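/- Let $\mathcal S$ be the unit sphere $S^2$, the Euclidean plane $E^2$ or the Lobachevskij (hyperbolic) plane $\mathbb L^2$, with its geodesic distance $d$. A segment joining $x$ to $y$ is an arc of a geodesic from $x$ to $y$ of length $d(x,y)$. A set $Q\subset\mathcal S$ is convex if any two of its points are joined by a unique segment and this segment lies in $Q$. The convex hull of a set is the intersection of all convex sets containing it. The perimeter $\mathfrak p(Q)$ of a bounded convex set $Q$ is the length of its boundary, i.e. the supremum of the lengths of the closed convex polygons with vertices on $\partial Q$; here a segment run through back and forth counts as a closed polygon, so that the perimeter of a segment is twice its length. The length $\ell(\gamma)$ of a curve is the supremum of the lengths of the inscribed geodesic polygonal lines. An absolutely continuous curve $\gamma:[a,b]\to\mathcal S$ is a $\mathcal G$-curve if for every $s_0\in[a,b]$ at which $\dot\gamma_{s_0}$ exists and is not $0$, all points $\gamma_s$ with $a\le s\le s_0$ lie in the same one of the two closed half spaces bounded by the line through $\gamma_{s_0}$ normal to $\dot\gamma_{s_0}$. The projecting sector of $\gamma$ at $\gamma_s$ is the smallest closed convex sector with vertex $\gamma_s$, bounded by two geodesic rays issuing from $\gamma_s$ (which may coincide), that contains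 $\gamma([a,s])$. **Theorem.** Let $\gamma:[a,b]\to\mathcal S$ be a $\mathcal G$-curve with convex hull $\widehat\gamma$ and, in the case $\mathcal S=S^2$, assume also that $\operatorname{diam}\gamma([a,b])<\frac{\pi}{2}$. Then: 1. $\ell(\gamma)\le\mathfrak p(\widehat\gamma)$. 2. If $\ell(\gamma)=\mathfrak p(\widehat\gamma)$, then for almost every $s\in[a,b]$ such that $\dot\gamma_s$ exists and $\dot\gamma_s\neq0$, the projecting sector of $\gamma$ at $\gamma_s$ exists, the angle between the tangent vectors $v_1,v_2$ at $\gamma_s$ of its two boundary rays is $\frac{\pi}{2}$, and $v_1$ or $v_2$ is tangent to $\gamma$ at $\gamma_s$ (i.e. parallel to $\dot\gamma_s$). 3. For every bounded convex set $Q\subset\mathcal S$ with $\gamma([a,b])\subset Q$ one has $\ell(\gamma)\le\mathfrak p(Q)$. -/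

import Mathlib

open Set

/-- The three simply connected complete surfaces of constant curvature `1`, `0`, `-1`. -/
inductive SpaceForm where
  | sphere
  | plane
  | lobachevskij

noncomputable section

namespace SpaceForm

/-- The symmetric bilinear form on `ℝ³` that induces the Riemannian metric of the surface on its
tangent planes: `dx₁² + dx₂² + K dx₃²` with `K = 1, 0, -1`. -/
def form : SpaceForm → (Fin 3 → ℝ) → (Fin 3 → ℝ) → ℝ
  | sphere, x, y => x 0 * y 0 + x 1 * y 1 + x 2 * y 2
  | plane, x, y => x 0 * y 0 + x 1 * y 1
  | lobachevskij, x, y => x 0 * y 0 + x 1 * y 1 - x 2 * y 2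

/-- The surface as a subset of `ℝ³`: the unit sphere, the Euclidean plane `{x₃ = 1}`, and the upper
sheet of the hyperboloid `x₁² + x₂² - x₃² = -1`. -/
def Mem : SpaceForm → (Fin 3 → ℝ) → Prop
  | sphere, x => form sphere x x = 1
  | plane, x => x 2 = 1
  | lobachevskij, x => form lobachevskij x x = -1 ∧ 0 < x 2

/-- The points of the surface, with the topology induced by `ℝ³`. -/
abbrev Surface (M : SpaceForm) : Type := {x : Fin 3 → ℝ // M.Mem x}

/-- `v` lies in the tangent plane of the surface at `x`. -/
def IsTangent : (M : SpaceForm) → M.Surface → (Fin 3 → ℝ) → Prop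
  | sphere, x, v => form sphere x v = 0
  | plane, _, v => v 2 = 0
  | lobachevskij, x, v => form lobachevskij x v = 0

/-- `v` is a unit tangent vector at `x`. -/
def IsUnitTangent (M : SpaceForm) (x : M.Surface) (v : Fin 3 → ℝ) : Prop :=
  M.IsTangent x v ∧ M.form v v = 1

/-- The Riemannian norm of a tangent vector. -/
def tnorm (M : SpaceForm) (v : Fin 3 → ℝ) : ℝ := Real.sqrt (M.form v v)

/-- The angle between two tangent vectors at the same point. -/
def angle (M : SpaceForm) (v w : Fin 3 → ℝ) : ℝ :=
  Real.arccos (M.form v w / (M.tnorm v * M.tnorm w))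

/-- The geodesic (Riemannian) distance. -/
def gdist : (M : SpaceForm) → M.Surface → M.Surface → ℝ
  | sphere, x, y => Real.arccos (form sphere x y)
  | plane, x, y => Real.sqrt (form plane ((x : Fin 3 → ℝ) - y) ((x : Fin 3 → ℝ) - y))
  | lobachevskij, x, y => Real.arcosh (-form lobachevskij x y)

/-- The geodesic with unit speed that starts at `x` in the direction of the unit tangent
vector `v`. -/
def geodesic : (M : SpaceForm) → M.Surface → (Fin 3 → ℝ) → ℝ → (Fin 3 → ℝ)
  | sphere, x, v, t => Real.cos t • (x : Fin 3 → ℝ) + Real.sin t • v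
  | plane, x, v, t => (x : Fin 3 → ℝ) + t • v
  | lobachevskij, x, v, t => Real.cosh t • (x : Fin 3 → ℝ) + Real.sinh t • v

/-- `A` is a segment joining `x` to `y`: an arc of a geodesic from `x` to `y` whose length is
the distance of `x` and `y`. -/
def IsSegment (M : SpaceForm) (x y : M.Surface) (A : Set M.Surface) : Prop :=
  ∃ v, M.IsUnitTangent x v ∧ M.geodesic x v (M.gdist x y) = (y : Fin 3 → ℝ) ∧
    A = {z : M.Surface | ∃ t ∈ Icc 0 (M.gdist x y), M.geodesic x v t = (z : Fin 3 → ℝ)}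

/-- `Q` is convex: any two points of `Q` are joined by a unique segment, and it lies in `Q`. -/
def IsConvex (M : SpaceForm) (Q : Set M.Surface) : Prop :=
  ∀ x ∈ Q, ∀ y ∈ Q, (∃! A, M.IsSegment x y A) ∧ ∀ A, M.IsSegment x y A → A ⊆ Q

/-- The convex hull: the intersection of all convex sets that contain `A`. -/
def hull (M : SpaceForm) (A : Set M.Surface) : Set M.Surface :=
  ⋂₀ {Q | M.IsConvex Q ∧ A ⊆ Q}

/-- The diameter of `A` for the geodesic distance. -/
def diam (M : SpaceForm) (A : Set M.Surface) : ENNReal :=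
  ⨆ (x ∈ A) (y ∈ A), ENNReal.ofReal (M.gdist x y)

/-- The length of the restriction of the curve `γ` to `[a, b]`: the supremum of the lengths of the
geodesic polygonal lines inscribed in it. -/
def length (M : SpaceForm) (γ : ℝ → M.Surface) (a b : ℝ) : ENNReal :=
  ⨆ (n : ℕ) (t : ℕ → ℝ) (_ : Monotone t) (_ : ∀ i, t i ∈ Icc a b),
    ∑ i ∈ Finset.range n, ENNReal.ofReal (M.gdist (γ (t i)) (γ (t (i + 1))))

/-- The points `p 0, …, p n` are, in this order, the vertices of a strictly convex polygon run
through counterclockwise: `p i, p j, p k` is a positively oriented triangle whenever `i < j < k`.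
(The sign of the determinant is the orientation of the triangle of the radial projections to the
plane `{x₃ = 1}`.) One point and two points (a segment run through back and forth) are allowed. -/
def IsConvexPolygon (M : SpaceForm) {n : ℕ} (p : Fin (n + 1) → M.Surface) : Prop :=
  ∀ i j k, i < j → j < k →
    0 < Matrix.det (Matrix.of ![(p i : Fin 3 → ℝ), (p j : Fin 3 → ℝ), (p k : Fin 3 → ℝ)])

/-- The perimeter of a convex set `Q`: the length of the boundary of `Q`, i.e. the supremum of
the lengths of the closed convex polygons with vertices on the boundary of `Q`. The perimeter of
a segment is twice its length. (In `p (i + 1)` the addition is cyclic, and so the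
polygon is closed.) -/
def perimeter (M : SpaceForm) (Q : Set M.Surface) : ENNReal :=
  ⨆ (n : ℕ) (p : Fin (n + 1) → M.Surface) (_ : ∀ i, p i ∈ frontier Q) (_ : M.IsConvexPolygon p),
    ENNReal.ofReal (∑ i, M.gdist (p i) (p (i + 1)))

/-- `u` is the velocity at `s` of the restriction of `γ` to `[a, b]` (one-sided at the end
points). -/
def HasVelocity (M : SpaceForm) (γ : ℝ → M.Surface) (a b s : ℝ) (u : Fin 3 → ℝ) : Prop :=
  HasDerivWithinAt (fun t => (γ t : Fin 3 → ℝ)) u (Icc a b) s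

/-- The restriction of `γ` to `[a, b]` is a `𝒢`-curve: it is absolutely continuous and, wherever
the velocity `u` at `s₀` exists and is not zero, all points `γ s` with `s ≤ s₀` lie in the same one
of the two closed half spaces bounded by the normal line `{y | form (y - γ s₀) u = 0}`, which
is the geodesic line through `γ s₀` orthogonal to `u`. -/
structure IsGCurve (M : SpaceForm) (γ : ℝ → M.Surface) (a b : ℝ) : Prop where
  absolutelyContinuous : AbsolutelyContinuousOnInterval (fun t => (γ t : Fin 3 → ℝ)) a b
  halfSpace : ∀ s₀ ∈ Icc a b, ∀ u, u ≠ 0 → M.HasVelocity γ a b s₀ u →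
    (∀ s ∈ Icc a s₀, M.form ((γ s : Fin 3 → ℝ) - γ s₀) u ≤ 0) ∨
    (∀ s ∈ Icc a s₀, 0 ≤ M.form ((γ s : Fin 3 → ℝ) - γ s₀) u)

/-- `C` is a closed convex sector bounded by the two geodesic rays from `x` with the unit tangent
vectors `v` and `w`. It consists of the points on the geodesics (half great circles on the sphere)
that start at `x` in a direction `α v + β w` with `α, β ≥ 0`. If `w = -v` it is one of the two half
planes bounded by the line through `x` tangent to `v`. If `w = v` it is a ray. (The coefficient `c`
is determined by `α, β` up to, on the sphere, its sign.) -/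
def IsSector (M : SpaceForm) (x : M.Surface) (v w : Fin 3 → ℝ) (C : Set M.Surface) : Prop :=
  M.IsUnitTangent x v ∧ M.IsUnitTangent x w ∧
    ((w ≠ -v ∧ C = {y : M.Surface | ∃ c α β : ℝ, 0 ≤ α ∧ 0 ≤ β ∧
        (y : Fin 3 → ℝ) = c • (x : Fin 3 → ℝ) + α • v + β • w}) ∨
     (w = -v ∧ ∃ n, M.IsUnitTangent x n ∧ M.form v n = 0 ∧
        C = {y : M.Surface | ∃ c α β : ℝ, 0 ≤ β ∧
          (y : Fin 3 → ℝ) = c • (x : Fin 3 → ℝ) + α • v + β • n}))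

/-- The smallest closed convex sector with vertex `x` that contains `A` exists, and its boundary
rays have the unit tangent vectors `v` and `w` at `x`. -/
def IsSmallestSector (M : SpaceForm) (x : M.Surface) (A : Set M.Surface)
    (v w : Fin 3 → ℝ) : Prop :=
  ∃ C, M.IsSector x v w C ∧ A ⊆ C ∧ ∀ v' w' C', M.IsSector x v' w' C' → A ⊆ C' → C ⊆ C'

/-- `v` and `w` are the unit tangent vectors of the boundary rays of the projecting sector
at `γ s` of the curve `γ` on `[a, b]`. -/
def IsProjectingSector (M : SpaceForm) (γ : ℝ → M.Surface) (a s : ℝ)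
    (v w : Fin 3 → ℝ) : Prop :=
  M.IsSmallestSector (γ s) (γ '' Icc a s) v w

end SpaceForm

end

/-! The proof is integral geometry in the gnomonic chart `{0 < x 2}`. For a direction `θ`, `lineDist
θ` is the signed distance from a line through the pole. Its `θ`-derivative `supp θ` is an increasing
function of the chart coordinate in direction `θ`, so it serves as a support number in all three
geometries. The `width` of a set is the integral over `θ` of the maximum of `supp θ` on it.

The width controls the length. Let `F s` be the width of the past `γ [a, s]`. If the past lies in a
right-angled sector at `γ s` with sides `v`, `w`, then `γ s` has the largest support number for all
`θ` in an interval. Over this interval the gain of width integrates to a difference of two values of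
`lineDist`, whose gradients are `-v` and `w`. Hence `F' ≥ -⟨u, v⟩ - ⟨u, w⟩` for the velocity `u`
(`le_deriv_width_past`). For a `𝒢`-curve such a sector exists, and it can be chosen to contain the
backward tangent: the past lies behind the normal line, and since the distance to each earlier point
does not decrease, two past points are seen at an angle of at most `π / 2`. If the backward tangent
makes the angles `φ` and `π / 2 - φ` with the sides, the rate is `|u| (cos φ + sin φ) ≥ |u|`. So the
speed is at most `F'` almost everywhere, and Lebesgue's inequality for the monotone function `F`
gives length `≤ F b` (`IsGCurve.length_le_width`).

If equality holds, then `F' = |u|` almost everywhere, so `φ` is `0` or `π / 2` for every admissible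
sector. The admissible sectors form an interval, so there is only one; it has a side along the
tangent and is the projecting sector (`IsGCurve.tnorm_le`).

The perimeter controls the width. A closed polygon is at least as long as the width of its vertex
set, by Crofton's inequality for each side (`width_range_le_sum_gdist`). Going outward in direction
`θ` from a point of `Q` one meets the boundary of `Q`, so the boundary dominates `Q` in every
direction, and so does, up to `ε`, a convex polygon spanned by a finite net of the boundary
(`width_le_perimeter`). On the sphere a reflection first moves `Q` into the chart. This is
impossible if the closure of `Q` contains antipodal points, but then the perimeter is at least `2π`,
which bounds every width (`IsConvex.exists_isMotion_width_le_perimeter`). -/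

namespace SpaceForm

/-! ### Support numbers in the gnomonic chart and Crofton's inequality. -/

/-- The Gaussian curvature of the surface. -/
def curv : SpaceForm → ℝ
  | sphere => 1
  | plane => 0
  | lobachevskij => -1

/-- The coordinate in the horizontal direction `(cos θ, sin θ, 0)`. -/
noncomputable def radial (θ : ℝ) (x : Fin 3 → ℝ) : ℝ := Real.cos θ * x 0 + Real.sin θ * x 1

/-- The coordinate in the horizontal direction `(sin θ, -cos θ, 0)`. -/
noncomputable def transverse (θ : ℝ) (x : Fin 3 → ℝ) : ℝ := Real.sin θ * x 0 - Real.cos θ * x 1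

/-- The inverse of the sine of the space form: `arcsin`, the identity, or `arsinh`. -/
noncomputable def asn : SpaceForm → ℝ → ℝ
  | sphere => Real.arcsin
  | plane => id
  | lobachevskij => Real.arsinh

/-- The signed distance of a point from the line `{transverse θ = 0}` through `(0, 0, 1)`. -/
noncomputable def lineDist (M : SpaceForm) (θ : ℝ) (x : Fin 3 → ℝ) : ℝ := M.asn (transverse θ x)

/-- The support number of a point in direction `θ`: a monotone function of the position of the
point in the gnomonic chart, normalized so that it is the `θ`-derivative of `lineDist`. -/
noncomputable def supp (M : SpaceForm) (θ : ℝ) (x : Fin 3 → ℝ) : ℝ :=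
  radial θ x / Real.sqrt (1 - M.curv * transverse θ x ^ 2)

/-- The component of the velocity `v` at `x` in direction `θ` of the gnomonic chart, times
`(x 2) ^ 2`. -/
noncomputable def slope (θ : ℝ) (x v : Fin 3 → ℝ) : ℝ := x 2 * radial θ v - radial θ x * v 2

variable {M : SpaceForm} {x y : Fin 3 → ℝ} {θ : ℝ}

/-- The equation of the surface in the rotated coordinates `radial`, `transverse` and `x 2`. -/
lemma one_sub_curv_mul (hx : M.Mem x) (θ : ℝ) :
    1 - M.curv * transverse θ x ^ 2 = x 2 ^ 2 + M.curv * radial θ x ^ 2 := by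
  have h := Real.sin_sq_add_cos_sq θ
  cases M <;> simp only [Mem, form, curv, transverse, radial] at *
  · linear_combination -(x 0 ^ 2 + x 1 ^ 2) * h - hx
  · rw [hx]; ring
  · linear_combination (x 0 ^ 2 + x 1 ^ 2) * h + hx.1

lemma one_sub_curv_pos (hx : M.Mem x) (h2 : 0 < x 2) (θ : ℝ) :
    0 < 1 - M.curv * transverse θ x ^ 2 := by
  cases M
  · rw [one_sub_curv_mul hx]; simp only [curv]; positivity
  · simp [curv]
  · simp only [curv]; nlinarith [sq_nonneg (transverse θ x)]

lemma hasDerivAt_asn {m : ℝ} (h : 0 < 1 - M.curv * m ^ 2) :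
    HasDerivAt M.asn (1 / Real.sqrt (1 - M.curv * m ^ 2)) m := by
  cases M
  · simp only [curv, asn, one_mul] at *
    exact Real.hasDerivAt_arcsin (by rintro rfl; norm_num at h) (by rintro rfl; norm_num at h)
  · simp only [curv, asn] at *
    simpa using hasDerivAt_id m
  · simp only [curv, asn] at *
    simpa using Real.hasDerivAt_arsinh m

lemma contDiffAt_asn {m : ℝ} (h : 0 < 1 - M.curv * m ^ 2) : ContDiffAt ℝ 1 M.asn m := by
  cases M
  · simp only [curv, asn, one_mul] at *
    exact Real.contDiffAt_arcsin (by rintro rfl; norm_num at h) (by rintro rfl; norm_num at h)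
  · exact contDiffAt_id
  · exact Real.contDiff_arsinh.contDiffAt

lemma hasDerivAt_transverse (x : Fin 3 → ℝ) (θ : ℝ) :
    HasDerivAt (fun θ => transverse θ x) (radial θ x) θ := by
  refine (((Real.hasDerivAt_sin θ).mul_const (x 0)).sub
    ((Real.hasDerivAt_cos θ).mul_const (x 1))).congr_deriv ?_
  simp only [radial]; ring

lemma continuous_transverse : Continuous fun p : ℝ × (Fin 3 → ℝ) => transverse p.1 p.2 := by
  unfold transverse; fun_prop

lemma continuous_radial : Continuous fun p : ℝ × (Fin 3 → ℝ) => radial p.1 p.2 := by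
  unfold radial; fun_prop

lemma hasDerivAt_lineDist (hx : M.Mem x) (h2 : 0 < x 2) (θ : ℝ) :
    HasDerivAt (fun θ => M.lineDist θ x) (M.supp θ x) θ := by
  refine ((hasDerivAt_asn (one_sub_curv_pos hx h2 θ)).comp θ
    (hasDerivAt_transverse x θ)).congr_deriv ?_
  simp only [supp]; ring

lemma continuousOn_supp :
    ContinuousOn (fun p : ℝ × (Fin 3 → ℝ) => M.supp p.1 p.2) {p | M.Mem p.2 ∧ 0 < p.2 2} := by
  unfold supp
  refine continuous_radial.continuousOn.div ?_ ?_
  · exact (Real.continuous_sqrt.comp (continuous_const.sub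
      (continuous_const.mul (continuous_transverse.pow 2)))).continuousOn
  · rintro ⟨θ, x⟩ ⟨hx, h2⟩
    exact (Real.sqrt_pos.2 (one_sub_curv_pos hx h2 θ)).ne'

lemma continuous_supp (hx : M.Mem x) (h2 : 0 < x 2) : Continuous fun θ => M.supp θ x := by
  unfold supp
  refine (continuous_radial.comp (Continuous.prodMk_left x)).div
    (Real.continuous_sqrt.comp (continuous_const.sub (continuous_const.mul
      ((continuous_transverse.comp (Continuous.prodMk_left x)).pow 2)))) fun θ => ?_
  exact (Real.sqrt_pos.2 (one_sub_curv_pos hx h2 θ)).ne'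

lemma integral_supp (hx : M.Mem x) (h2 : 0 < x 2) (α β : ℝ) :
    ∫ θ in α..β, M.supp θ x = M.lineDist β x - M.lineDist α x :=
  intervalIntegral.integral_eq_sub_of_hasDerivAt (fun θ _ => hasDerivAt_lineDist hx h2 θ)
    ((continuous_supp hx h2).intervalIntegrable _ _)

lemma radial_add_pi (θ : ℝ) (x : Fin 3 → ℝ) : radial (θ + Real.pi) x = -radial θ x := by
  simp [radial]; ring

lemma transverse_add_pi (θ : ℝ) (x : Fin 3 → ℝ) :
    transverse (θ + Real.pi) x = -transverse θ x := by
  simp [transverse]; ring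

lemma supp_add_pi (M : SpaceForm) (θ : ℝ) (x : Fin 3 → ℝ) :
    M.supp (θ + Real.pi) x = -M.supp θ x := by
  simp [supp, radial_add_pi, transverse_add_pi, neg_div]

lemma lineDist_add_pi (M : SpaceForm) (θ : ℝ) (x : Fin 3 → ℝ) :
    M.lineDist (θ + Real.pi) x = -M.lineDist θ x := by
  cases M <;> simp [lineDist, transverse_add_pi, asn]

lemma supp_add_two_pi (M : SpaceForm) (θ : ℝ) (x : Fin 3 → ℝ) :
    M.supp (θ + 2 * Real.pi) x = M.supp θ x := by
  rw [two_mul, ← add_assoc, supp_add_pi, supp_add_pi, neg_neg]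

/-- Monotonicity of `p / √(1 + k p²)` for either sign of `k`: after cross-multiplying and squaring,
the terms with `k` cancel and `p ^ 2 - q ^ 2` is left. -/
lemma mul_sqrt_le_mul_sqrt {k p q A B : ℝ} (hA : A = 1 + k * p ^ 2) (hB : B = 1 + k * q ^ 2)
    (hA0 : 0 < A) (hB0 : 0 < B) (h : p ≤ q) : p / Real.sqrt A ≤ q / Real.sqrt B := by
  have sA := Real.sqrt_pos.2 hA0
  have sB := Real.sqrt_pos.2 hB0
  have qA := Real.sq_sqrt hA0.le
  have qB := Real.sq_sqrt hB0.le
  rw [div_le_div_iff₀ sA sB]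
  set a := Real.sqrt A
  set b := Real.sqrt B
  have key : (p * b) ^ 2 - (q * a) ^ 2 = p ^ 2 - q ^ 2 := by
    rw [mul_pow, mul_pow, qA, qB, hA, hB]; ring
  rcases le_or_gt 0 p with hp | hp
  · have hq : 0 ≤ q := hp.trans h
    refine abs_le_of_sq_le_sq' (by nlinarith) (by positivity) |>.2
  · rcases le_or_gt 0 q with hq | hq
    · nlinarith [mul_nonneg hq sA.le, mul_pos (neg_pos.2 hp) sB]
    · have := abs_le_of_sq_le_sq' (a := q * a) (b := -(p * b)) (by nlinarith)
        (by nlinarith [mul_pos (neg_pos.2 hp) sB])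
      linarith [this.1]

/-- Both numerator and radicand are homogeneous in `radial` and `x 2`, so only the gnomonic
coordinate `radial θ x / x 2` survives. -/
lemma supp_eq (hx : M.Mem x) (h2 : 0 < x 2) (θ : ℝ) :
    M.supp θ x = (radial θ x / x 2) / Real.sqrt (1 + M.curv * (radial θ x / x 2) ^ 2) := by
  have : 1 - M.curv * transverse θ x ^ 2 =
      x 2 ^ 2 * (1 + M.curv * (radial θ x / x 2) ^ 2) := by
    rw [one_sub_curv_mul hx]; field_simp
  rw [supp, this, Real.sqrt_mul (sq_nonneg _), Real.sqrt_sq h2.le, div_div]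

lemma one_add_curv_pos (hx : M.Mem x) (h2 : 0 < x 2) (θ : ℝ) :
    0 < 1 + M.curv * (radial θ x / x 2) ^ 2 := by
  have : 1 + M.curv * (radial θ x / x 2) ^ 2 = (1 - M.curv * transverse θ x ^ 2) / x 2 ^ 2 := by
    rw [one_sub_curv_mul hx]; field_simp
  rw [this]
  exact div_pos (one_sub_curv_pos hx h2 θ) (by positivity)

/-- The support number is monotone in the gnomonic coordinate. -/
lemma supp_le_supp (hx : M.Mem x) (hx2 : 0 < x 2) (hy : M.Mem y) (hy2 : 0 < y 2)
    (h : radial θ x * y 2 ≤ radial θ y * x 2) : M.supp θ x ≤ M.supp θ y := by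
  rw [supp_eq hx hx2, supp_eq hy hy2]
  exact mul_sqrt_le_mul_sqrt rfl rfl (one_add_curv_pos hx hx2 θ) (one_add_curv_pos hy hy2 θ)
    ((div_le_div_iff₀ hx2 hy2).2 h)

/-- For `M = sphere` the support numbers are bounded by `1`. -/
lemma supp_sphere_le_one (hx : sphere.Mem x) (h2 : 0 < x 2) (θ : ℝ) : sphere.supp θ x ≤ 1 := by
  have h := one_sub_curv_pos hx h2 θ
  have h' := one_sub_curv_mul hx θ
  rw [supp, div_le_one (Real.sqrt_pos.2 h)]
  apply Real.le_sqrt_of_sq_le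
  rw [h']; simp only [curv]; nlinarith [sq_nonneg (x 2)]

lemma form_eq (M : SpaceForm) (θ : ℝ) (x y : Fin 3 → ℝ) :
    M.form x y = radial θ x * radial θ y + transverse θ x * transverse θ y +
      M.curv * (x 2 * y 2) := by
  have h := Real.sin_sq_add_cos_sq θ
  cases M <;> simp only [form, curv, transverse, radial] <;>
    linear_combination -(x 0 * y 0 + x 1 * y 1) * h

lemma transverse_sphere_mem (hx : sphere.Mem x) (θ : ℝ) :
    -1 ≤ transverse θ x ∧ transverse θ x ≤ 1 := by
  have h := one_sub_curv_mul hx θ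
  simp only [curv] at h
  constructor <;> nlinarith [sq_nonneg (x 2), sq_nonneg (radial θ x)]

lemma abs_sub_le_arccos {a b c d : ℝ}
    (ha : |a - b| ≤ Real.pi) (hc : c = Real.cos (a - b)) (hd : d ≤ c) :
    |a - b| ≤ Real.arccos d := by
  rw [← Real.arccos_cos (abs_nonneg _) ha, Real.cos_abs, ← hc]
  exact Real.arccos_le_arccos hd

/-- The signed distance from a line is `1`-Lipschitz. -/
lemma abs_lineDist_sub_le (x y : M.Surface) (hx2 : 0 < (x : Fin 3 → ℝ) 2)
    (hy2 : 0 < (y : Fin 3 → ℝ) 2) (θ : ℝ) :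
    |M.lineDist θ x - M.lineDist θ y| ≤ M.gdist x y := by
  obtain ⟨x, hx⟩ := x
  obtain ⟨y, hy⟩ := y
  simp only at hx2 hy2 ⊢
  have hX := one_sub_curv_mul hx θ
  have hY := one_sub_curv_mul hy θ
  have hX0 := one_sub_curv_pos hx hx2 θ
  have hY0 := one_sub_curv_pos hy hy2 θ
  cases M
  · have hF := form_eq sphere θ x y
    simp only [curv, one_mul] at *
    have tx := transverse_sphere_mem hx θ
    have ty := transverse_sphere_mem hy θ
    simp only [lineDist, asn, gdist]
    refine abs_sub_le_arccos ?_ rfl ?_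
    · rw [abs_le]
      constructor <;> linarith [Real.arcsin_le_pi_div_two (transverse θ x),
        Real.neg_pi_div_two_le_arcsin (transverse θ x), Real.arcsin_le_pi_div_two (transverse θ y),
        Real.neg_pi_div_two_le_arcsin (transverse θ y)]
    · rw [Real.cos_sub, Real.cos_arcsin, Real.cos_arcsin, Real.sin_arcsin tx.1 tx.2,
        Real.sin_arcsin ty.1 ty.2, hF, ← Real.sqrt_mul hX0.le, hX, hY]
      -- Cauchy–Schwarz for the pairs `(radial, x 2)`.
      have : radial θ x * radial θ y + x 2 * y 2 ≤
          Real.sqrt ((x 2 ^ 2 + radial θ x ^ 2) * (y 2 ^ 2 + radial θ y ^ 2)) := by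
        apply Real.le_sqrt_of_sq_le
        nlinarith [sq_nonneg (radial θ x * y 2 - radial θ y * x 2)]
      linarith
  · simp only [lineDist, asn, gdist, id]
    apply Real.abs_le_sqrt
    rw [form_eq plane θ]
    simp only [curv, radial, transverse, Pi.sub_apply]
    nlinarith [sq_nonneg (Real.cos θ * (x 0 - y 0) + Real.sin θ * (x 1 - y 1))]
  · have hF := form_eq lobachevskij θ x y
    simp only [curv] at *
    simp only [lineDist, asn, gdist]
    set a := Real.arsinh (transverse θ x) with ha
    set b := Real.arsinh (transverse θ y) with hb
    have h1 : Real.cosh |a - b| = Real.sqrt ((1 - -1 * transverse θ x ^ 2) *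
        (1 - -1 * transverse θ y ^ 2)) - transverse θ x * transverse θ y := by
      rw [Real.cosh_abs, Real.cosh_sub, ha, hb, Real.sinh_arsinh, Real.sinh_arsinh,
        Real.cosh_arsinh, Real.cosh_arsinh, Real.sqrt_mul hX0.le]
      ring_nf
    rw [← Real.arcosh_cosh (abs_nonneg (a - b))]
    have h2 : Real.cosh |a - b| ≤ -form lobachevskij x y := by
      rw [h1, hF, hX, hY]
      -- The reversed Cauchy–Schwarz inequality for the timelike pairs `(radial, x 2)`.
      have : Real.sqrt ((x 2 ^ 2 + -1 * radial θ x ^ 2) * (y 2 ^ 2 + -1 * radial θ y ^ 2)) ≤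
          x 2 * y 2 - radial θ x * radial θ y := by
        have e1 : radial θ x ^ 2 ≤ x 2 ^ 2 := by nlinarith [sq_nonneg (transverse θ x)]
        have e2 : radial θ y ^ 2 ≤ y 2 ^ 2 := by nlinarith [sq_nonneg (transverse θ y)]
        have a1 := abs_le_of_sq_le_sq e1 hx2.le
        have a2 := abs_le_of_sq_le_sq e2 hy2.le
        have : radial θ x * radial θ y ≤ x 2 * y 2 := by
          calc _ ≤ |radial θ x * radial θ y| := le_abs_self _
            _ = |radial θ x| * |radial θ y| := abs_mul _ _
            _ ≤ _ := by gcongr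
        rw [Real.sqrt_le_left (by linarith)]
        nlinarith [sq_nonneg (radial θ x * y 2 - radial θ y * x 2)]
      linarith
    exact (Real.arcosh_le_arcosh (Real.cosh_pos _)
      ((Real.cosh_pos _).trans_le h2)).2 h2

/-- The distance of two points of a line orthogonal to `{transverse θ = 0}`. -/
lemma abs_lineDist_sub_eq (x y : M.Surface) (hx2 : 0 < (x : Fin 3 → ℝ) 2)
    (hy2 : 0 < (y : Fin 3 → ℝ) 2) (h : radial θ x * (y : Fin 3 → ℝ) 2 =
      radial θ y * (x : Fin 3 → ℝ) 2) :
    |M.lineDist θ x - M.lineDist θ y| = M.gdist x y := by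
  obtain ⟨x, hx⟩ := x
  obtain ⟨y, hy⟩ := y
  simp only at hx2 hy2 h ⊢
  have hX := one_sub_curv_mul hx θ
  have hY := one_sub_curv_mul hy θ
  have hX0 := one_sub_curv_pos hx hx2 θ
  have hY0 := one_sub_curv_pos hy hy2 θ
  cases M
  · have hF := form_eq sphere θ x y
    simp only [curv, one_mul] at *
    have tx := transverse_sphere_mem hx θ
    have ty := transverse_sphere_mem hy θ
    simp only [lineDist, asn, gdist]
    rw [← Real.arccos_cos (abs_nonneg _) (x := |_ - _|), Real.cos_abs]
    · rw [Real.cos_sub, Real.cos_arcsin, Real.cos_arcsin, Real.sin_arcsin tx.1 tx.2,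
        Real.sin_arcsin ty.1 ty.2, hF, ← Real.sqrt_mul hX0.le, hX, hY]
      -- By `h` the pairs `(radial, x 2)` are proportional, so Cauchy–Schwarz is an equality.
      have : (x 2 ^ 2 + radial θ x ^ 2) * (y 2 ^ 2 + radial θ y ^ 2) =
          (radial θ x * radial θ y + x 2 * y 2) ^ 2 := by
        linear_combination (radial θ x * y 2 - radial θ y * x 2) * h
      have e : 0 ≤ radial θ x * radial θ y + x 2 * y 2 := by
        have e1 : (radial θ x * radial θ y) * (x 2 * y 2) = (radial θ x * y 2) ^ 2 := by
          linear_combination -(radial θ x * y 2) * h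
        have e2 := mul_pos hx2 hy2
        have : 0 ≤ radial θ x * radial θ y := by
          by_contra hc; nlinarith [sq_nonneg (radial θ x * y 2)]
        positivity
      rw [this, Real.sqrt_sq e]
      congr 1; ring
    · rw [abs_le]
      constructor <;> linarith [Real.arcsin_le_pi_div_two (transverse θ x),
        Real.neg_pi_div_two_le_arcsin (transverse θ x), Real.arcsin_le_pi_div_two (transverse θ y),
        Real.neg_pi_div_two_le_arcsin (transverse θ y)]
  · simp only [lineDist, asn, gdist, id]
    rw [← Real.sqrt_sq_eq_abs]
    congr 1
    rw [form_eq plane θ]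
    simp only [Mem] at hx hy
    rw [hx, hy] at h
    simp only [curv, radial, transverse, Pi.sub_apply] at *
    linear_combination -(Real.cos θ * (x 0 - y 0) + Real.sin θ * (x 1 - y 1)) * h
  · have hF := form_eq lobachevskij θ x y
    simp only [curv] at *
    simp only [lineDist, asn, gdist]
    set a := Real.arsinh (transverse θ x) with ha
    set b := Real.arsinh (transverse θ y) with hb
    have h1 : Real.cosh |a - b| = Real.sqrt ((1 - -1 * transverse θ x ^ 2) *
        (1 - -1 * transverse θ y ^ 2)) - transverse θ x * transverse θ y := by
      rw [Real.cosh_abs, Real.cosh_sub, ha, hb, Real.sinh_arsinh, Real.sinh_arsinh,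
        Real.cosh_arsinh, Real.cosh_arsinh, Real.sqrt_mul hX0.le]
      ring_nf
    rw [← Real.arcosh_cosh (abs_nonneg (a - b)), h1, hF, hX, hY]
    have : (x 2 ^ 2 + -1 * radial θ x ^ 2) * (y 2 ^ 2 + -1 * radial θ y ^ 2) =
        (x 2 * y 2 - radial θ x * radial θ y) ^ 2 := by
      linear_combination -(radial θ x * y 2 - radial θ y * x 2) * h
    have e : 0 ≤ x 2 * y 2 - radial θ x * radial θ y := by
      have e1 : radial θ x ^ 2 ≤ x 2 ^ 2 := by nlinarith [sq_nonneg (transverse θ x)]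
      have e2 : radial θ y ^ 2 ≤ y 2 ^ 2 := by nlinarith [sq_nonneg (transverse θ y)]
      have a1 := abs_le_of_sq_le_sq e1 hx2.le
      have a2 := abs_le_of_sq_le_sq e2 hy2.le
      have : radial θ x * radial θ y ≤ x 2 * y 2 := by
        calc _ ≤ |radial θ x * radial θ y| := le_abs_self _
          _ = |radial θ x| * |radial θ y| := abs_mul _ _
          _ ≤ _ := by gcongr
      linarith
    rw [this, Real.sqrt_sq e]
    congr 1; ring

/-- Polar coordinates with the angle in a prescribed period. -/
lemma exists_polar (p q θ₀ : ℝ) (h : p ≠ 0 ∨ q ≠ 0) :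
    ∃ r > 0, ∃ θ ∈ Ico θ₀ (θ₀ + 2 * Real.pi), p = -r * Real.sin θ ∧ q = r * Real.cos θ := by
  set z : ℂ := ⟨q, -p⟩ with hz
  have hz0 : z ≠ 0 := by
    intro h0
    have h1 := congrArg Complex.re h0
    have h2 := congrArg Complex.im h0
    simp [hz] at h1 h2
    exact h.elim (fun h => h h2) (fun h => h h1)
  refine ⟨‖z‖, norm_pos_iff.2 hz0, toIcoMod Real.two_pi_pos θ₀ z.arg,
    toIcoMod_mem_Ico _ _ _, ?_, ?_⟩
  · rw [toIcoMod, zsmul_eq_mul, Real.sin_sub_int_mul_two_pi, neg_mul, Complex.norm_mul_sin_arg]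
    simp [hz]
  · rw [toIcoMod, zsmul_eq_mul, Real.cos_sub_int_mul_two_pi, Complex.norm_mul_cos_arg]

/-- The chord between the two chart points is orthogonal to some direction; if the points coincide
in the chart, any direction will do. -/
lemma exists_radial_eq (x y : Fin 3 → ℝ) : ∃ θ, radial θ x * y 2 = radial θ y * x 2 := by
  by_cases h : x 0 * y 2 - y 0 * x 2 ≠ 0 ∨ x 1 * y 2 - y 1 * x 2 ≠ 0
  · obtain ⟨r, hr, θ, -, h1, h2⟩ := exists_polar _ _ 0 h
    refine ⟨θ, ?_⟩
    simp only [radial]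
    linear_combination Real.cos θ * h1 + Real.sin θ * h2
  · push Not at h
    refine ⟨0, ?_⟩
    simp only [radial, Real.cos_zero, Real.sin_zero]
    linear_combination h.1

/-- `radial φ x * y 2 - radial φ y * x 2` is a constant times `sin (φ - θ)`, so the difference of
the support numbers has one sign on this half turn. Its integral is a difference of values of
`lineDist`, and the factor `2` appears because `lineDist` changes sign after a half turn. -/
lemma integral_abs_supp_sub_half (x y : M.Surface) (hx2 : 0 < (x : Fin 3 → ℝ) 2)
    (hy2 : 0 < (y : Fin 3 → ℝ) 2) (h : radial θ x * (y : Fin 3 → ℝ) 2 =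
      radial θ y * (x : Fin 3 → ℝ) 2) :
    ∫ φ in θ..θ + Real.pi, |M.supp φ x - M.supp φ y| ≤ 2 * M.gdist x y := by
  have hcx := continuous_supp x.2 hx2
  have hcy := continuous_supp y.2 hy2
  have hint : ∫ φ in θ..θ + Real.pi, (M.supp φ x - M.supp φ y) =
      -2 * (M.lineDist θ x - M.lineDist θ y) := by
    rw [intervalIntegral.integral_sub (hcx.intervalIntegrable _ _) (hcy.intervalIntegrable _ _),
      integral_supp x.2 hx2, integral_supp y.2 hy2, lineDist_add_pi, lineDist_add_pi]
    ring
  have hb := abs_lineDist_sub_le x y hx2 hy2 θ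
  have hpi := Real.pi_pos
  have hrot : ∀ φ, radial φ x * (y : Fin 3 → ℝ) 2 - radial φ y * (x : Fin 3 → ℝ) 2 =
      Real.sin (φ - θ) * (-(transverse θ x * (y : Fin 3 → ℝ) 2) +
        transverse θ y * (x : Fin 3 → ℝ) 2) := by
    intro φ
    have e : ∀ z : Fin 3 → ℝ, radial φ z =
        Real.cos (φ - θ) * radial θ z - Real.sin (φ - θ) * transverse θ z := by
      intro z
      rw [Real.cos_sub, Real.sin_sub, radial, radial, transverse]
      linear_combination -(Real.cos φ * z 0 + Real.sin φ * z 1) * Real.sin_sq_add_cos_sq θ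
    rw [e x, e y]
    linear_combination Real.cos (φ - θ) * h
  have hsin : ∀ φ ∈ Icc θ (θ + Real.pi), 0 ≤ Real.sin (φ - θ) := fun φ hφ =>
    Real.sin_nonneg_of_nonneg_of_le_pi (by linarith [hφ.1]) (by linarith [hφ.2])
  rcases le_total 0 (-(transverse θ x * (y : Fin 3 → ℝ) 2) +
        transverse θ y * (x : Fin 3 → ℝ) 2) with hs | hs
  · have : ∫ φ in θ..θ + Real.pi, |M.supp φ x - M.supp φ y| =
        ∫ φ in θ..θ + Real.pi, (M.supp φ x - M.supp φ y) := by
      refine intervalIntegral.integral_congr fun φ hφ => ?_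
      rw [uIcc_of_le (by linarith)] at hφ
      refine abs_of_nonneg (sub_nonneg.2 (supp_le_supp y.2 hy2 x.2 hx2 ?_))
      nlinarith [hrot φ, mul_nonneg (hsin φ hφ) hs]
    rw [this, hint]
    linarith [(abs_le.1 hb).1]
  · have : ∫ φ in θ..θ + Real.pi, |M.supp φ x - M.supp φ y| =
        ∫ φ in θ..θ + Real.pi, -(M.supp φ x - M.supp φ y) := by
      refine intervalIntegral.integral_congr fun φ hφ => ?_
      rw [uIcc_of_le (by linarith)] at hφ
      refine abs_of_nonpos (sub_nonpos.2 (supp_le_supp x.2 hx2 y.2 hy2 ?_))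
      nlinarith [hrot φ, mul_nonneg (hsin φ hφ) (neg_nonneg.2 hs)]
    rw [this, intervalIntegral.integral_neg, hint]
    linarith [(abs_le.1 hb).2]

/-- Crofton's inequality for two points. -/
lemma integral_abs_supp_sub_le (x y : M.Surface) (hx2 : 0 < (x : Fin 3 → ℝ) 2)
    (hy2 : 0 < (y : Fin 3 → ℝ) 2) :
    ∫ φ in 0..2 * Real.pi, |M.supp φ x - M.supp φ y| ≤ 4 * M.gdist x y := by
  obtain ⟨θ, h⟩ := exists_radial_eq x y
  have hc : Continuous fun φ => |M.supp φ x - M.supp φ y| :=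
    ((continuous_supp x.2 hx2).sub (continuous_supp y.2 hy2)).abs
  have hper : Function.Periodic (fun φ => |M.supp φ x - M.supp φ y|) (2 * Real.pi) := fun φ => by
    simp only [supp_add_two_pi]
  have h0 := hper.intervalIntegral_add_eq 0 θ
  rw [zero_add] at h0
  rw [h0, ← intervalIntegral.integral_add_adjacent_intervals (b := θ + Real.pi)
    (hc.intervalIntegrable _ _) (hc.intervalIntegrable _ _)]
  have h1 := integral_abs_supp_sub_half x y hx2 hy2 h
  have h2 := integral_abs_supp_sub_half (θ := θ + Real.pi) x y hx2 hy2
    (by rw [radial_add_pi, radial_add_pi]; linarith)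
  rw [show θ + Real.pi + Real.pi = θ + 2 * Real.pi by ring] at h2
  linarith

end SpaceForm

/-! ### The support function and the width of a compact set. -/

namespace SpaceForm

variable {M : SpaceForm} {x y : Fin 3 → ℝ} {θ : ℝ}

/-- A nonempty compact subset of the domain `{0 < x 2}` of the gnomonic chart. -/
structure IsChartCompact (M : SpaceForm) (A : Set (Fin 3 → ℝ)) : Prop where
  isCompact : IsCompact A
  nonempty : A.Nonempty
  mem : ∀ x ∈ A, M.Mem x
  pos : ∀ x ∈ A, 0 < x 2

/-- The support function of a set. -/
noncomputable def supMax (M : SpaceForm) (A : Set (Fin 3 → ℝ)) (θ : ℝ) : ℝ := sSup (M.supp θ '' A)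

/-- The integral of the support function of a set, by Cauchy's formula the perimeter of its convex
hull. -/
noncomputable def width (M : SpaceForm) (A : Set (Fin 3 → ℝ)) : ℝ :=
  ∫ θ in 0..2 * Real.pi, M.supMax A θ

namespace IsChartCompact

variable {A B : Set (Fin 3 → ℝ)}

lemma continuousOn_supp (hA : M.IsChartCompact A) (θ : ℝ) : ContinuousOn (M.supp θ) A :=
  SpaceForm.continuousOn_supp.comp (f := fun x => (θ, x)) (by fun_prop)
    fun x hx => ⟨hA.mem x hx, hA.pos x hx⟩

lemma isCompact_image (hA : M.IsChartCompact A) (θ : ℝ) : IsCompact (M.supp θ '' A) :=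
  hA.isCompact.image_of_continuousOn (hA.continuousOn_supp θ)

lemma le_supMax (hA : M.IsChartCompact A) (hx : x ∈ A) : M.supp θ x ≤ M.supMax A θ :=
  le_csSup (hA.isCompact_image θ).bddAbove (mem_image_of_mem _ hx)

lemma supMax_le (hA : M.IsChartCompact A) {c : ℝ} (h : ∀ x ∈ A, M.supp θ x ≤ c) :
    M.supMax A θ ≤ c :=
  csSup_le (hA.nonempty.image _) (by rintro _ ⟨x, hx, rfl⟩; exact h x hx)

lemma exists_supMax_eq (hA : M.IsChartCompact A) (θ : ℝ) :
    ∃ x ∈ A, M.supMax A θ = M.supp θ x := by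
  obtain ⟨x, hx, h⟩ := (hA.isCompact_image θ).sSup_mem (hA.nonempty.image _)
  exact ⟨x, hx, h.symm⟩

lemma continuous_supMax (hA : M.IsChartCompact A) : Continuous (M.supMax A) := by
  have := hA.isCompact
  have hc : CompactSpace A := isCompact_iff_compactSpace.1 this
  have h : Continuous fun θ => sSup ((fun x : A => M.supp θ x) '' univ) := by
    refine isCompact_univ.continuous_sSup ?_
    exact SpaceForm.continuousOn_supp.comp_continuous
      (f := fun p : ℝ × A => (p.1, (p.2 : Fin 3 → ℝ))) (by fun_prop)
      fun p => ⟨hA.mem _ p.2.2, hA.pos _ p.2.2⟩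
  convert h using 2 with θ
  rw [supMax, image_univ]
  congr 1
  ext z; simp

lemma supMax_add_two_pi (A : Set (Fin 3 → ℝ)) : Function.Periodic (M.supMax A) (2 * Real.pi) := by
  intro θ
  simp only [supMax]
  congr 1
  exact image_congr fun x _ => supp_add_two_pi M θ x

lemma width_eq (A : Set (Fin 3 → ℝ)) (θ : ℝ) :
    M.width A = ∫ φ in θ..θ + 2 * Real.pi, M.supMax A φ := by
  have := (supMax_add_two_pi (M := M) A).intervalIntegral_add_eq 0 θ
  rw [← this, zero_add, width]

lemma supMax_mono (hA : M.IsChartCompact A) (hB : M.IsChartCompact B) (h : A ⊆ B) (θ : ℝ) :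
    M.supMax A θ ≤ M.supMax B θ := hA.supMax_le fun _ hx => hB.le_supMax (h hx)

lemma width_mono (hA : M.IsChartCompact A) (hB : M.IsChartCompact B) (h : A ⊆ B) :
    M.width A ≤ M.width B :=
  intervalIntegral.integral_mono_on (μ := MeasureTheory.volume) Real.two_pi_pos.le
    (hA.continuous_supMax.intervalIntegrable _ _)
    (hB.continuous_supMax.intervalIntegrable _ _) fun θ _ => hA.supMax_mono hB h θ

lemma width_le_add (hA : M.IsChartCompact A) (hB : M.IsChartCompact B) {ε : ℝ}
    (h : ∀ θ ∈ Icc 0 (2 * Real.pi), M.supMax A θ ≤ M.supMax B θ + ε) :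
    M.width A ≤ M.width B + 2 * Real.pi * ε := by
  have := intervalIntegral.integral_mono_on (μ := MeasureTheory.volume) Real.two_pi_pos.le
    (hA.continuous_supMax.intervalIntegrable _ _)
    ((hB.continuous_supMax.add (continuous_const (y := ε))).intervalIntegrable _ _) h
  refine this.trans_eq ((intervalIntegral.integral_add
    (hB.continuous_supMax.intervalIntegrable _ _) (by simp)).trans ?_)
  rw [intervalIntegral.integral_const]
  simp [width]

/-- The support numbers of a single point of `A` integrate to zero over the full turn, as `lineDist`
is periodic. -/
lemma width_nonneg (hA : M.IsChartCompact A) : 0 ≤ M.width A := by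
  obtain ⟨x, hx⟩ := hA.nonempty
  have h := intervalIntegral.integral_mono_on (μ := MeasureTheory.volume) Real.two_pi_pos.le
    ((continuous_supp (hA.mem x hx) (hA.pos x hx)).intervalIntegrable _ _)
    (hA.continuous_supMax.intervalIntegrable _ _) fun θ _ => hA.le_supMax hx
  rw [integral_supp (hA.mem x hx) (hA.pos x hx)] at h
  have e : M.lineDist (2 * Real.pi) x = M.lineDist 0 x := by simp [lineDist, transverse]
  rwa [e, sub_self] at h

/-- Needed for convex sets with antipodal points in the closure, whose perimeter is at least this
bound. -/
lemma width_sphere_le {A : Set (Fin 3 → ℝ)} (hA : sphere.IsChartCompact A) :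
    sphere.width A ≤ 2 * Real.pi := by
  have h := intervalIntegral.integral_mono_on (μ := MeasureTheory.volume) Real.two_pi_pos.le
    (hA.continuous_supMax.intervalIntegrable _ _)
    (continuous_const (y := (1 : ℝ)).intervalIntegrable _ _) fun θ _ =>
      hA.supMax_le fun x hx => supp_sphere_le_one (hA.mem x hx) (hA.pos x hx) θ
  simpa [width] using h

/-- Enlarging a set by a point `z` increases the width at least by the integral of the increase of
the support numbers over an interval of directions in which `x` supports the set. -/
lemma lineDist_sub_le_width_sub (hA : M.IsChartCompact A) (hB : M.IsChartCompact B) (hAB : A ⊆ B)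
    {z : Fin 3 → ℝ} (hx : x ∈ A) (hz : z ∈ B) {θ₁ θ₂ : ℝ} (h12 : θ₁ ≤ θ₂)
    (h2 : θ₂ ≤ θ₁ + 2 * Real.pi)
    (h : ∀ θ ∈ Icc θ₁ θ₂, ∀ y ∈ A, M.supp θ y ≤ M.supp θ x) :
    (M.lineDist θ₂ z - M.lineDist θ₁ z) - (M.lineDist θ₂ x - M.lineDist θ₁ x) ≤
      M.width B - M.width A := by
  have cA := hA.continuous_supMax
  have cB := hB.continuous_supMax
  have i1 : ∀ α β : ℝ, IntervalIntegrable (fun φ => M.supMax B φ - M.supMax A φ)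
      MeasureTheory.volume α β := fun α β => (cB.sub cA).intervalIntegrable _ _
  have cx := continuous_supp (hA.mem x hx) (hA.pos x hx)
  have cz := continuous_supp (hB.mem z hz) (hB.pos z hz)
  rw [width_eq B θ₁, width_eq A θ₁, ← intervalIntegral.integral_sub (cB.intervalIntegrable _ _)
    (cA.intervalIntegrable _ _), ← integral_supp (hB.mem z hz) (hB.pos z hz),
    ← integral_supp (hA.mem x hx) (hA.pos x hx),
    ← intervalIntegral.integral_sub (cz.intervalIntegrable _ _) (cx.intervalIntegrable _ _),
    ← intervalIntegral.integral_add_adjacent_intervals (i1 θ₁ θ₂) (i1 θ₂ _)]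
  have e1 : ∫ φ in θ₁..θ₂, (M.supp φ z - M.supp φ x) ≤
      ∫ φ in θ₁..θ₂, (M.supMax B φ - M.supMax A φ) :=
    intervalIntegral.integral_mono_on h12 ((cz.sub cx).intervalIntegrable _ _) (i1 _ _)
      fun φ hφ => sub_le_sub (hB.le_supMax hz) (hA.supMax_le (h φ hφ))
  have e2 : 0 ≤ ∫ φ in θ₂..θ₁ + 2 * Real.pi, (M.supMax B φ - M.supMax A φ) :=
    intervalIntegral.integral_nonneg h2 fun φ _ => sub_nonneg.2 (hA.supMax_mono hB hAB φ)
  linarith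

end IsChartCompact

-- A closed walk through `g i` and `g j` covers the gap between them twice, once each way.
open Fin.NatCast in
lemma two_mul_sub_le_sum_abs_sub {n : ℕ} (g : Fin (n + 1) → ℝ) (i j : Fin (n + 1)) :
    2 * (g i - g j) ≤ ∑ k, |g k - g (k + 1)| := by
  set f : ℕ → ℝ := fun k => g ((k : Fin (n + 1)) + i) with hf
  have hsum : ∑ k, |g k - g (k + 1)| = ∑ k ∈ Finset.range (n + 1), dist (f k) (f (k + 1)) := by
    rw [← Equiv.sum_comp (Equiv.addRight i),
      ← Fin.sum_univ_eq_sum_range (fun k => dist (f k) (f (k + 1)))]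
    refine Finset.sum_congr rfl fun k _ => ?_
    simp only [hf, Equiv.coe_addRight, Real.dist_eq, Nat.cast_add, Nat.cast_one,
      Fin.cast_val_eq_self, add_right_comm]
  obtain ⟨m, hm⟩ : ∃ m : ℕ, m = (j - i : Fin (n + 1)).val := ⟨_, rfl⟩
  have hmn : m ≤ n + 1 := by rw [hm]; exact (j - i).is_lt.le
  have h0 : f 0 = g i := by simp [hf]
  have hN : f (n + 1) = g i := by simp [hf]
  have hj : f m = g j := by simp [hf, hm]
  have e1 := dist_le_range_sum_dist f m
  have e2 := dist_le_Ico_sum_dist f hmn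
  rw [hsum, ← Finset.sum_range_add_sum_Ico _ hmn]
  rw [h0, hj, Real.dist_eq] at e1
  rw [hN, hj, Real.dist_eq] at e2
  have := le_abs_self (g i - g j)
  rw [abs_sub_comm] at e2
  linarith

/-- The length of a closed polygon is at least the width of the set of its vertices. -/
lemma width_range_le_sum_gdist {n : ℕ} (p : Fin (n + 1) → M.Surface)
    (hp : ∀ i, 0 < (p i : Fin 3 → ℝ) 2) :
    M.width (range fun i => (p i : Fin 3 → ℝ)) ≤ ∑ i, M.gdist (p i) (p (i + 1)) := by
  set A : Set (Fin 3 → ℝ) := range fun i => (p i : Fin 3 → ℝ) with hAdef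
  have hA : M.IsChartCompact A := by
    refine ⟨(finite_range _).isCompact, range_nonempty _, ?_, ?_⟩
    · rintro _ ⟨i, rfl⟩; exact (p i).2
    · rintro _ ⟨i, rfl⟩; exact hp i
  have hcont : ∀ i, Continuous fun θ => |M.supp θ (p i) - M.supp θ (p (i + 1))| := fun i =>
    ((continuous_supp (p i).2 (hp i)).sub (continuous_supp (p _).2 (hp _))).abs
  have h1 : ∫ θ in 0..2 * Real.pi, ∑ i, |M.supp θ (p i) - M.supp θ (p (i + 1))| ≤
      4 * ∑ i, M.gdist (p i) (p (i + 1)) := by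
    rw [intervalIntegral.integral_finsetSum fun i _ => (hcont i).intervalIntegrable _ _,
      Finset.mul_sum]
    exact Finset.sum_le_sum fun i _ => integral_abs_supp_sub_le _ _ (hp _) (hp _)
  have cA := hA.continuous_supMax
  have cA' : Continuous fun θ => M.supMax A (θ + Real.pi) := cA.comp (by fun_prop)
  -- The least support number in direction `θ` is minus the largest one in direction `θ + π`; over a
  -- full turn both terms integrate to the width.
  have h2 : ∫ θ in 0..2 * Real.pi, 2 * (M.supMax A θ + M.supMax A (θ + Real.pi)) ≤
      ∫ θ in 0..2 * Real.pi, ∑ i, |M.supp θ (p i) - M.supp θ (p (i + 1))| := by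
    refine intervalIntegral.integral_mono_on (μ := MeasureTheory.volume) Real.two_pi_pos.le
      ((continuous_const.mul (cA.add cA')).intervalIntegrable _ _)
      ((continuous_finsetSum _ fun i _ => hcont i).intervalIntegrable _ _) fun θ _ => ?_
    obtain ⟨_, ⟨i, rfl⟩, hi⟩ := hA.exists_supMax_eq θ
    obtain ⟨_, ⟨j, rfl⟩, hj⟩ := hA.exists_supMax_eq (θ + Real.pi)
    rw [hi, hj, supp_add_pi, ← sub_eq_add_neg]
    exact two_mul_sub_le_sum_abs_sub (fun i => M.supp θ (p i)) i j
  rw [intervalIntegral.integral_const_mul, intervalIntegral.integral_add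
    (cA.intervalIntegrable _ _) (cA'.intervalIntegrable _ _),
    intervalIntegral.integral_comp_add_right (fun θ => M.supMax A θ), zero_add,
    add_comm (2 * Real.pi), ← IsChartCompact.width_eq, ← width] at h2
  linarith

/-! ### Tangent vectors in the chart and the directions dual to a right-angled sector. -/

lemma isTangent_iff_form (h : M ≠ plane) (x : M.Surface) (v : Fin 3 → ℝ) :
    M.IsTangent x v ↔ M.form x v = 0 := by
  cases M
  · rfl
  · exact absurd rfl h
  · rfl

/-- At `x` the tangent vectors have the orthogonal coordinates `transverse θ` and `slope θ x`. -/
lemma one_sub_curv_mul_form (x : M.Surface) {u v : Fin 3 → ℝ} (hu : M.IsTangent x u)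
    (hv : M.IsTangent x v) (θ : ℝ) :
    (1 - M.curv * transverse θ x ^ 2) * M.form u v =
      transverse θ u * transverse θ v + slope θ x u * slope θ x v := by
  have hM := one_sub_curv_mul x.2 θ
  by_cases hp : M = plane
  · subst hp
    have hx := x.2
    rw [form_eq plane θ]
    simp only [IsTangent, Mem, curv, slope] at *
    rw [hu, hv, hx]; ring
  · rw [isTangent_iff_form hp, form_eq M θ] at hu hv
    have hK : M.curv ^ 2 = 1 := by cases M <;> simp_all [curv]
    rw [form_eq M θ, slope, slope]
    generalize M.curv = K at *
    generalize (x : Fin 3 → ℝ) 2 = z at *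
    generalize radial θ x = r at *
    generalize transverse θ x = m at *
    generalize radial θ u = ru at *
    generalize radial θ v = rv at *
    generalize transverse θ u = mu at *
    generalize transverse θ v = mv at *
    linear_combination (ru * rv + K * (u 2 * v 2)) * hM + K * (r * rv + K * (z * v 2)) * hu -
      K * m * mu * hv - (z * u 2 * (r * rv + z * v 2 * K) - z ^ 2 * K * (u 2 * v 2)) * hK +
      (u 2 * v 2 * r ^ 2 - ru * v 2 * z * r - K * u 2 * v 2 * z ^ 2) * hK

/-- For a tangent vector with `slope` zero this compares the sign of `transverse` with that of the
transverse velocity in the chart. -/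
lemma mul_transverse_eq (x : M.Surface) {v : Fin 3 → ℝ} (hv : M.IsTangent x v) (θ : ℝ) :
    (x : Fin 3 → ℝ) 2 * transverse θ v = (1 - M.curv * transverse θ x ^ 2) *
      ((x : Fin 3 → ℝ) 2 * transverse θ v - transverse θ x * v 2) -
      M.curv * transverse θ x * radial θ x * slope θ x v := by
  have hM := one_sub_curv_mul x.2 θ
  by_cases hp : M = plane
  · subst hp
    simp only [IsTangent, curv, slope] at *
    rw [hv]; ring
  · rw [isTangent_iff_form hp, form_eq M θ] at hv
    have hK : M.curv ^ 2 = 1 := by cases M <;> simp_all [curv]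
    rw [slope]
    generalize M.curv = K at *
    generalize (x : Fin 3 → ℝ) 2 = z at *
    generalize radial θ x = r at *
    generalize transverse θ x = m at *
    generalize radial θ v = rv at *
    generalize transverse θ v = mv at *
    linear_combination m * v 2 * hM + K * m * z * hv - m * z ^ 2 * v 2 * hK

end SpaceForm

namespace SpaceForm

variable {M : SpaceForm} {x y : Fin 3 → ℝ} {θ : ℝ}

lemma slope_eq (θ : ℝ) (x v : Fin 3 → ℝ) : slope θ x v =
    Real.cos θ * (x 2 * v 0 - x 0 * v 2) + Real.sin θ * (x 2 * v 1 - x 1 * v 2) := by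
  simp only [slope, radial]; ring

/-- The gnomonic chart is an immersion: the two numbers are the chart velocity times `(x 2) ^ 2`. -/
lemma chart_ne_zero (x : M.Surface) (h2 : 0 < (x : Fin 3 → ℝ) 2) {v : Fin 3 → ℝ}
    (hv : M.IsUnitTangent x v) :
    (x : Fin 3 → ℝ) 2 * v 0 - (x : Fin 3 → ℝ) 0 * v 2 ≠ 0 ∨
      (x : Fin 3 → ℝ) 2 * v 1 - (x : Fin 3 → ℝ) 1 * v 2 ≠ 0 := by
  by_contra! h
  have hs : slope 0 x v = 0 := by rw [slope_eq, h.1, h.2]; ring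
  have ht := mul_transverse_eq x hv.1 0
  have e : (x : Fin 3 → ℝ) 2 * transverse 0 v - transverse 0 x * v 2 = 0 := by
    simp only [transverse, Real.sin_zero, Real.cos_zero]; linear_combination -h.2
  rw [e, hs] at ht
  have ht0 : transverse 0 v = 0 := by
    have : (x : Fin 3 → ℝ) 2 * transverse 0 v = 0 := by linarith
    exact (mul_eq_zero.1 this).resolve_left h2.ne'
  have hf := one_sub_curv_mul_form x hv.1 hv.1 0
  rw [hs, ht0, hv.2] at hf
  linarith [one_sub_curv_pos x.2 h2 0]

/-- The gradient of `lineDist θ` at `x` is the unit tangent vector `-v` orthogonal to `slope θ`. -/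
lemma transverse_div_sqrt_eq (x : M.Surface) (h2 : 0 < (x : Fin 3 → ℝ) 2) {v : Fin 3 → ℝ}
    (hv : M.IsUnitTangent x v) {r : ℝ} (hr : 0 < r)
    (hp : (x : Fin 3 → ℝ) 2 * v 0 - (x : Fin 3 → ℝ) 0 * v 2 = -r * Real.sin θ)
    (hq : (x : Fin 3 → ℝ) 2 * v 1 - (x : Fin 3 → ℝ) 1 * v 2 = r * Real.cos θ)
    {u : Fin 3 → ℝ} (hu : M.IsTangent x u) :
    transverse θ u / Real.sqrt (1 - M.curv * transverse θ x ^ 2) = -M.form u v := by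
  have hpos := one_sub_curv_pos x.2 h2 θ
  have hs : slope θ x v = 0 := by rw [slope_eq, hp, hq]; ring
  have e : (x : Fin 3 → ℝ) 2 * transverse θ v - transverse θ x * v 2 = -r := by
    simp only [transverse]
    linear_combination Real.sin θ * hp - Real.cos θ * hq - r * Real.sin_sq_add_cos_sq θ
  have ht := mul_transverse_eq x hv.1 θ
  rw [e, hs] at ht
  -- This selects the sign of the square root in `hroot`.
  have hneg : transverse θ v < 0 := by
    by_contra! hc
    nlinarith [mul_nonneg h2.le hc, mul_pos hpos hr]
  have hsq := one_sub_curv_mul_form x hv.1 hv.1 θ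
  have huv := one_sub_curv_mul_form x hu hv.1 θ
  rw [hs, hv.2] at hsq
  rw [hs] at huv
  have hroot : Real.sqrt (1 - M.curv * transverse θ x ^ 2) = -transverse θ v := by
    rw [show 1 - M.curv * transverse θ x ^ 2 = (-transverse θ v) ^ 2 by linarith]
    exact Real.sqrt_sq (by linarith)
  rw [hroot, div_eq_iff (by linarith)]
  have : transverse θ v * (transverse θ u) = transverse θ v * (M.form u v * transverse θ v) := by
    linear_combination -huv + M.form u v * hsq
  have := mul_left_cancel₀ hneg.ne this
  linarith

lemma IsUnitTangent.neg {x : M.Surface} {v : Fin 3 → ℝ} (hv : M.IsUnitTangent x v) :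
    M.IsUnitTangent x (-v) := by
  obtain ⟨h1, h2⟩ := hv
  cases M <;> refine ⟨?_, ?_⟩ <;> simp only [IsTangent, form, Pi.neg_apply] at * <;> linarith

lemma form_neg_right (M : SpaceForm) (u v : Fin 3 → ℝ) : M.form u (-v) = -M.form u v := by
  cases M <;> simp only [form, Pi.neg_apply] <;> ring

lemma form_comm (M : SpaceForm) (u v : Fin 3 → ℝ) : M.form u v = M.form v u := by
  cases M <;> simp only [form] <;> ring

/-- The directions in which `x` supports the sector at `x` spanned by the orthonormal vectors `v`
and `w`. -/
lemma exists_directions_of_pos (x : M.Surface) (h2 : 0 < (x : Fin 3 → ℝ) 2) {v w : Fin 3 → ℝ}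
    (hv : M.IsUnitTangent x v) (hw : M.IsUnitTangent x w)
    (hdet : 0 < ((x : Fin 3 → ℝ) 2 * v 0 - (x : Fin 3 → ℝ) 0 * v 2) *
      ((x : Fin 3 → ℝ) 2 * w 1 - (x : Fin 3 → ℝ) 1 * w 2) -
      ((x : Fin 3 → ℝ) 2 * w 0 - (x : Fin 3 → ℝ) 0 * w 2) *
      ((x : Fin 3 → ℝ) 2 * v 1 - (x : Fin 3 → ℝ) 1 * v 2)) :
    ∃ θ₁ θ₂, θ₁ ≤ θ₂ ∧ θ₂ ≤ θ₁ + 2 * Real.pi ∧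
      (∀ u, M.IsTangent x u →
        transverse θ₂ u / Real.sqrt (1 - M.curv * transverse θ₂ x ^ 2) -
        transverse θ₁ u / Real.sqrt (1 - M.curv * transverse θ₁ x ^ 2) =
        -M.form u v - M.form u w) ∧
      ∀ θ ∈ Icc θ₁ θ₂, slope θ x v ≤ 0 ∧ slope θ x w ≤ 0 := by
  -- The angle `θ₁` belongs to `-w` and `θ₂` to `v`, so the gradients of `lineDist` at the ends of
  -- the interval are `w` and `-v`.
  obtain ⟨r, hr, θ₁, -, hp1, hq1⟩ := exists_polar _ _ 0 (chart_ne_zero x h2 hw.neg)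
  obtain ⟨t, ht, θ₂, hθ, hp2, hq2⟩ := exists_polar _ _ θ₁ (chart_ne_zero x h2 hv)
  have hp1' : (x : Fin 3 → ℝ) 2 * w 0 - (x : Fin 3 → ℝ) 0 * w 2 = r * Real.sin θ₁ := by
    simp only [Pi.neg_apply] at hp1; linarith
  have hq1' : (x : Fin 3 → ℝ) 2 * w 1 - (x : Fin 3 → ℝ) 1 * w 2 = -r * Real.cos θ₁ := by
    simp only [Pi.neg_apply] at hq1; linarith
  -- The orientation of `(v, w)` says that `θ₂ - θ₁` lies in `(0, π)`. Therefore `sin (θ₂ - θ)` and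
  -- `sin (θ - θ₁)`, which give the two slopes up to negative factors, are nonnegative on the
  -- interval.
  have hsin : 0 < Real.sin (θ₂ - θ₁) := by
    rw [hp1', hq1', hp2, hq2] at hdet
    have : 0 < (r * t) * Real.sin (θ₂ - θ₁) := by rw [Real.sin_sub]; nlinarith
    exact pos_of_mul_pos_right this (by positivity)
  have hlt : θ₂ - θ₁ < Real.pi := by
    by_contra! hc
    have h := Real.sin_nonneg_of_nonneg_of_le_pi (x := θ₂ - θ₁ - Real.pi) (by linarith)
      (by linarith [hθ.2])
    rw [Real.sin_sub_pi] at h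
    linarith
  refine ⟨θ₁, θ₂, hθ.1, hθ.2.le, fun u hu => ?_, fun θ h => ⟨?_, ?_⟩⟩
  · rw [transverse_div_sqrt_eq x h2 hv ht hp2 hq2 hu,
      transverse_div_sqrt_eq x h2 hw.neg hr hp1 hq1 hu, form_neg_right]
    ring
  · rw [slope_eq, hp2, hq2]
    have := Real.sin_nonneg_of_nonneg_of_le_pi (x := θ₂ - θ) (by linarith [h.2])
      (by linarith [h.1])
    rw [Real.sin_sub] at this
    nlinarith
  · rw [slope_eq, hp1', hq1']
    have := Real.sin_nonneg_of_nonneg_of_le_pi (x := θ - θ₁) (by linarith [h.1])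
      (by linarith [h.2])
    rw [Real.sin_sub] at this
    nlinarith

lemma exists_directions (x : M.Surface) (h2 : 0 < (x : Fin 3 → ℝ) 2) {v w : Fin 3 → ℝ}
    (hv : M.IsUnitTangent x v) (hw : M.IsUnitTangent x w) (hvw : M.form v w = 0) :
    ∃ θ₁ θ₂, θ₁ ≤ θ₂ ∧ θ₂ ≤ θ₁ + 2 * Real.pi ∧
      (∀ u, M.IsTangent x u →
        transverse θ₂ u / Real.sqrt (1 - M.curv * transverse θ₂ x ^ 2) -
        transverse θ₁ u / Real.sqrt (1 - M.curv * transverse θ₁ x ^ 2) =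
        -M.form u v - M.form u w) ∧
      ∀ θ ∈ Icc θ₁ θ₂, slope θ x v ≤ 0 ∧ slope θ x w ≤ 0 := by
  rcases lt_trichotomy 0 (((x : Fin 3 → ℝ) 2 * v 0 - (x : Fin 3 → ℝ) 0 * v 2) *
      ((x : Fin 3 → ℝ) 2 * w 1 - (x : Fin 3 → ℝ) 1 * w 2) -
      ((x : Fin 3 → ℝ) 2 * w 0 - (x : Fin 3 → ℝ) 0 * w 2) *
      ((x : Fin 3 → ℝ) 2 * v 1 - (x : Fin 3 → ℝ) 1 * v 2)) with h | h | h
  · exact exists_directions_of_pos x h2 hv hw h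
  -- If `v` and `w` were parallel in the chart, both would have `slope` zero for one `θ`, and their
  -- Gram determinant would vanish although they are orthonormal.
  · exfalso
    obtain ⟨r, hr, θ, -, hp, hq⟩ := exists_polar _ _ 0 (chart_ne_zero x h2 hv)
    rw [hp, hq] at h
    have hpos := one_sub_curv_pos x.2 h2 θ
    have hsv : slope θ x v = 0 := by rw [slope_eq, hp, hq]; ring
    have hsw : slope θ x w = 0 := by
      rw [slope_eq]
      have : r * (Real.cos θ * ((x : Fin 3 → ℝ) 2 * w 0 - (x : Fin 3 → ℝ) 0 * w 2) +
        Real.sin θ * ((x : Fin 3 → ℝ) 2 * w 1 - (x : Fin 3 → ℝ) 1 * w 2)) = 0 := by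
        linear_combination h
      exact (mul_eq_zero.1 this).resolve_left hr.ne'
    have e1 := one_sub_curv_mul_form x hv.1 hw.1 θ
    have e2 := one_sub_curv_mul_form x hv.1 hv.1 θ
    have e3 := one_sub_curv_mul_form x hw.1 hw.1 θ
    rw [hsv, hvw] at e1
    rw [hsv, hv.2] at e2
    rw [hsw, hw.2] at e3
    have : (1 - M.curv * transverse θ x ^ 2) * (1 - M.curv * transverse θ x ^ 2) = 0 := by
      linear_combination (1 - M.curv * transverse θ x ^ 2) * e2 +
        (transverse θ v * transverse θ v) * e3 - (transverse θ v * transverse θ w) * e1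
    nlinarith
  · obtain ⟨θ₁, θ₂, h1, h2, h3, h4⟩ := exists_directions_of_pos x h2 hw hv (by linarith)
    exact ⟨θ₁, θ₂, h1, h2, fun u hu => by rw [h3 u hu]; ring, fun θ h => (h4 θ h).symm⟩

/-! ### Growth of the width along a curve. -/

/-- The part `γ [a, s]` of a curve as a subset of `ℝ³`. -/
def past (γ : ℝ → M.Surface) (a s : ℝ) : Set (Fin 3 → ℝ) :=
  (fun t => (γ t : Fin 3 → ℝ)) '' Icc a s

lemma isChartCompact_past {γ : ℝ → M.Surface} {a b s : ℝ}
    (hc : ContinuousOn (fun t => (γ t : Fin 3 → ℝ)) (Icc a b))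
    (hpos : ∀ t ∈ Icc a b, 0 < (γ t : Fin 3 → ℝ) 2) (hs : s ∈ Icc a b) :
    M.IsChartCompact (past γ a s) := by
  have hsub : Icc a s ⊆ Icc a b := Icc_subset_Icc_right hs.2
  refine ⟨isCompact_Icc.image_of_continuousOn (hc.mono hsub),
    (nonempty_Icc.2 hs.1).image _, ?_, ?_⟩
  · rintro _ ⟨t, -, rfl⟩; exact (γ t).2
  · rintro _ ⟨t, ht, rfl⟩; exact hpos t (hsub ht)

lemma past_mono (γ : ℝ → M.Surface) (a : ℝ) {s t : ℝ} (h : s ≤ t) :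
    past γ a s ⊆ past γ a t := image_mono (Icc_subset_Icc_right h)

lemma monotoneOn_width_past {γ : ℝ → M.Surface} {a b : ℝ}
    (hc : ContinuousOn (fun t => (γ t : Fin 3 → ℝ)) (Icc a b))
    (hpos : ∀ t ∈ Icc a b, 0 < (γ t : Fin 3 → ℝ) 2) :
    MonotoneOn (fun s => M.width (past γ a s)) (Icc a b) := fun _ hs _ ht h =>
  (isChartCompact_past hc hpos hs).width_mono (isChartCompact_past hc hpos ht) (past_mono γ a h)

lemma nonneg_of_hasDerivWithinAt {f : ℝ → ℝ} {f' s b : ℝ} (hsb : s < b)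
    (hf : HasDerivWithinAt f f' (Icc s b) s) (h : ∀ t ∈ Icc s b, f s ≤ f t) : 0 ≤ f' := by
  rw [hasDerivWithinAt_iff_tendsto_slope] at hf
  have hne : (nhdsWithin s (Icc s b \ {s})).NeBot := by
    rw [Icc_sdiff_left, ← mem_closure_iff_nhdsWithin_neBot, closure_Ioc hsb.ne]
    exact left_mem_Icc.2 hsb.le
  refine ge_of_tendsto hf ?_
  filter_upwards [self_mem_nhdsWithin] with t ht
  rw [slope_def_field]
  exact div_nonneg (sub_nonneg.2 (h t ht.1)) (sub_nonneg.2 ht.1.1)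

lemma HasVelocity.coord {γ : ℝ → M.Surface} {a b s : ℝ} {u : Fin 3 → ℝ}
    (h : M.HasVelocity γ a b s u) (i : Fin 3) :
    HasDerivWithinAt (fun t => (γ t : Fin 3 → ℝ) i) (u i) (Icc a b) s :=
  (hasDerivWithinAt_pi.1 h) i

lemma HasVelocity.isTangent {γ : ℝ → M.Surface} {a b s : ℝ} {u : Fin 3 → ℝ} (hab : a < b)
    (hs : s ∈ Icc a b) (h : M.HasVelocity γ a b s u) : M.IsTangent (γ s) u := by
  have hu : UniqueDiffWithinAt ℝ (Icc a b) s := uniqueDiffOn_Icc hab s hs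
  have h0 := h.coord 0
  have h1 := h.coord 1
  have h2 := h.coord 2
  cases M
  · have e := ((h0.mul h0).add (h1.mul h1)).add (h2.mul h2)
    have e' := e.congr (f₁ := fun _ => (1 : ℝ)) (fun t _ => (γ t).2.symm) (γ s).2.symm
    have := hu.eq_deriv _ e' (hasDerivWithinAt_const _ _ _)
    simp only [IsTangent, form]; linarith
  · have e' := h2.congr (f₁ := fun _ => (1 : ℝ)) (fun t _ => (γ t).2.symm) (γ s).2.symm
    exact hu.eq_deriv _ e' (hasDerivWithinAt_const _ _ _)
  · have e := ((h0.mul h0).add (h1.mul h1)).sub (h2.mul h2)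
    have e' := e.congr (f₁ := fun _ => (-1 : ℝ)) (fun t _ => (γ t).2.1.symm) (γ s).2.1.symm
    have := hu.eq_deriv _ e' (hasDerivWithinAt_const _ _ _)
    simp only [IsTangent, form]; linarith

lemma HasVelocity.lineDist {γ : ℝ → M.Surface} {a b s : ℝ} {u : Fin 3 → ℝ}
    (hpos : 0 < (γ s : Fin 3 → ℝ) 2) (h : M.HasVelocity γ a b s u) (θ : ℝ) :
    HasDerivWithinAt (fun t => M.lineDist θ (γ t))
      (transverse θ u / Real.sqrt (1 - M.curv * transverse θ (γ s) ^ 2)) (Icc a b) s := by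
  have ht : HasDerivWithinAt (fun t => transverse θ (γ t)) (transverse θ u) (Icc a b) s :=
    ((h.coord 0).const_mul _).sub ((h.coord 1).const_mul _)
  refine ((hasDerivAt_asn (one_sub_curv_pos (γ s).2 hpos θ)).comp_hasDerivWithinAt s
    ht).congr_deriv ?_
  ring

/-- If the past of `γ s` lies in the right-angled sector at `γ s` spanned by `v` and `w`, then the
width of the past grows at least at the rate `-⟨u, v⟩ - ⟨u, w⟩`, where `u` is the velocity. -/
lemma le_deriv_width_past {γ : ℝ → M.Surface} {a b s F' : ℝ} {u v w : Fin 3 → ℝ}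
    (hc : ContinuousOn (fun t => (γ t : Fin 3 → ℝ)) (Icc a b))
    (hpos : ∀ t ∈ Icc a b, 0 < (γ t : Fin 3 → ℝ) 2) (hs : s ∈ Ico a b)
    (hv : M.IsUnitTangent (γ s) v) (hw : M.IsUnitTangent (γ s) w) (hvw : M.form v w = 0)
    (hsector : ∀ t ∈ Icc a s, ∃ c α β : ℝ, 0 ≤ α ∧ 0 ≤ β ∧
      (γ t : Fin 3 → ℝ) = c • (γ s : Fin 3 → ℝ) + α • v + β • w)
    (hu : M.HasVelocity γ a b s u)
    (hF : HasDerivAt (fun s => M.width (past γ a s)) F' s) :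
    -M.form u v - M.form u w ≤ F' := by
  have hsI : s ∈ Icc a b := ⟨hs.1, hs.2.le⟩
  obtain ⟨θ₁, θ₂, h12, h21, hgrad, hsl⟩ := exists_directions (γ s) (hpos s hsI) hv hw hvw
  have hsub : Icc s b ⊆ Icc a b := Icc_subset_Icc_left hs.1
  -- The function `F - lineDist θ₂ + lineDist θ₁` along the curve has on `[s, b]` its least value at
  -- `s`, hence a nonnegative right derivative there.
  have hd := ((hF.hasDerivWithinAt (s := Icc s b)).sub
    ((hu.lineDist (hpos s hsI) θ₂).mono hsub)).add ((hu.lineDist (hpos s hsI) θ₁).mono hsub)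
  have hA := isChartCompact_past hc hpos hsI
  have key := nonneg_of_hasDerivWithinAt hs.2 hd fun t ht => by
    have hB := isChartCompact_past hc hpos (hsub ht)
    have := hA.lineDist_sub_le_width_sub hB (past_mono γ a ht.1)
      (mem_image_of_mem _ (right_mem_Icc.2 hs.1)) (mem_image_of_mem _
        (right_mem_Icc.2 (hs.1.trans ht.1))) h12 h21 (fun θ hθ y hy => by
      obtain ⟨τ, hτ, rfl⟩ := hy
      have hτb : τ ∈ Icc a b := ⟨hτ.1, hτ.2.trans hs.2.le⟩
      refine supp_le_supp (γ τ).2 (hpos τ hτb) (γ s).2 (hpos s hsI) ?_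
      obtain ⟨c, α, β, hα, hβ, he⟩ := hsector τ hτ
      have e : slope θ (γ s) (γ τ) = α * slope θ (γ s) v + β * slope θ (γ s) w := by
        rw [he]; simp only [slope, radial, Pi.add_apply, Pi.smul_apply, smul_eq_mul]; ring
      have hslope := hsl θ hθ
      have e2 : slope θ (γ s) (γ τ) ≤ 0 := by
        rw [e]; nlinarith [mul_nonneg hα (neg_nonneg.2 hslope.1),
          mul_nonneg hβ (neg_nonneg.2 hslope.2)]
      simp only [slope] at e2
      linarith)
    simp only [Pi.add_apply, Pi.sub_apply]
    linarith
  have := hgrad u (hu.isTangent (hs.1.trans_lt hs.2) hsI)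
  linarith

end SpaceForm

/-! ### Absolutely continuous curves and `𝒢`-curves. -/

namespace SpaceForm

variable {M : SpaceForm} {x y : Fin 3 → ℝ} {θ : ℝ}

lemma absolutelyContinuous_of_dist_le {X Y : Type*} [PseudoMetricSpace X] [PseudoMetricSpace Y]
    {f : ℝ → X} {g : ℝ → Y} {a b C : ℝ} (hf : AbsolutelyContinuousOnInterval f a b)
    (h : ∀ s ∈ uIcc a b, ∀ t ∈ uIcc a b, dist (g s) (g t) ≤ C * dist (f s) (f t)) :
    AbsolutelyContinuousOnInterval g a b := by
  have hC := Filter.Tendsto.const_mul C hf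
  rw [mul_zero] at hC
  refine squeeze_zero' (Filter.Eventually.of_forall fun E =>
    Finset.sum_nonneg fun i _ => dist_nonneg) ?_ hC
  refine Filter.eventually_inf_principal.2 (Filter.Eventually.of_forall fun E hE => ?_)
  rw [Finset.mul_sum]
  exact Finset.sum_le_sum fun i hi => h _ (hE.1 i hi).1 _ (hE.1 i hi).2

lemma absolutelyContinuous_coord {f : ℝ → Fin 3 → ℝ} {a b : ℝ}
    (hf : AbsolutelyContinuousOnInterval f a b) (i : Fin 3) :
    AbsolutelyContinuousOnInterval (fun t => f t i) a b :=
  absolutelyContinuous_of_dist_le (C := 1) hf fun s _ t _ => by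
    rw [one_mul]; exact dist_le_pi_dist (f s) (f t) i

/-- The values of `f` fill a compact interval, on which a `C¹` function is Lipschitz. -/
lemma absolutelyContinuous_comp_contDiff {f g : ℝ → ℝ} {a b : ℝ}
    (hf : AbsolutelyContinuousOnInterval f a b)
    (hg : ∀ t ∈ uIcc a b, ContDiffAt ℝ 1 g (f t)) :
    AbsolutelyContinuousOnInterval (fun t => g (f t)) a b := by
  have hc : ContinuousOn f (Icc (min a b) (max a b)) := hf.continuousOn
  have himg := hc.image_Icc min_le_max
  set c := sInf (f '' Icc (min a b) (max a b))
  set d := sSup (f '' Icc (min a b) (max a b))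
  have hg' : ContDiffOn ℝ 1 g (Icc c d) := by
    rw [← himg]
    rintro _ ⟨t, ht, rfl⟩
    exact (hg t ht).contDiffWithinAt
  obtain ⟨K, hK⟩ := hg'.exists_lipschitzOnWith (by decide) (convex_Icc _ _) isCompact_Icc
  refine absolutelyContinuous_of_dist_le (C := K) hf fun s hs t ht => ?_
  exact hK.dist_le_mul _ (himg ▸ mem_image_of_mem f hs) _ (himg ▸ mem_image_of_mem f ht)

lemma absolutelyContinuous_lineDist {γ : ℝ → M.Surface} {a b : ℝ} (hab : a ≤ b)
    (hf : AbsolutelyContinuousOnInterval (fun t => (γ t : Fin 3 → ℝ)) a b)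
    (hpos : ∀ t ∈ Icc a b, 0 < (γ t : Fin 3 → ℝ) 2) (θ : ℝ) :
    AbsolutelyContinuousOnInterval (fun t => M.lineDist θ (γ t)) a b := by
  have hm : AbsolutelyContinuousOnInterval (fun t => transverse θ (γ t)) a b :=
    ((absolutelyContinuous_coord hf 0).const_mul _).sub
    ((absolutelyContinuous_coord hf 1).const_mul _)
  refine absolutelyContinuous_comp_contDiff hm fun t ht => ?_
  rw [uIcc_of_le hab] at ht
  exact contDiffAt_asn (one_sub_curv_pos (γ t).2 (hpos t ht) θ)

/-- Almost everywhere on `[a, b]` the curve has a velocity, namely its derivative. -/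
lemma ae_hasDerivAt {f : ℝ → Fin 3 → ℝ} {a b : ℝ} (hab : a ≤ b)
    (hf : AbsolutelyContinuousOnInterval f a b) :
    ∀ᵐ t : ℝ, t ∈ Icc a b → HasDerivAt f (deriv f t) t := by
  filter_upwards [hf.boundedVariationOn.ae_differentiableAt_of_mem_uIcc] with t ht hmem
  exact (ht (by rwa [uIcc_of_le hab])).hasDerivAt

/-- The left side is the derivative of `lineDist θ` along `u`. It is one of two orthogonal
coordinates of `u`, by `one_sub_curv_mul_form`. -/
lemma abs_transverse_div_le_tnorm (x : M.Surface) (h2 : 0 < (x : Fin 3 → ℝ) 2)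
    {u : Fin 3 → ℝ} (hu : M.IsTangent x u) (θ : ℝ) :
    |transverse θ u / Real.sqrt (1 - M.curv * transverse θ x ^ 2)| ≤ M.tnorm u := by
  have hpos := one_sub_curv_pos x.2 h2 θ
  have h := one_sub_curv_mul_form x hu hu θ
  refine Real.abs_le_sqrt ?_
  rw [div_pow, Real.sq_sqrt hpos.le, div_le_iff₀ hpos]
  nlinarith [sq_nonneg (slope θ x u)]

lemma ae_ne (c : ℝ) : ∀ᵐ t : ℝ, t ≠ c := by
  simp [MeasureTheory.ae_iff, MeasureTheory.measure_singleton]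

/-- The distance of two points of a curve is at most the integral of a bound for the speed. -/
lemma gdist_le_integral {γ : ℝ → M.Surface} {a b : ℝ} {g : ℝ → ℝ} (hab : a ≤ b)
    (hf : AbsolutelyContinuousOnInterval (fun t => (γ t : Fin 3 → ℝ)) a b)
    (hpos : ∀ t ∈ Icc a b, 0 < (γ t : Fin 3 → ℝ) 2)
    (hint : IntervalIntegrable g MeasureTheory.volume a b)
    (hg : ∀ᵐ t : ℝ, t ∈ Ioo a b → ∀ u, HasDerivAt (fun t => (γ t : Fin 3 → ℝ)) u t →
      M.tnorm u ≤ g t) :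
    M.gdist (γ a) (γ b) ≤ ∫ t in a..b, g t := by
  -- For this `θ` the distance of the end points is a difference of values of the real function
  -- `lineDist θ`, so the fundamental theorem of calculus applies.
  obtain ⟨θ, hθ⟩ := exists_radial_eq (γ b : Fin 3 → ℝ) (γ a)
  have hac := absolutelyContinuous_lineDist hab hf hpos θ
  have e := abs_lineDist_sub_eq (γ b) (γ a) (hpos b (right_mem_Icc.2 hab))
    (hpos a (left_mem_Icc.2 hab)) hθ
  have hcomm : M.gdist (γ a) (γ b) = M.gdist (γ b) (γ a) := by
    rw [← e, abs_sub_comm, abs_lineDist_sub_eq _ _ (hpos a (left_mem_Icc.2 hab))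
      (hpos b (right_mem_Icc.2 hab)) hθ.symm]
  rw [hcomm, ← e, ← hac.integral_deriv_eq_sub]
  refine (intervalIntegral.abs_integral_le_integral_abs hab).trans ?_
  refine intervalIntegral.integral_mono_ae_restrict hab hac.intervalIntegrable_deriv.abs hint ?_
  refine (MeasureTheory.ae_restrict_iff' measurableSet_Icc).2 ?_
  filter_upwards [ae_hasDerivAt hab hf, ae_ne a, ae_ne b, hg] with t ht hta htb hgt hmem
  have hta' : a < t := lt_of_le_of_ne hmem.1 hta.symm
  have htb' : t < b := lt_of_le_of_ne hmem.2 htb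
  have hv : M.HasVelocity γ a b t (deriv (fun t => (γ t : Fin 3 → ℝ)) t) :=
    (ht hmem).hasDerivWithinAt
  have hd := (hv.lineDist (hpos t hmem) θ).hasDerivAt (Icc_mem_nhds hta' htb')
  simp only [hd.deriv]
  exact (abs_transverse_div_le_tnorm (γ t) (hpos t hmem)
    (hv.isTangent (hta'.trans htb') hmem) θ).trans (hgt ⟨hta', htb'⟩ _ (ht hmem))

lemma form_self_pos (x : M.Surface) {u : Fin 3 → ℝ} (hu : M.IsTangent x u) (h : u ≠ 0) :
    0 < M.form u u := by
  by_contra! hc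
  apply h
  have hx := x.2
  have hz : u 0 = 0 ∧ u 1 = 0 ∧ u 2 = 0 := by
    cases M <;> simp only [IsTangent, form, Mem] at *
    · refine ⟨?_, ?_, ?_⟩ <;> nlinarith [sq_nonneg (u 0), sq_nonneg (u 1), sq_nonneg (u 2)]
    · refine ⟨?_, ?_, hu⟩ <;> nlinarith [sq_nonneg (u 0), sq_nonneg (u 1)]
    -- On the hyperboloid the indefinite form becomes a sum of squares on tangent vectors, up to the
    -- factor `x 2 ^ 2`.
    · have e : u 0 ^ 2 + u 1 ^ 2 + (x.1 0 * u 1 - x.1 1 * u 0) ^ 2 =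
          x.1 2 ^ 2 * (u 0 * u 0 + u 1 * u 1 - u 2 * u 2) := by
        linear_combination (u 0 ^ 2 + u 1 ^ 2) * hx.1 -
          (x.1 0 * u 0 + x.1 1 * u 1 + x.1 2 * u 2) * hu
      have e2 : u 0 ^ 2 + u 1 ^ 2 ≤ 0 := by
        nlinarith [sq_nonneg (x.1 0 * u 1 - x.1 1 * u 0), sq_nonneg (x.1 2)]
      have h0 : u 0 = 0 := by nlinarith [sq_nonneg (u 0), sq_nonneg (u 1)]
      have h1 : u 1 = 0 := by nlinarith [sq_nonneg (u 0), sq_nonneg (u 1)]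
      refine ⟨h0, h1, ?_⟩
      rw [h0, h1] at hu
      have : x.1 2 * u 2 = 0 := by linarith
      exact (mul_eq_zero.1 this).resolve_left hx.2.ne'
  ext i
  fin_cases i <;> simp [hz]

lemma HasVelocity.form_sub {γ : ℝ → M.Surface} {a b s : ℝ} {u : Fin 3 → ℝ}
    (h : M.HasVelocity γ a b s u) (y w : Fin 3 → ℝ) :
    HasDerivWithinAt (fun t => M.form ((γ t : Fin 3 → ℝ) - y) w) (M.form u w) (Icc a b) s := by
  have h0 := ((h.coord 0).sub_const (y 0)).mul_const (w 0)
  have h1 := ((h.coord 1).sub_const (y 1)).mul_const (w 1)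
  have h2 := ((h.coord 2).sub_const (y 2)).mul_const (w 2)
  cases M
  · exact (h0.add h1).add h2
  · exact h0.add h1
  · exact (h0.add h1).sub h2

lemma HasVelocity.form_sub_self {γ : ℝ → M.Surface} {a b s : ℝ} {u : Fin 3 → ℝ}
    (h : M.HasVelocity γ a b s u) (y : Fin 3 → ℝ) :
    HasDerivWithinAt (fun t => M.form ((γ t : Fin 3 → ℝ) - y) ((γ t : Fin 3 → ℝ) - y))
      (2 * M.form ((γ s : Fin 3 → ℝ) - y) u) (Icc a b) s := by
  have h0 := (h.coord 0).sub_const (y 0)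
  have h1 := (h.coord 1).sub_const (y 1)
  have h2 := (h.coord 2).sub_const (y 2)
  cases M
  · refine (((h0.mul h0).add (h1.mul h1)).add (h2.mul h2)).congr_deriv ?_
    simp only [form, Pi.sub_apply]; ring
  · refine ((h0.mul h0).add (h1.mul h1)).congr_deriv ?_
    simp only [form, Pi.sub_apply]; ring
  · refine (((h0.mul h0).add (h1.mul h1)).sub (h2.mul h2)).congr_deriv ?_
    simp only [form, Pi.sub_apply]; ring

lemma absolutelyContinuous_form_sub_self {γ : ℝ → M.Surface} {a b : ℝ}
    (hf : AbsolutelyContinuousOnInterval (fun t => (γ t : Fin 3 → ℝ)) a b) (y : Fin 3 → ℝ) :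
    AbsolutelyContinuousOnInterval
      (fun t => M.form ((γ t : Fin 3 → ℝ) - y) ((γ t : Fin 3 → ℝ) - y)) a b := by
  have h : ∀ i, AbsolutelyContinuousOnInterval (fun t => (γ t : Fin 3 → ℝ) i - y i) a b :=
    fun i => absolutelyContinuous_of_dist_le (C := 1) (absolutelyContinuous_coord hf i)
      fun s _ t _ => by simp
  cases M
  · exact (((h 0).mul (h 0)).add ((h 1).mul (h 1))).add ((h 2).mul (h 2))
  · exact ((h 0).mul (h 0)).add ((h 1).mul (h 1))
  · exact (((h 0).mul (h 0)).add ((h 1).mul (h 1))).sub ((h 2).mul (h 2))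

namespace IsGCurve

variable {γ : ℝ → M.Surface} {a b : ℝ}

/-- The past of a `𝒢`-curve lies behind the normal line. -/
lemma form_sub_le (hγ : M.IsGCurve γ a b) {s : ℝ} (hs : s ∈ Ioc a b) {u : Fin 3 → ℝ}
    (hu0 : u ≠ 0) (hu : M.HasVelocity γ a b s u) {t : ℝ} (ht : t ∈ Icc a s) :
    M.form ((γ t : Fin 3 → ℝ) - γ s) u ≤ 0 := by
  have hsI : s ∈ Icc a b := ⟨hs.1.le, hs.2⟩
  have hab : a < b := hs.1.trans_le hs.2
  -- In the other half space the function `t ↦ ⟨γ t - γ s, u⟩` would be nonnegative before its zero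
  -- at `s`, but its derivative at `s` is `⟨u, u⟩ > 0`.
  refine (hγ.halfSpace s hsI u hu0 hu).resolve_right (fun h => ?_) t ht
  have hp := form_self_pos (γ s) (hu.isTangent hab hsI) hu0
  have hd := (hu.form_sub (γ s) u).mono (Icc_subset_Icc_right hs.2)
  rw [hasDerivWithinAt_iff_tendsto_slope] at hd
  have hne : (nhdsWithin s (Icc a s \ {s})).NeBot := by
    rw [Icc_sdiff_right, ← mem_closure_iff_nhdsWithin_neBot, closure_Ico hs.1.ne]
    exact right_mem_Icc.2 hs.1.le
  refine absurd (le_of_tendsto hd ?_) (not_le.2 hp)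
  filter_upwards [self_mem_nhdsWithin] with τ hτ
  rw [slope_def_field]
  refine div_nonpos_of_nonneg_of_nonpos ?_ (sub_nonpos.2 hτ.1.2)
  have : M.form ((γ s : Fin 3 → ℝ) - γ s) u = 0 := by cases M <;> simp [form]
  rw [this, sub_zero]
  exact h τ hτ.1

/-- A `𝒢`-curve moves away from each of its past points. -/
lemma form_sub_self_le (hγ : M.IsGCurve γ a b) {r s t : ℝ} (har : a ≤ r) (hrs : r ≤ s)
    (hst : s ≤ t) (htb : t ≤ b) :
    M.form ((γ s : Fin 3 → ℝ) - γ r) ((γ s : Fin 3 → ℝ) - γ r) ≤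
      M.form ((γ t : Fin 3 → ℝ) - γ r) ((γ t : Fin 3 → ℝ) - γ r) := by
  have hsub : Icc s t ⊆ Icc a b := Icc_subset_Icc (har.trans hrs) htb
  have hab : a ≤ b := har.trans (hrs.trans (hst.trans htb))
  have hac := (absolutelyContinuous_form_sub_self hγ.absolutelyContinuous (γ r)).mono
    (by rwa [uIcc_of_le hst, uIcc_of_le hab] : uIcc s t ⊆ uIcc a b)
  -- The squared chord is absolutely continuous with derivative `2 ⟨γ τ - γ r, u⟩`, which is
  -- nonnegative because `γ r` lies behind the normal line at `γ τ`.
  rw [← sub_nonneg, ← hac.integral_deriv_eq_sub]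
  refine intervalIntegral.integral_nonneg_of_ae_restrict hst ?_
  refine (MeasureTheory.ae_restrict_iff' measurableSet_Icc).2 ?_
  filter_upwards [ae_hasDerivAt hab hγ.absolutelyContinuous, ae_ne s, ae_ne t]
    with τ hτ hτs hτt hmem
  have hI := hsub hmem
  have hlt : s < τ := lt_of_le_of_ne hmem.1 hτs.symm
  have hlt' : τ < t := lt_of_le_of_ne hmem.2 hτt
  have hv : M.HasVelocity γ a b τ (deriv (fun t => (γ t : Fin 3 → ℝ)) τ) :=
    (hτ hI).hasDerivWithinAt
  have hd := (hv.form_sub_self (γ r)).hasDerivAt (Icc_mem_nhds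
    ((har.trans hrs).trans_lt hlt) (hlt'.trans_le htb))
  rw [hd.deriv]
  by_cases h0 : deriv (fun t => (γ t : Fin 3 → ℝ)) τ = 0
  · rw [h0]; cases M <;> simp [form]
  · have := hγ.form_sub_le ⟨(har.trans hrs).trans_lt hlt, hI.2⟩ h0 hv
      (t := r) ⟨har, hrs.trans hmem.1⟩
    have e : M.form ((γ τ : Fin 3 → ℝ) - γ r) (deriv (fun t => (γ t : Fin 3 → ℝ)) τ) =
        -M.form ((γ r : Fin 3 → ℝ) - γ τ) (deriv (fun t => (γ t : Fin 3 → ℝ)) τ) := by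
      cases M <;> simp only [form, Pi.sub_apply] <;> ring
    simp only [Pi.zero_apply]
    linarith

end IsGCurve

end SpaceForm

/-! ### Right-angled sectors in the Euclidean plane. -/

lemma mul_le_mul_of_sq_le {a b c d : ℝ} (hc : 0 ≤ c) (hd : 0 ≤ d)
    (h : a ^ 2 * b ^ 2 ≤ c ^ 2 * d ^ 2) : a * b ≤ c * d :=
  (abs_le_of_sq_le_sq' (by rw [mul_pow, mul_pow]; exact h) (mul_nonneg hc hd)).2

/-- The sines `S` of the upper angles of the right-angled sectors of the half plane `{0 ≤ z.1}`
with the positive first axis inside that contain a set `Z` form a nonempty interval. -/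
lemma exists_right_sector_bounds (Z : Set (ℝ × ℝ)) (h0 : ∀ z ∈ Z, 0 ≤ z.1)
    (h1 : ∀ z ∈ Z, ∀ w ∈ Z, 0 ≤ z.1 * w.1 + z.2 * w.2) :
    ∃ S T : ℝ, 0 ≤ S ∧ S ≤ T ∧ T ≤ 1 ∧
      (∀ z ∈ Z, 0 < z.2 → z.2 ≤ S * Real.sqrt (z.1 ^ 2 + z.2 ^ 2)) ∧
      (∀ z ∈ Z, z.2 < 0 → T * Real.sqrt (z.1 ^ 2 + z.2 ^ 2) ≤ z.1) ∧
      (∀ k, 0 ≤ k → (∀ z ∈ Z, 0 < z.2 → z.2 ≤ k * Real.sqrt (z.1 ^ 2 + z.2 ^ 2)) → S ≤ k) ∧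
      (∀ k, k ≤ 1 → (∀ z ∈ Z, z.2 < 0 → k * Real.sqrt (z.1 ^ 2 + z.2 ^ 2) ≤ z.1) → k ≤ T) := by
  set ρ : ℝ × ℝ → ℝ := fun z => Real.sqrt (z.1 ^ 2 + z.2 ^ 2) with hρ
  have hpos : ∀ z : ℝ × ℝ, z.2 ≠ 0 → 0 < ρ z := fun z hz =>
    Real.sqrt_pos.2 (add_pos_of_nonneg_of_pos (sq_nonneg _) (pow_pos (abs_pos.2 hz) 2 |>.trans_eq
      (sq_abs _)))
  have hsq : ∀ z : ℝ × ℝ, ρ z ^ 2 = z.1 ^ 2 + z.2 ^ 2 := fun z => Real.sq_sqrt (by positivity)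
  -- `Lo` holds the sines of the angles of the points above the axis, `Hi` the cosines for those
  -- below. The inserted `0` and `1` are the bounds when there are no such points, and keep the axis
  -- in the sector.
  set Lo : Set ℝ := insert 0 {r | ∃ z ∈ Z, 0 < z.2 ∧ r = z.2 / ρ z} with hLo
  set Hi : Set ℝ := insert 1 {r | ∃ z ∈ Z, z.2 < 0 ∧ r = z.1 / ρ z} with hHi
  -- An angle above and an angle below the axis have sum at most `π / 2`, so the sine of the first
  -- is at most the cosine of the second; the last case is `h1` squared.
  have hle : ∀ l ∈ Lo, ∀ r ∈ Hi, l ≤ r := by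
    rintro l (rfl | ⟨z, hz, hz2, rfl⟩) r (rfl | ⟨w, hw, hw2, rfl⟩)
    · exact zero_le_one
    · exact div_nonneg (h0 w hw) (hpos w hw2.ne).le
    · rw [div_le_one (hpos z hz2.ne')]
      exact Real.le_sqrt_of_sq_le (by nlinarith [sq_nonneg z.1])
    · rw [div_le_div_iff₀ (hpos z hz2.ne') (hpos w hw2.ne)]
      refine mul_le_mul_of_sq_le (h0 w hw) (hpos z hz2.ne').le ?_
      rw [hsq, hsq]
      have : z.2 * (-w.2) ≤ z.1 * w.1 := by linarith [h1 z hz w hw]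
      have h2 : 0 ≤ z.2 * (-w.2) := mul_nonneg hz2.le (by linarith)
      nlinarith [mul_self_le_mul_self h2 this]
  have hloBdd : BddAbove Lo := ⟨1, fun l hl => hle l hl 1 (mem_insert _ _)⟩
  have hhiBdd : BddBelow Hi := ⟨0, fun r hr => hle 0 (mem_insert _ _) r hr⟩
  refine ⟨sSup Lo, sInf Hi, le_csSup hloBdd (mem_insert _ _), ?_,
    csInf_le hhiBdd (mem_insert _ _), ?_, ?_, ?_, ?_⟩
  · exact csSup_le (insert_nonempty _ _) fun l hl =>
      le_csInf (insert_nonempty _ _) fun r hr => hle l hl r hr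
  · intro z hz hz2
    rw [← div_le_iff₀ (hpos z hz2.ne')]
    exact le_csSup hloBdd (mem_insert_of_mem _ ⟨z, hz, hz2, rfl⟩)
  · intro z hz hz2
    rw [← le_div_iff₀ (hpos z hz2.ne)]
    exact csInf_le hhiBdd (mem_insert_of_mem _ ⟨z, hz, hz2, rfl⟩)
  · intro k hk h
    refine csSup_le (insert_nonempty _ _) ?_
    rintro l (rfl | ⟨z, hz, hz2, rfl⟩)
    · exact hk
    · rw [div_le_iff₀ (hpos z hz2.ne')]; exact h z hz hz2
  · intro k hk h
    refine le_csInf (insert_nonempty _ _) ?_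
    rintro l (rfl | ⟨z, hz, hz2, rfl⟩)
    · exact hk
    · rw [le_div_iff₀ (hpos z hz2.ne)]; exact h z hz hz2

/-- The sector with the boundary rays `(C, S)` and `(S, -C)` contains `Z`. -/
def InRightSector (Z : Set (ℝ × ℝ)) (S C : ℝ) : Prop :=
  0 ≤ S ∧ 0 ≤ C ∧ S ^ 2 + C ^ 2 = 1 ∧ ∀ z ∈ Z, z.2 * C ≤ z.1 * S ∧ -z.2 * S ≤ z.1 * C

/-- Here `r` is the sine of the angle of the upper side. The lower side is a right angle away, so
`r` is the cosine of its angle, and the points below are controlled by comparing cosines. -/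
lemma inRightSector_of_mem_Icc {Z : Set (ℝ × ℝ)} (h0 : ∀ z ∈ Z, 0 ≤ z.1) {S T r : ℝ}
    (hS : 0 ≤ S) (hT : T ≤ 1)
    (hlo : ∀ z ∈ Z, 0 < z.2 → z.2 ≤ S * Real.sqrt (z.1 ^ 2 + z.2 ^ 2))
    (hhi : ∀ z ∈ Z, z.2 < 0 → T * Real.sqrt (z.1 ^ 2 + z.2 ^ 2) ≤ z.1) (hr : r ∈ Icc S T) :
    InRightSector Z r (Real.sqrt (1 - r ^ 2)) := by
  have hr0 : 0 ≤ r := hS.trans hr.1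
  have hr1 : r ≤ 1 := hr.2.trans hT
  have hsq : Real.sqrt (1 - r ^ 2) ^ 2 = 1 - r ^ 2 := Real.sq_sqrt (by nlinarith)
  have hC := Real.sqrt_nonneg (1 - r ^ 2)
  refine ⟨hr0, hC, by rw [hsq]; ring, fun z hz => ?_⟩
  have hρ : Real.sqrt (z.1 ^ 2 + z.2 ^ 2) ^ 2 = z.1 ^ 2 + z.2 ^ 2 := Real.sq_sqrt (by positivity)
  have hρ0 := Real.sqrt_nonneg (z.1 ^ 2 + z.2 ^ 2)
  constructor
  · rcases le_or_gt z.2 0 with h | h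
    · nlinarith [mul_nonneg (neg_nonneg.2 h) hC, mul_nonneg (h0 z hz) hr0]
    · refine mul_le_mul_of_sq_le (h0 z hz) hr0 ?_
      have h2 : z.2 ≤ r * Real.sqrt (z.1 ^ 2 + z.2 ^ 2) :=
        (hlo z hz h).trans (mul_le_mul_of_nonneg_right hr.1 hρ0)
      have := mul_self_le_mul_self h.le h2
      nlinarith
  · rcases le_or_gt 0 z.2 with h | h
    · nlinarith [mul_nonneg h hr0, mul_nonneg (h0 z hz) hC]
    · refine mul_le_mul_of_sq_le (h0 z hz) hC ?_
      have h2 : r * Real.sqrt (z.1 ^ 2 + z.2 ^ 2) ≤ z.1 :=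
        (mul_le_mul_of_nonneg_right hr.2 hρ0).trans (hhi z hz h)
      have := mul_self_le_mul_self (by positivity) h2
      nlinarith

lemma exists_inRightSector {Z : Set (ℝ × ℝ)} (h0 : ∀ z ∈ Z, 0 ≤ z.1)
    (h1 : ∀ z ∈ Z, ∀ w ∈ Z, 0 ≤ z.1 * w.1 + z.2 * w.2) : ∃ S C, InRightSector Z S C := by
  obtain ⟨S, T, hS, hST, hT, hlo, hhi, -, -⟩ := exists_right_sector_bounds Z h0 h1
  exact ⟨S, _, inRightSector_of_mem_Icc h0 hS hT hlo hhi (left_mem_Icc.2 hST)⟩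

/-- If a right-angled sector can contain `Z` only if the first axis is one of its sides, then the
smallest sector that contains `Z` and the first axis is one of the two quadrants. -/
lemma quadrant_of_inRightSector {Z : Set (ℝ × ℝ)} (h0 : ∀ z ∈ Z, 0 ≤ z.1)
    (h1 : ∀ z ∈ Z, ∀ w ∈ Z, 0 ≤ z.1 * w.1 + z.2 * w.2)
    (h : ∀ S C, InRightSector Z S C → S = 0 ∨ C = 0) :
    ((∀ z ∈ Z, 0 ≤ z.2) ∧ ∀ l m : ℝ, (∀ z ∈ Z, 0 ≤ l * z.1 + m * z.2) → 0 ≤ m) ∨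
    ((∀ z ∈ Z, z.2 ≤ 0) ∧ ∀ l m : ℝ, (∀ z ∈ Z, 0 ≤ l * z.1 + m * z.2) → m ≤ 0) := by
  obtain ⟨S, T, hS, hST, hT, hlo, hhi, hS', hT'⟩ := exists_right_sector_bounds Z h0 h1
  have hr : ∀ r ∈ Icc S T, r = 0 ∨ r = 1 := fun r hr => by
    refine (h _ _ (inRightSector_of_mem_Icc h0 hS hT hlo hhi hr)).imp_right fun hC => ?_
    have h01 : 0 ≤ r ∧ r ≤ 1 := ⟨hS.trans hr.1, hr.2.trans hT⟩
    have : 1 - r ^ 2 ≤ 0 := Real.sqrt_eq_zero'.1 hC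
    nlinarith
  -- The admissible sines form an interval inside `{0, 1}`; the value `1 / 2` excludes that it is
  -- `[0, 1]`.
  have hST' : S = T := by
    by_contra hne
    rcases hr S (left_mem_Icc.2 hST) with e | e <;> rcases hr T (right_mem_Icc.2 hST) with e' | e'
    · exact hne (e.trans e'.symm)
    · rcases hr (1 / 2) ⟨by rw [e]; norm_num, by rw [e']; norm_num⟩ with e | e <;> norm_num at e
    · linarith
    · exact hne (e.trans e'.symm)
  have hlm : ∀ l m : ℝ, m ≠ 0 → 0 < Real.sqrt (l ^ 2 + m ^ 2) := fun l m hm =>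
    Real.sqrt_pos.2 (add_pos_of_nonneg_of_pos (sq_nonneg _) (pow_pos (abs_pos.2 hm) 2 |>.trans_eq
      (sq_abs _)))
  have hlm2 : ∀ l m : ℝ, Real.sqrt (l ^ 2 + m ^ 2) ^ 2 = l ^ 2 + m ^ 2 := fun l m =>
    Real.sq_sqrt (by positivity)
  rcases hr S (left_mem_Icc.2 hST) with e | e
  · right
    have hnp : ∀ z ∈ Z, z.2 ≤ 0 := fun z hz => by
      by_contra! hc
      have := hlo z hz hc
      rw [e, zero_mul] at this
      linarith
    refine ⟨hnp, fun l m hz => ?_⟩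
    by_contra! hm
    -- A half plane with `0 < m` that contains `Z` would keep the points below the axis away from
    -- the negative second axis, and `T` would be positive.
    have hk : m / Real.sqrt (l ^ 2 + m ^ 2) ≤ T := by
      refine hT' _ ?_ fun z hzZ hz2 => ?_
      · rw [div_le_one (hlm l m hm.ne')]
        exact Real.le_sqrt_of_sq_le (by nlinarith [sq_nonneg l])
      · rw [div_mul_eq_mul_div, div_le_iff₀ (hlm l m hm.ne')]
        refine mul_le_mul_of_sq_le (h0 z hzZ) (Real.sqrt_nonneg _) ?_
        rw [hlm2, hlm2]
        have h3 : m * -z.2 ≤ l * z.1 := by linarith [hz z hzZ]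
        have := mul_self_le_mul_self (mul_nonneg hm.le (by linarith)) h3
        nlinarith
    have := div_pos hm (hlm l m hm.ne')
    linarith
  · left
    have hnn : ∀ z ∈ Z, 0 ≤ z.2 := fun z hz => by
      by_contra! hc
      have h2 := hhi z hz hc
      rw [← hST', e, one_mul] at h2
      have := Real.sqrt_le_left (h0 z hz) |>.1 h2
      nlinarith
    refine ⟨hnn, fun l m hz => ?_⟩
    by_contra! hm
    -- A half plane with `m < 0` would keep the points above the axis away from the positive second
    -- axis, and `S` would be less than `1`.
    have hk : S ≤ |l| / Real.sqrt (l ^ 2 + m ^ 2) := by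
      refine hS' _ (by positivity) fun z hzZ hz2 => ?_
      rw [div_mul_eq_mul_div, le_div_iff₀ (hlm l m hm.ne)]
      refine mul_le_mul_of_sq_le (abs_nonneg l) (Real.sqrt_nonneg _) ?_
      rw [hlm2, hlm2, sq_abs]
      have h3 : -m * z.2 ≤ l * z.1 := by linarith [hz z hzZ]
      have := mul_self_le_mul_self (mul_nonneg (by linarith) (hnn z hzZ)) h3
      nlinarith
    rw [e, le_div_iff₀ (hlm l m hm.ne), one_mul, Real.sqrt_le_left (abs_nonneg l), sq_abs] at hk
    have := mul_pos_of_neg_of_neg hm hm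
    nlinarith

/-! ### The tangent directions in which a point sees other points. -/

namespace SpaceForm

variable {M : SpaceForm}

/-- The cosine of the distance, for the cosine of the space form. -/
def cosDist : SpaceForm → (Fin 3 → ℝ) → (Fin 3 → ℝ) → ℝ
  | sphere, x, y => form sphere x y
  | plane, _, _ => 1
  | lobachevskij, x, y => -form lobachevskij x y

/-- The component of `y` tangent to the surface at `x`. -/
def tangentPart (M : SpaceForm) (x y : Fin 3 → ℝ) : Fin 3 → ℝ := y - M.cosDist x y • x

lemma eq_add_tangentPart (M : SpaceForm) (x y : Fin 3 → ℝ) :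
    y = M.cosDist x y • x + M.tangentPart x y := by
  simp [tangentPart]

lemma isTangent_tangentPart (x y : M.Surface) : M.IsTangent x (M.tangentPart x y) := by
  have hx := x.2
  have hy := y.2
  cases M <;> simp only [IsTangent, tangentPart, cosDist, form, Pi.sub_apply, Pi.smul_apply,
    smul_eq_mul, Mem] at *
  · linear_combination -(x.1 0 * y.1 0 + x.1 1 * y.1 1 + x.1 2 * y.1 2) * hx
  · rw [hx, hy]; ring
  · linear_combination (x.1 0 * y.1 0 + x.1 1 * y.1 1 - x.1 2 * y.1 2) * hx.1

lemma form_tangentPart (x y : M.Surface) {u : Fin 3 → ℝ} (hu : M.IsTangent x u) :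
    M.form (M.tangentPart x y) u = M.form ((y : Fin 3 → ℝ) - x) u := by
  cases M <;> simp only [IsTangent, tangentPart, cosDist, form, Pi.sub_apply, Pi.smul_apply,
    smul_eq_mul] at *
  · linear_combination (1 - (x.1 0 * y.1 0 + x.1 1 * y.1 1 + x.1 2 * y.1 2)) * hu
  · ring
  · linear_combination (1 + (x.1 0 * y.1 0 + x.1 1 * y.1 1 - x.1 2 * y.1 2)) * hu

/-- The reversed Cauchy–Schwarz inequality; it makes the values legitimate arguments of
`Real.arcosh`. -/
lemma neg_form_ge_one (x y : lobachevskij.Surface) : 1 ≤ -form lobachevskij x y := by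
  have hx := x.2
  have hy := y.2
  simp only [form, Mem] at *
  have h1 : (x.1 0 * y.1 0 + x.1 1 * y.1 1 + 1) ^ 2 ≤ (x.1 2 * y.1 2) ^ 2 := by
    have e1 : x.1 2 ^ 2 = 1 + x.1 0 ^ 2 + x.1 1 ^ 2 := by linarith [hx.1]
    have e2 : y.1 2 ^ 2 = 1 + y.1 0 ^ 2 + y.1 1 ^ 2 := by linarith [hy.1]
    rw [mul_pow, e1, e2]
    nlinarith [sq_nonneg (x.1 0 - y.1 0), sq_nonneg (x.1 1 - y.1 1),
      sq_nonneg (x.1 0 * y.1 1 - x.1 1 * y.1 0)]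
  have := abs_le_of_sq_le_sq' h1 (mul_pos hx.2 hy.2).le
  linarith [this.2]

lemma form_sphere_le_one (x y : sphere.Surface) : form sphere x y ≤ 1 := by
  have hx := x.2
  have hy := y.2
  simp only [form, Mem] at *
  nlinarith [sq_nonneg (x.1 0 - y.1 0), sq_nonneg (x.1 1 - y.1 1), sq_nonneg (x.1 2 - y.1 2)]

/-- A point `x` that is farther from `y` than `z` sees `y` and `z` at an angle that is at most
`π / 2`; on the sphere the points have to be closer than `π / 2`. -/
lemma form_tangentPart_nonneg (x y z : M.Surface)
    (hpos : M = sphere → 0 < M.form x y)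
    (h : M.form ((z : Fin 3 → ℝ) - y) ((z : Fin 3 → ℝ) - y) ≤
      M.form ((x : Fin 3 → ℝ) - y) ((x : Fin 3 → ℝ) - y)) :
    0 ≤ M.form (M.tangentPart x y) (M.tangentPart x z) := by
  cases M
  · have hx := x.2
    have hy := y.2
    have hz := z.2
    have hp := hpos rfl
    have h1 := form_sphere_le_one x z
    simp only [tangentPart, cosDist, form, Pi.sub_apply, Pi.smul_apply, smul_eq_mul, Mem] at *
    set c := x.1 0 * y.1 0 + x.1 1 * y.1 1 + x.1 2 * y.1 2
    set d := x.1 0 * z.1 0 + x.1 1 * z.1 1 + x.1 2 * z.1 2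
    -- By the law of cosines (`e2`) the goal is `c * d ≤ ⟨z, y⟩`, and `c * d ≤ c ≤ ⟨z, y⟩` because
    -- `0 < c` and `d ≤ 1`.
    have e : c ≤ z.1 0 * y.1 0 + z.1 1 * y.1 1 + z.1 2 * y.1 2 := by
      simp only [c]; nlinarith
    have e2 : (y.1 0 - c * x.1 0) * (z.1 0 - d * x.1 0) + (y.1 1 - c * x.1 1) *
        (z.1 1 - d * x.1 1) + (y.1 2 - c * x.1 2) * (z.1 2 - d * x.1 2) =
        z.1 0 * y.1 0 + z.1 1 * y.1 1 + z.1 2 * y.1 2 - c * d := by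
      simp only [c, d]
      linear_combination (x.1 0 * y.1 0 + x.1 1 * y.1 1 + x.1 2 * y.1 2) *
        (x.1 0 * z.1 0 + x.1 1 * z.1 1 + x.1 2 * z.1 2) * hx
    rw [e2]
    nlinarith [mul_nonneg hp.le (sub_nonneg.2 h1)]
  · simp only [tangentPart, cosDist, form, Pi.sub_apply, Pi.smul_apply, smul_eq_mul] at *
    nlinarith [sq_nonneg (z.1 0 - x.1 0), sq_nonneg (z.1 1 - x.1 1)]
  · have hx := x.2
    have hy := y.2
    have hz := z.2
    have h1 := neg_form_ge_one x z
    have h2 := neg_form_ge_one x y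
    simp only [tangentPart, cosDist, form, Pi.sub_apply, Pi.smul_apply, smul_eq_mul, Mem] at *
    set c := x.1 0 * y.1 0 + x.1 1 * y.1 1 - x.1 2 * y.1 2
    set d := x.1 0 * z.1 0 + x.1 1 * z.1 1 - x.1 2 * z.1 2
    have e : c ≤ z.1 0 * y.1 0 + z.1 1 * y.1 1 - z.1 2 * y.1 2 := by
      simp only [c]; nlinarith
    have e2 : (y.1 0 - -c * x.1 0) * (z.1 0 - -d * x.1 0) + (y.1 1 - -c * x.1 1) *
        (z.1 1 - -d * x.1 1) - (y.1 2 - -c * x.1 2) * (z.1 2 - -d * x.1 2) =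
        z.1 0 * y.1 0 + z.1 1 * y.1 1 - z.1 2 * y.1 2 + c * d := by
      simp only [c, d]
      linear_combination (x.1 0 * y.1 0 + x.1 1 * y.1 1 - x.1 2 * y.1 2) *
        (x.1 0 * z.1 0 + x.1 1 * z.1 1 - x.1 2 * z.1 2) * hx.1
    rw [e2]
    nlinarith [mul_nonneg (show 0 ≤ -c - 1 by linarith) (show 0 ≤ -d - 1 by linarith)]

lemma IsTangent.add {x : M.Surface} {u v : Fin 3 → ℝ} (hu : M.IsTangent x u)
    (hv : M.IsTangent x v) : M.IsTangent x (u + v) := by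
  cases M <;> simp only [IsTangent, form, Pi.add_apply] at * <;> linarith

lemma IsTangent.smul {x : M.Surface} {u : Fin 3 → ℝ} (hu : M.IsTangent x u) (c : ℝ) :
    M.IsTangent x (c • u) := by
  cases M <;> simp only [IsTangent, form, Pi.smul_apply, smul_eq_mul] at *
  · linear_combination c * hu
  · rw [hu, mul_zero]
  · linear_combination c * hu

lemma form_add_left (M : SpaceForm) (u v w : Fin 3 → ℝ) :
    M.form (u + v) w = M.form u w + M.form v w := by
  cases M <;> simp only [form, Pi.add_apply] <;> ring

lemma form_add_right (M : SpaceForm) (u v w : Fin 3 → ℝ) :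
    M.form u (v + w) = M.form u v + M.form u w := by
  cases M <;> simp only [form, Pi.add_apply] <;> ring

lemma form_smul_left (M : SpaceForm) (c : ℝ) (u v : Fin 3 → ℝ) :
    M.form (c • u) v = c * M.form u v := by
  cases M <;> simp only [form, Pi.smul_apply, smul_eq_mul] <;> ring

lemma form_smul_right (M : SpaceForm) (c : ℝ) (u v : Fin 3 → ℝ) :
    M.form u (c • v) = c * M.form u v := by
  cases M <;> simp only [form, Pi.smul_apply, smul_eq_mul] <;> ring

lemma IsTangent.eq_zero {x : M.Surface} {u : Fin 3 → ℝ} (hu : M.IsTangent x u)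
    (h : M.form u u = 0) : u = 0 := by
  by_contra hne
  exact (form_self_pos x hu hne).ne' h

/-- The image of the unit tangent vector `e` at `x` under the rotation by `π / 2`. -/
def rot : SpaceForm → (Fin 3 → ℝ) → (Fin 3 → ℝ) → (Fin 3 → ℝ)
  | sphere, x, e => ![x 1 * e 2 - x 2 * e 1, x 2 * e 0 - x 0 * e 2, x 0 * e 1 - x 1 * e 0]
  | plane, _, e => ![-e 1, e 0, 0]
  | lobachevskij, x, e => ![x 1 * e 2 - x 2 * e 1, x 2 * e 0 - x 0 * e 2, x 1 * e 0 - x 0 * e 1]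

lemma isTangent_rot (x : M.Surface) (e : Fin 3 → ℝ) : M.IsTangent x (M.rot x e) := by
  cases M <;> simp [IsTangent, form, rot] <;> ring

lemma form_rot (M : SpaceForm) (x e : Fin 3 → ℝ) : M.form e (M.rot x e) = 0 := by
  cases M <;> simp [form, rot] <;> ring

/-- Lagrange's identity in the tangent plane. -/
lemma form_rot_sq (x : M.Surface) {e w : Fin 3 → ℝ} (he : M.IsTangent x e)
    (hw : M.IsTangent x w) :
    M.form w (M.rot x e) ^ 2 = M.form e e * M.form w w - M.form e w ^ 2 := by
  have hx := x.2
  cases M <;> simp [IsTangent, form, rot, Mem] at *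
  · linear_combination ((e 0 * e 0 + e 1 * e 1 + e 2 * e 2) * (w 0 * w 0 + w 1 * w 1 + w 2 * w 2) -
      (e 0 * w 0 + e 1 * w 1 + e 2 * w 2) ^ 2) * hx -
      ((x.1 0 * e 0 + x.1 1 * e 1 + x.1 2 * e 2) * (w 0 * w 0 + w 1 * w 1 + w 2 * w 2) -
      (e 0 * w 0 + e 1 * w 1 + e 2 * w 2) * (x.1 0 * w 0 + x.1 1 * w 1 + x.1 2 * w 2)) * he +
      ((x.1 0 * e 0 + x.1 1 * e 1 + x.1 2 * e 2) * (e 0 * w 0 + e 1 * w 1 + e 2 * w 2) -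
      (e 0 * e 0 + e 1 * e 1 + e 2 * e 2) * (x.1 0 * w 0 + x.1 1 * w 1 + x.1 2 * w 2)) * hw
  · ring
  · linear_combination -((e 0 * e 0 + e 1 * e 1 - e 2 * e 2) *
      (w 0 * w 0 + w 1 * w 1 - w 2 * w 2) - (e 0 * w 0 + e 1 * w 1 - e 2 * w 2) ^ 2) * hx.1 +
      ((x.1 0 * e 0 + x.1 1 * e 1 - x.1 2 * e 2) * (w 0 * w 0 + w 1 * w 1 - w 2 * w 2) -
      (e 0 * w 0 + e 1 * w 1 - e 2 * w 2) * (x.1 0 * w 0 + x.1 1 * w 1 - x.1 2 * w 2)) * he -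
      ((x.1 0 * e 0 + x.1 1 * e 1 - x.1 2 * e 2) * (e 0 * w 0 + e 1 * w 1 - e 2 * w 2) -
      (e 0 * e 0 + e 1 * e 1 - e 2 * e 2) * (x.1 0 * w 0 + x.1 1 * w 1 - x.1 2 * w 2)) * hw

lemma form_rot_self (x : M.Surface) {e : Fin 3 → ℝ} (he : M.IsTangent x e) :
    M.form (M.rot x e) (M.rot x e) = M.form e e := by
  have hx := x.2
  cases M <;> simp [IsTangent, form, rot, Mem] at *
  · linear_combination (e 0 * e 0 + e 1 * e 1 + e 2 * e 2) * hx -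
      (x.1 0 * e 0 + x.1 1 * e 1 + x.1 2 * e 2) * he
  · ring
  · linear_combination -(e 0 * e 0 + e 1 * e 1 - e 2 * e 2) * hx.1 +
      (x.1 0 * e 0 + x.1 1 * e 1 - x.1 2 * e 2) * he

lemma isUnitTangent_rot (x : M.Surface) {e : Fin 3 → ℝ} (he : M.IsUnitTangent x e) :
    M.IsUnitTangent x (M.rot x e) :=
  ⟨isTangent_rot x e, (form_rot_self x he.1).trans he.2⟩

/-- Orthonormal unit tangent vectors at `x` are a basis of the tangent plane. -/
lemma IsTangent.eq_add {x : M.Surface} {e n w : Fin 3 → ℝ} (hw : M.IsTangent x w)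
    (he : M.IsUnitTangent x e) (hn : M.IsUnitTangent x n) (hen : M.form e n = 0) :
    w = M.form w e • e + M.form w n • n := by
  set m := M.rot x e with hm
  have hmu : M.IsUnitTangent x m := isUnitTangent_rot x he
  have hem : M.form e m = 0 := form_rot M x e
  have hsq : ∀ v, M.IsTangent x v → M.form v e = 0 → M.form v m = 0 → v = 0 := by
    intro v hv h1 h2
    have := form_rot_sq x he.1 hv
    rw [← hm, h2, he.2, form_comm M e v, h1] at this
    exact hv.eq_zero (by linarith)
  have hexp : ∀ v, M.IsTangent x v → v = M.form v e • e + M.form v m • m := by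
    intro v hv
    have hr : M.IsTangent x (v + (-(M.form v e) • e + -(M.form v m) • m)) :=
      hv.add ((he.1.smul _).add (hmu.1.smul _))
    have := hsq _ hr
      (by simp only [form_add_left, form_smul_left, he.2, form_comm M m e, hem]; ring)
      (by simp only [form_add_left, form_smul_left, hmu.2, hem]; ring)
    rw [← sub_eq_zero, ← this]
    module
  -- The rotated vector `m` gives one orthonormal basis; `n` is a multiple of `m` with a factor of
  -- square `1`, so the expansion carries over.
  have hn' := hexp n hn.1
  rw [form_comm M n e, hen, zero_smul, zero_add] at hn'
  have h1 : M.form n m ^ 2 = 1 := by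
    have h2 := hn.2
    nth_rw 1 [hn'] at h2
    rw [form_smul_left, form_comm M m n] at h2
    linear_combination h2
  have h3 := hexp w hw
  have h4 : M.form w n = M.form n m * M.form w m := by
    conv_lhs => rw [hn']
    rw [form_smul_right]
  generalize M.form n m = k at hn' h1 h4
  rw [h4, hn', smul_smul, show k * M.form w m * k = M.form w m by
    linear_combination M.form w m * h1]
  exact h3

end SpaceForm

/-! ### The projecting sector and the bound for the speed. -/

namespace SpaceForm

variable {M : SpaceForm}

/-- The decomposition into a multiple of `x` and a tangent vector at `x` is unique. -/
lemma tangentPart_eq_of_eq_add {x y : M.Surface} {c : ℝ} {k : Fin 3 → ℝ} (hk : M.IsTangent x k)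
    (h : (y : Fin 3 → ℝ) = c • (x : Fin 3 → ℝ) + k) : M.tangentPart x y = k := by
  suffices hc : M.cosDist x y = c by rw [tangentPart, hc, h]; simp
  have hx := x.2
  have hy := y.2
  have h0 := congrFun h 0
  have h1 := congrFun h 1
  have h2 := congrFun h 2
  cases M <;> simp only [IsTangent, cosDist, form, Mem, Pi.add_apply, Pi.smul_apply,
    smul_eq_mul] at *
  · rw [h0, h1, h2]; linear_combination c * hx + hk
  · rw [hx, hy, hk] at h2; linarith
  · rw [h0, h1, h2]; linear_combination -c * hx.1 - hk

lemma ne_neg_of_form_eq_zero {x : M.Surface} {e n : Fin 3 → ℝ} (he : M.IsUnitTangent x e)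
    (hen : M.form e n = 0) : n ≠ -e := by
  rintro rfl
  rw [form_neg_right, he.2] at hen
  norm_num at hen

/-- A quadrant is the smallest sector containing a set if the set contains points of the quadrant
arbitrarily near to its sides; the latter is expressed by duality. -/
lemma isSmallestSector_quadrant {x : M.Surface} {e n : Fin 3 → ℝ} (he : M.IsUnitTangent x e)
    (hn : M.IsUnitTangent x n) (hen : M.form e n = 0) {A : Set M.Surface}
    (hA : ∀ y ∈ A, 0 ≤ M.form (M.tangentPart x y) e ∧ 0 ≤ M.form (M.tangentPart x y) n)
    (hle : ∀ l m : ℝ, (∀ y ∈ A, 0 ≤ l * M.form (M.tangentPart x y) e +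
      m * M.form (M.tangentPart x y) n) → 0 ≤ l ∧ 0 ≤ m) :
    M.IsSmallestSector x A e n := by
  have hne : M.form n e = 0 := by rw [form_comm, hen]
  refine ⟨_, ⟨he, hn, Or.inl ⟨ne_neg_of_form_eq_zero he hen, rfl⟩⟩, fun y hy => ?_, ?_⟩
  · refine ⟨M.cosDist x y, _, _, (hA y hy).1, (hA y hy).2, ?_⟩
    rw [add_assoc, ← (isTangent_tangentPart x y).eq_add he hn hen]
    exact eq_add_tangentPart M _ _
  · rintro v w C' ⟨hv, hw, hC | ⟨hwv, k, hk, hvk, rfl⟩⟩ hAC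
    · obtain ⟨hwv, rfl⟩ := hC
      have ev := hv.1.eq_add he hn hen
      have ew := hw.1.eq_add he hn hen
      have hv1 := hv.2
      have hw1 := hw.2
      set a := M.form v e
      set b := M.form v n
      set c := M.form w e
      set d := M.form w n
      rw [ev] at hv1
      rw [ew] at hw1
      simp only [form_add_left, form_add_right, form_smul_left, form_smul_right, he.2, hn.2, hen,
        hne] at hv1 hw1
      have hmem : ∀ y ∈ A, ∃ α β : ℝ, 0 ≤ α ∧ 0 ≤ β ∧
          M.form (M.tangentPart x y) e = α * a + β * c ∧
          M.form (M.tangentPart x y) n = α * b + β * d := by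
        intro y hy
        obtain ⟨r, α, β, hα, hβ, hr⟩ := hAC hy
        rw [add_assoc] at hr
        rw [tangentPart_eq_of_eq_add ((hv.1.smul α).add (hw.1.smul β)) hr]
        exact ⟨α, β, hα, hβ, by simp only [form_add_left, form_smul_left, a, c],
          by simp only [form_add_left, form_smul_left, b, d]⟩
      by_cases hdet : a * d - b * c = 0
      -- Parallel `v` and `w` must be equal, since `w ≠ -v`. Then `A` is seen on one line, and `hle`
      -- for both signs of its normal functional makes that functional vanish.
      · exfalso
        have hq : (a * c + b * d) ^ 2 = 1 := by
          linear_combination hv1 * (c ^ 2 + d ^ 2) + hw1 - (a * d - b * c) * hdet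
        have hac : a = c ∧ b = d := by
          rcases sq_eq_sq_iff_eq_or_eq_neg.1 (hq.trans (one_pow 2).symm) with h | h
          · have : (a - c) ^ 2 + (b - d) ^ 2 = 0 := by linear_combination hv1 + hw1 - 2 * h
            constructor <;> nlinarith [sq_nonneg (a - c), sq_nonneg (b - d)]
          · exfalso
            have h3 : (a + c) ^ 2 + (b + d) ^ 2 = 0 := by linear_combination hv1 + hw1 + 2 * h
            have h4 : a + c = 0 := by nlinarith [sq_nonneg (a + c), sq_nonneg (b + d)]
            have h5 : b + d = 0 := by nlinarith [sq_nonneg (a + c), sq_nonneg (b + d)]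
            apply hwv
            rw [ev, ew, show c = -a by linarith, show d = -b by linarith]
            module
        have h1 := hle b (-a) fun y hy => by
          obtain ⟨α, β, -, -, h1, h2⟩ := hmem y hy
          rw [h1, h2, ← hac.1, ← hac.2]; apply le_of_eq; ring
        have h2 := hle (-b) a fun y hy => by
          obtain ⟨α, β, -, -, h1, h2⟩ := hmem y hy
          rw [h1, h2, ← hac.1, ← hac.2]; apply le_of_eq; ring
        have ha : a = 0 := by linarith [h1.2, h2.2]
        have hb : b = 0 := by linarith [h1.1, h2.1]
        rw [ha, hb] at hv1
        norm_num at hv1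
      -- By Cramer's rule the coefficients `α`, `β` are linear functionals that are nonnegative on
      -- `A`. Duality makes them nonnegative on `e` and `n`, hence on the quadrant.
      · obtain ⟨δ, hδ⟩ : ∃ δ, δ * (a * d - b * c) = 1 := ⟨_, inv_mul_cancel₀ hdet⟩
        have hα := hle (d * δ) (-c * δ) fun y hy => by
          obtain ⟨α, β, h0, -, h1, h2⟩ := hmem y hy
          rw [h1, h2]
          exact h0.trans_eq (by linear_combination -α * hδ)
        have hβ := hle (-b * δ) (a * δ) fun y hy => by
          obtain ⟨α, β, -, h0, h1, h2⟩ := hmem y hy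
          rw [h1, h2]
          exact h0.trans_eq (by linear_combination -β * hδ)
        rintro y ⟨r, p, q, hp, hq, hy⟩
        refine ⟨r, p * (d * δ) + q * (-c * δ), p * (-b * δ) + q * (a * δ),
          add_nonneg (mul_nonneg hp hα.1) (mul_nonneg hq hα.2),
          add_nonneg (mul_nonneg hp hβ.1) (mul_nonneg hq hβ.2), ?_⟩
        rw [hy, ev, ew]
        ext i
        simp only [Pi.add_apply, Pi.smul_apply, smul_eq_mul]
        linear_combination -(p * e i + q * n i) * hδ
    -- A half plane is cut out by the single functional given by `k`, to which duality applies
    -- directly.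
    · have hmem : ∀ y ∈ A, 0 ≤ M.form (M.tangentPart x y) k := by
        intro y hy
        obtain ⟨r, α, β, hβ, hr⟩ := hAC hy
        rw [add_assoc] at hr
        rw [tangentPart_eq_of_eq_add ((hv.1.smul α).add (hk.1.smul β)) hr, form_add_left,
          form_smul_left, form_smul_left, hvk, hk.2]
        linarith
      have hl := hle (M.form e k) (M.form n k) fun y hy => by
        have := hmem y hy
        rw [(isTangent_tangentPart x y).eq_add he hn hen, form_add_left, form_smul_left,
          form_smul_left] at this
        linarith
      rintro y ⟨r, p, q, hp, hq, hy⟩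
      have ht := ((he.1.smul p).add (hn.1.smul q)).eq_add hv hk hvk
      refine ⟨r, M.form (p • e + q • n) v, M.form (p • e + q • n) k, ?_, ?_⟩
      · rw [form_add_left, form_smul_left, form_smul_left]
        exact add_nonneg (mul_nonneg hp hl.1) (mul_nonneg hq hl.2)
      · rw [hy, add_assoc, add_assoc, ← ht]

lemma angle_eq_pi_div_two {v w : Fin 3 → ℝ} (h : M.form v w = 0) :
    M.angle v w = Real.pi / 2 := by
  rw [angle, h, zero_div, Real.arccos_zero]

variable {γ : ℝ → M.Surface} {a b s : ℝ} {u : Fin 3 → ℝ}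

lemma HasVelocity.hasDerivWithinAt_form_tangentPart
    (h : M.HasVelocity γ a b s u) {w : Fin 3 → ℝ} (hw : M.IsTangent (γ s) w) :
    HasDerivWithinAt (fun t => M.form (M.tangentPart (γ s) (γ t)) w) (M.form u w)
      (Icc a b) s := by
  simp only [form_tangentPart _ _ hw]
  exact h.form_sub (γ s) w

/-- The tangent direction is a limit of past directions. -/
lemma HasVelocity.nonpos_of_forall (hs : s ∈ Ioc a b) (h : M.HasVelocity γ a b s u)
    {w : Fin 3 → ℝ} (hw : M.IsTangent (γ s) w)
    (hnn : ∀ t ∈ Icc a s, 0 ≤ M.form (M.tangentPart (γ s) (γ t)) w) : M.form u w ≤ 0 := by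
  have hd := (h.hasDerivWithinAt_form_tangentPart hw).mono
    (Icc_subset_Icc_right hs.2)
  rw [hasDerivWithinAt_iff_tendsto_slope] at hd
  have hne : (nhdsWithin s (Icc a s \ {s})).NeBot := by
    rw [Icc_sdiff_right, ← mem_closure_iff_nhdsWithin_neBot, closure_Ico hs.1.ne]
    exact right_mem_Icc.2 hs.1.le
  refine le_of_tendsto hd ?_
  filter_upwards [self_mem_nhdsWithin] with τ hτ
  rw [slope_def_field]
  refine div_nonpos_of_nonneg_of_nonpos ?_ (sub_nonpos.2 hτ.1.2)
  have : M.form (M.tangentPart (γ s) (γ s)) w = 0 := by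
    rw [form_tangentPart _ _ hw]; cases M <;> simp [form]
  rw [this, sub_zero]
  exact hnn τ hτ.1

/-- Let `F'` be a bound for the growth rates given by the right-angled sectors that contain the
past of a `𝒢`-curve. Then the speed is at most `F'`, and if it is equal to `F'`, then the
projecting sector is right-angled and one of its sides is tangent to the curve. -/
lemma IsGCurve.tnorm_le (hγ : M.IsGCurve γ a b)
    (hpos : M = sphere → ∀ r ∈ Icc a b, ∀ t ∈ Icc a b, 0 < M.form (γ r) (γ t))
    (hs : s ∈ Ioo a b) (hu0 : u ≠ 0) (hu : M.HasVelocity γ a b s u) {F' : ℝ}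
    (hF : ∀ v w, M.IsUnitTangent (γ s) v → M.IsUnitTangent (γ s) w → M.form v w = 0 →
      (∀ t ∈ Icc a s, ∃ c α β : ℝ, 0 ≤ α ∧ 0 ≤ β ∧
        (γ t : Fin 3 → ℝ) = c • (γ s : Fin 3 → ℝ) + α • v + β • w) →
      -M.form u v - M.form u w ≤ F') :
    M.tnorm u ≤ F' ∧ (F' = M.tnorm u → ∃ v₁ v₂, M.IsProjectingSector γ a s v₁ v₂ ∧
      M.angle v₁ v₂ = Real.pi / 2 ∧ ((∃ r : ℝ, u = r • v₁) ∨ (∃ r : ℝ, u = r • v₂))) := by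
  have hab : a < b := hs.1.trans hs.2
  have hsI : s ∈ Icc a b := ⟨hs.1.le, hs.2.le⟩
  have hsI' : s ∈ Ioc a b := ⟨hs.1, hs.2.le⟩
  have hut := hu.isTangent hab hsI
  have hup := form_self_pos (γ s) hut hu0
  have hk : 0 < M.tnorm u := Real.sqrt_pos.2 hup
  have hk2 : M.tnorm u ^ 2 = M.form u u := Real.sq_sqrt hup.le
  set k := M.tnorm u with hkdef
  -- The backward unit tangent; it becomes the positive first axis in the plane of the
  -- `InRightSector` lemmas.
  obtain ⟨e, hedef⟩ : ∃ e : Fin 3 → ℝ, e = (-k⁻¹) • u := ⟨_, rfl⟩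
  have he : M.IsUnitTangent (γ s) e := by
    refine ⟨hedef ▸ hut.smul _, ?_⟩
    rw [hedef, form_smul_left, form_smul_right, ← hk2]
    field_simp
  obtain ⟨n, hn, hen⟩ : ∃ n, M.IsUnitTangent (γ s) n ∧ M.form e n = 0 :=
    ⟨M.rot (γ s) e, isUnitTangent_rot _ he, form_rot M _ e⟩
  have hue : u = (-k) • e := by
    rw [hedef, smul_smul, neg_mul_neg, mul_inv_cancel₀ hk.ne', one_smul]
  have hfe : M.form u e = -k := by rw [hue, form_smul_left, he.2, mul_one]
  have hfn : M.form u n = 0 := by rw [hue, form_smul_left, hen, mul_zero]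
  set D : ℝ → Fin 3 → ℝ := fun t => M.tangentPart (γ s) (γ t) with hD
  have hDt : ∀ t, D t = M.form (D t) e • e + M.form (D t) n • n := fun t =>
    (isTangent_tangentPart _ _).eq_add he hn hen
  set Z : Set (ℝ × ℝ) := (fun t => (M.form (D t) e, M.form (D t) n)) '' Icc a s with hZ
  have h0 : ∀ z ∈ Z, 0 ≤ z.1 := by
    rintro _ ⟨t, ht, rfl⟩
    have h1 := hγ.form_sub_le hsI' hu0 hu ht
    rw [← form_tangentPart _ _ hut] at h1
    simp only [hD, hedef, form_smul_right]
    have := mul_nonneg (inv_nonneg.2 hk.le) (neg_nonneg.2 h1)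
    linarith
  have hpair : ∀ r ∈ Icc a s, ∀ t ∈ Icc a s, r ≤ t → 0 ≤ M.form (D r) (D t) := by
    intro r hr t ht hrt
    refine form_tangentPart_nonneg _ _ _ (fun hM => hpos hM s hsI r ⟨hr.1, hr.2.trans hs.2.le⟩)
      (hγ.form_sub_self_le hr.1 hrt ht.2 hs.2.le)
  have h1 : ∀ z ∈ Z, ∀ w ∈ Z, 0 ≤ z.1 * w.1 + z.2 * w.2 := by
    rintro _ ⟨r, hr, rfl⟩ _ ⟨t, ht, rfl⟩
    have hexp : M.form (D r) (D t) =
        M.form (D r) e * M.form (D t) e + M.form (D r) n * M.form (D t) n := by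
      conv_lhs => rw [hDt t]
      rw [form_add_right, form_smul_right, form_smul_right]; ring
    have : 0 ≤ M.form (D r) (D t) := by
      rcases le_total r t with h | h
      · exact hpair r hr t ht h
      · rw [form_comm]; exact hpair t ht r hr h
    rwa [hexp] at this
  -- The sides `C e + S n` and `S e - C n` have products `-k C` and `-k S` with `u`.
  have hrate : ∀ S C, InRightSector Z S C → k * (S + C) ≤ F' := by
    rintro S C ⟨hS, hC, hSC, hz⟩
    have hne : M.form n e = 0 := by rw [form_comm, hen]
    have hv : M.IsUnitTangent (γ s) (C • e + S • n) := by
      refine ⟨(he.1.smul C).add (hn.1.smul S), ?_⟩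
      simp only [form_add_left, form_add_right, form_smul_left, form_smul_right, he.2, hn.2, hen,
        hne]
      linear_combination hSC
    have hw : M.IsUnitTangent (γ s) (S • e + (-C) • n) := by
      refine ⟨(he.1.smul S).add (hn.1.smul (-C)), ?_⟩
      simp only [form_add_left, form_add_right, form_smul_left, form_smul_right, he.2, hn.2, hen,
        hne]
      linear_combination hSC
    have hvw : M.form (C • e + S • n) (S • e + (-C) • n) = 0 := by
      simp only [form_add_left, form_add_right, form_smul_left, form_smul_right, he.2, hn.2, hen,
        hne]
      ring
    have := hF _ _ hv hw hvw fun t ht => by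
      have hzt := hz _ (mem_image_of_mem _ ht)
      refine ⟨M.cosDist (γ s) (γ t), M.form (D t) e * C + M.form (D t) n * S,
        M.form (D t) e * S - M.form (D t) n * C, by linarith [hzt.2], by linarith [hzt.1], ?_⟩
      have h2 := eq_add_tangentPart (M := M) (γ s) (γ t)
      conv_lhs => rw [h2, show M.tangentPart (γ s) (γ t) = D t from rfl, hDt t]
      ext i
      simp only [Pi.add_apply, Pi.smul_apply, smul_eq_mul]
      linear_combination -(M.form (D t) e * e i + M.form (D t) n * n i) * hSC
    simp only [form_add_right, form_smul_right, hfe, hfn] at this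
    linarith
  -- `(S + C) ^ 2 = 1 + 2 S C`, so `S + C = 1` also forces `S C = 0`.
  have hge : ∀ S C : ℝ, InRightSector Z S C → 1 ≤ S + C := by
    rintro S C ⟨hS, hC, hSC, -⟩
    nlinarith [mul_nonneg hS hC]
  constructor
  · obtain ⟨S, C, h⟩ := exists_inRightSector h0 h1
    nlinarith [hrate S C h, hge S C h]
  · intro hFk
    have h01 : ∀ S C, InRightSector Z S C → S = 0 ∨ C = 0 := by
      intro S C h
      have h2 := hrate S C h
      rw [hFk] at h2
      have h3 : S + C ≤ 1 := by nlinarith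
      have h4 : S * C = 0 := by nlinarith [mul_nonneg h.1 h.2.1, h.2.2.1, hge S C h]
      exact mul_eq_zero.1 h4
    -- Past directions accumulate at the backward tangent `e`, so a functional that is nonnegative
    -- on the past is nonnegative at `e`.
    have hl : ∀ l m : ℝ, (∀ t ∈ Icc a s, 0 ≤ l * M.form (D t) e + m * M.form (D t) n) →
        0 ≤ l := by
      intro l m h
      have h2 := hu.nonpos_of_forall hsI' ((he.1.smul l).add (hn.1.smul m)) fun t ht => by
        rw [form_add_right, form_smul_right, form_smul_right]; exact h t ht
      rw [form_add_right, form_smul_right, form_smul_right, hfe, hfn] at h2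
      nlinarith
    rcases quadrant_of_inRightSector h0 h1 h01 with ⟨hq, hm⟩ | ⟨hq, hm⟩
    · refine ⟨e, n, ?_, angle_eq_pi_div_two hen, Or.inl ⟨_, hue⟩⟩
      refine isSmallestSector_quadrant he hn hen ?_ fun l m h => ?_
      · rintro _ ⟨t, ht, rfl⟩
        exact ⟨h0 _ (mem_image_of_mem _ ht), hq _ (mem_image_of_mem _ ht)⟩
      · have h' : ∀ t ∈ Icc a s, 0 ≤ l * M.form (D t) e + m * M.form (D t) n := fun t ht =>
          h _ (mem_image_of_mem _ ht)
        refine ⟨hl l m h', hm l m ?_⟩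
        rintro _ ⟨t, ht, rfl⟩
        exact h' t ht
    · have hen' : M.form e (-n) = 0 := by rw [form_neg_right, hen, neg_zero]
      refine ⟨e, -n, ?_, angle_eq_pi_div_two hen', Or.inl ⟨_, hue⟩⟩
      refine isSmallestSector_quadrant he hn.neg hen' ?_ fun l m h => ?_
      · rintro _ ⟨t, ht, rfl⟩
        refine ⟨h0 _ (mem_image_of_mem _ ht), ?_⟩
        rw [form_neg_right]
        exact neg_nonneg.2 (hq _ (mem_image_of_mem _ ht))
      · have h' : ∀ t ∈ Icc a s, 0 ≤ l * M.form (D t) e + -m * M.form (D t) n := fun t ht => by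
          have := h _ (mem_image_of_mem _ ht)
          rw [form_neg_right] at this
          simp only [hD]
          linarith
        refine ⟨hl l (-m) h', ?_⟩
        have := hm l (-m) (by rintro _ ⟨t, ht, rfl⟩; exact h' t ht)
        linarith

end SpaceForm

/-! ### Motions, and the inequality between length and width. -/

namespace SpaceForm

variable {M : SpaceForm}

/-- A linear map that preserves the surface and its metric. -/
structure IsMotion (M : SpaceForm) (R : (Fin 3 → ℝ) →ₗ[ℝ] (Fin 3 → ℝ)) : Prop where
  form_map : ∀ x y, M.form (R x) (R y) = M.form x y
  mem_map : ∀ x, M.Mem x → M.Mem (R x)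
  isTangent_map : ∀ (x y : M.Surface) (v : Fin 3 → ℝ), (y : Fin 3 → ℝ) = R x →
    M.IsTangent x v → M.IsTangent y (R v)

lemma isMotion_id (M : SpaceForm) : M.IsMotion LinearMap.id :=
  ⟨fun _ _ => rfl, fun _ h => h, fun x y v h hv => by
    obtain rfl : y = x := Subtype.ext h
    exact hv⟩

namespace IsMotion

variable {R : (Fin 3 → ℝ) →ₗ[ℝ] (Fin 3 → ℝ)}

/-- The action of a motion on the points of the surface. -/
def map (hR : M.IsMotion R) (x : M.Surface) : M.Surface := ⟨R x, hR.mem_map x x.2⟩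

lemma gdist_map (hR : M.IsMotion R) (x y : M.Surface) :
    M.gdist (hR.map x) (hR.map y) = M.gdist x y := by
  cases M <;> simp only [gdist, map, ← map_sub, hR.form_map]

lemma tnorm_map (hR : M.IsMotion R) (v : Fin 3 → ℝ) : M.tnorm (R v) = M.tnorm v := by
  rw [tnorm, tnorm, hR.form_map]

lemma isUnitTangent_map (hR : M.IsMotion R) {x : M.Surface} {v : Fin 3 → ℝ}
    (hv : M.IsUnitTangent x v) : M.IsUnitTangent (hR.map x) (R v) :=
  ⟨hR.isTangent_map x _ v rfl hv.1, by rw [hR.form_map]; exact hv.2⟩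

end IsMotion

lemma continuous_tnorm (M : SpaceForm) : Continuous M.tnorm := by
  unfold tnorm
  cases M <;> simp only [form] <;> fun_prop

lemma tnorm_nonneg (M : SpaceForm) (v : Fin 3 → ℝ) : 0 ≤ M.tnorm v := Real.sqrt_nonneg _

lemma tnorm_zero (M : SpaceForm) : M.tnorm 0 = 0 := by cases M <;> simp [tnorm, form]

/-- The length of a curve is at most the integral of a speed bound. -/
lemma length_le_of_gdist_le {γ : ℝ → M.Surface} {a b : ℝ} {g : ℝ → ℝ} (hab : a ≤ b)
    (hint : IntervalIntegrable g MeasureTheory.volume a b) (hg : ∀ t, 0 ≤ g t)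
    (h : ∀ s t, a ≤ s → s ≤ t → t ≤ b → M.gdist (γ s) (γ t) ≤ ∫ τ in s..t, g τ) :
    M.length γ a b ≤ ENNReal.ofReal (∫ τ in a..b, g τ) := by
  refine iSup_le fun n => iSup_le fun t => iSup_le fun ht => iSup_le fun hI => ?_
  have hint' : ∀ s t, s ∈ Icc a b → t ∈ Icc a b →
      IntervalIntegrable g MeasureTheory.volume s t := fun s t hs ht =>
    hint.mono_set (uIcc_subset_uIcc (by rwa [uIcc_of_le hab]) (by rwa [uIcc_of_le hab]))
  have h0 : ∀ s t, s ≤ t → 0 ≤ ∫ τ in s..t, g τ := fun s t hst =>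
    intervalIntegral.integral_nonneg hst fun τ _ => hg τ
  calc ∑ i ∈ Finset.range n, ENNReal.ofReal (M.gdist (γ (t i)) (γ (t (i + 1))))
      ≤ ∑ i ∈ Finset.range n, ENNReal.ofReal (∫ τ in t i..t (i + 1), g τ) :=
        Finset.sum_le_sum fun i _ => ENNReal.ofReal_le_ofReal
          (h _ _ (hI i).1 (ht (Nat.le_succ i)) (hI _).2)
    _ = ENNReal.ofReal (∑ i ∈ Finset.range n, ∫ τ in t i..t (i + 1), g τ) :=
        (ENNReal.ofReal_sum_of_nonneg fun i _ => h0 _ _ (ht (Nat.le_succ i))).symm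
    _ ≤ _ := by
        rw [intervalIntegral.sum_integral_adjacent_intervals fun k _ => hint' _ _ (hI k) (hI _)]
        refine ENNReal.ofReal_le_ofReal ?_
        exact intervalIntegral.integral_mono_interval (hI 0).1 (ht (Nat.zero_le n)) (hI n).2
          (Filter.Eventually.of_forall fun τ => hg τ) hint

/-- The length of a `𝒢`-curve is at most the width of the curve in the gnomonic chart; and if both
are equal, then the projecting sectors are right-angled and one side is tangent to the curve. -/
theorem IsGCurve.length_le_width {γ : ℝ → M.Surface} {a b : ℝ} (hab : a ≤ b)
    (hγ : M.IsGCurve γ a b)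
    (hpos : M = sphere → ∀ r ∈ Icc a b, ∀ t ∈ Icc a b, 0 < M.form (γ r) (γ t))
    {R : (Fin 3 → ℝ) →ₗ[ℝ] (Fin 3 → ℝ)} (hR : M.IsMotion R)
    (hRpos : ∀ t ∈ Icc a b, 0 < R (γ t) 2) :
    M.length γ a b ≤ ENNReal.ofReal (M.width (past (fun t => hR.map (γ t)) a b)) ∧
    (ENNReal.ofReal (M.width (past (fun t => hR.map (γ t)) a b)) ≤ M.length γ a b →
      ∀ᵐ s : ℝ, s ∈ Icc a b → ∀ u, u ≠ 0 → M.HasVelocity γ a b s u →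
        ∃ v₁ v₂, M.IsProjectingSector γ a s v₁ v₂ ∧ M.angle v₁ v₂ = Real.pi / 2 ∧
          ((∃ r : ℝ, u = r • v₁) ∨ (∃ r : ℝ, u = r • v₂))) := by
  set η : ℝ → M.Surface := fun t => hR.map (γ t) with hη
  set f : ℝ → Fin 3 → ℝ := fun t => (γ t : Fin 3 → ℝ) with hf
  set L := LinearMap.toContinuousLinearMap R
  have hηf : ∀ t, (η t : Fin 3 → ℝ) = L (f t) := fun t => rfl
  have hacη : AbsolutelyContinuousOnInterval (fun t => (η t : Fin 3 → ℝ)) a b :=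
    absolutelyContinuous_of_dist_le (C := ‖L‖) hγ.absolutelyContinuous fun s _ t _ => by
      rw [hηf, hηf, dist_eq_norm, dist_eq_norm, ← map_sub]; exact L.le_opNorm _
  have hc : ContinuousOn (fun t => (η t : Fin 3 → ℝ)) (Icc a b) := by
    have := hacη.continuousOn
    rwa [uIcc_of_le hab] at this
  set F : ℝ → ℝ := fun s => M.width (past η a s) with hF
  have hmono : MonotoneOn F (Icc a b) := monotoneOn_width_past hc hRpos
  have hmono' : MonotoneOn F (uIcc a b) := by rwa [uIcc_of_le hab]
  -- Only the width is measured after the motion; the sector and the velocity are carried over by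
  -- `R`, which is linear and preserves the form.
  have hrate : ∀ s ∈ Ioo a b, ∀ F' u, HasDerivAt F F' s → M.HasVelocity γ a b s u →
      ∀ v w, M.IsUnitTangent (γ s) v → M.IsUnitTangent (γ s) w → M.form v w = 0 →
      (∀ t ∈ Icc a s, ∃ c α β : ℝ, 0 ≤ α ∧ 0 ≤ β ∧
        (γ t : Fin 3 → ℝ) = c • (γ s : Fin 3 → ℝ) + α • v + β • w) →
      -M.form u v - M.form u w ≤ F' := by
    intro s hs F' u hF' hu v w hv hw hvw hsec
    have hu' : M.HasVelocity η a b s (R u) := L.hasFDerivAt.comp_hasDerivWithinAt s hu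
    have := le_deriv_width_past hc hRpos ⟨hs.1.le, hs.2⟩ (hR.isUnitTangent_map hv)
      (hR.isUnitTangent_map hw) (by rw [hR.form_map, hvw]) (fun t ht => by
        obtain ⟨c, α, β, hα, hβ, he⟩ := hsec t ht
        refine ⟨c, α, β, hα, hβ, ?_⟩
        rw [hηf, hηf, ← map_smul]
        simp only [hf, he, map_add, map_smul]
        rfl) hu' hF'
    rwa [hR.form_map, hR.form_map] at this
  have hdiff : ∀ᵐ s : ℝ, s ∈ Icc a b → s ∈ Ioo a b ∧ HasDerivAt F (deriv F s) s ∧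
      HasDerivAt f (deriv f s) s := by
    filter_upwards [hmono.ae_differentiableWithinAt_of_mem,
      ae_hasDerivAt hab hγ.absolutelyContinuous, ae_ne a, ae_ne b] with s h1 h2 ha hb hs
    have hs' : s ∈ Ioo a b := ⟨lt_of_le_of_ne hs.1 ha.symm, lt_of_le_of_ne hs.2 hb⟩
    exact ⟨hs', ((h1 hs).differentiableAt (Icc_mem_nhds hs'.1 hs'.2)).hasDerivAt, h2 hs⟩
  set g : ℝ → ℝ := fun s => M.tnorm (deriv f s) with hg
  -- Where the velocity vanishes the half-space condition says nothing, but there monotonicity of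
  -- `F` suffices.
  have hgF : ∀ᵐ s : ℝ, s ∈ Icc a b → g s ≤ deriv F s := by
    filter_upwards [hdiff] with s hs hsI
    obtain ⟨hso, hF', hf'⟩ := hs hsI
    by_cases h0 : deriv f s = 0
    · simp only [hg, h0, tnorm_zero]
      refine nonneg_of_hasDerivWithinAt hso.2 hF'.hasDerivWithinAt fun t ht => ?_
      exact hmono hsI ⟨hso.1.le.trans ht.1, ht.2⟩ ht.1
    · exact (hγ.tnorm_le hpos hso h0 hf'.hasDerivWithinAt
        (hrate s hso _ _ hF' hf'.hasDerivWithinAt)).1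
  have hg0 : ∀ t, 0 ≤ g t := fun t => tnorm_nonneg M _
  have hFint : IntervalIntegrable (deriv F) MeasureTheory.volume a b :=
    hmono'.intervalIntegrable_deriv
  have hgF' : ∀ᵐ s ∂MeasureTheory.volume.restrict (Icc a b), g s ≤ deriv F s :=
    (MeasureTheory.ae_restrict_iff' measurableSet_Icc).2 hgF
  have hgmeas : Measurable g := (continuous_tnorm M).measurable.comp (measurable_deriv f)
  have hgint : IntervalIntegrable g MeasureTheory.volume a b := by
    refine hFint.mono_fun' hgmeas.aestronglyMeasurable ?_
    rw [uIoc_of_le hab]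
    filter_upwards [MeasureTheory.ae_restrict_of_ae_restrict_of_subset Ioc_subset_Icc_self hgF']
      with s hs
    rwa [Real.norm_of_nonneg (hg0 s)]
  have hdist : ∀ s t, a ≤ s → s ≤ t → t ≤ b → M.gdist (γ s) (γ t) ≤ ∫ τ in s..t, g τ := by
    intro s t has hst htb
    have hsub : uIcc s t ⊆ uIcc a b := by
      rw [uIcc_of_le hst, uIcc_of_le hab]; exact Icc_subset_Icc has htb
    rw [← hR.gdist_map]
    refine gdist_le_integral (γ := η) hst (hacη.mono hsub)
      (fun τ hτ => hRpos τ ⟨has.trans hτ.1, hτ.2.trans htb⟩) (hgint.mono_set hsub) ?_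
    filter_upwards [hdiff] with τ hτ hmem u hu
    have h1 := (hτ ⟨has.trans hmem.1.le, hmem.2.le.trans htb⟩).2.2
    have h2 : HasDerivAt (fun t => (η t : Fin 3 → ℝ)) (R (deriv f τ)) τ :=
      L.hasFDerivAt.comp_hasDerivAt τ h1
    rw [hu.unique h2, hR.tnorm_map]
  have hlen := length_le_of_gdist_le hab hgint hg0 hdist
  have hI1 : ∫ τ in a..b, g τ ≤ ∫ τ in a..b, deriv F τ :=
    intervalIntegral.integral_mono_ae_restrict hab hgint hFint hgF'
  have hFa : 0 ≤ F a := (isChartCompact_past hc hRpos (left_mem_Icc.2 hab)).width_nonneg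
  have hFab : F a ≤ F b := hmono (left_mem_Icc.2 hab) (right_mem_Icc.2 hab) hab
  -- Lebesgue's inequality for monotone functions; `F` need not be absolutely continuous.
  have hI2 : ∫ τ in a..b, deriv F τ ≤ F b := by
    have := hmono'.intervalIntegral_deriv_mem_uIcc
    rw [uIcc_of_le (sub_nonneg.2 hFab)] at this
    linarith [this.2]
  refine ⟨hlen.trans (ENNReal.ofReal_le_ofReal (hI1.trans hI2)), fun hle => ?_⟩
  have hgnn : 0 ≤ ∫ τ in a..b, g τ := intervalIntegral.integral_nonneg hab fun τ _ => hg0 τ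
  -- In the equality case the chain `∫ g ≤ ∫ F' ≤ F b ≤ ∫ g` closes up, so `F' = g` almost
  -- everywhere.
  have hle' : F b ≤ ∫ τ in a..b, g τ := (ENNReal.ofReal_le_ofReal_iff hgnn).1 (hle.trans hlen)
  have hgF'' := MeasureTheory.ae_restrict_of_ae_restrict_of_subset
    (Ioc_subset_Icc_self (a := a) (b := b)) hgF'
  have hz : ∫ τ in a..b, (deriv F τ - g τ) = 0 := by
    rw [intervalIntegral.integral_sub hFint hgint]; linarith
  rw [intervalIntegral.integral_of_le hab, MeasureTheory.integral_eq_zero_iff_of_nonneg_ae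
    (by filter_upwards [hgF''] with s hs; exact sub_nonneg.2 hs)
    ((intervalIntegrable_iff_integrableOn_Ioc_of_le hab).1 (hFint.sub hgint))] at hz
  have hz' := (MeasureTheory.ae_restrict_iff' measurableSet_Ioc).1 hz
  filter_upwards [hdiff, hz'] with s hs hzs hsI u hu0 hu
  obtain ⟨hso, hF', hf'⟩ := hs hsI
  have huf : u = deriv f s :=
    (hu.hasDerivAt (Icc_mem_nhds hso.1 hso.2)).unique hf'
  refine (hγ.tnorm_le hpos hso hu0 hu (hrate s hso _ _ hF' hu)).2 ?_
  have := hzs ⟨hso.1, hso.2.le⟩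
  simp only [Pi.zero_apply, hg] at this
  rw [huf]
  linarith

end SpaceForm

/-! ### Convex polygons spanned by finite sets. -/

namespace SpaceForm

variable {M : SpaceForm}

/-- The determinant of three vectors. -/
def tri (x y z : Fin 3 → ℝ) : ℝ :=
  x 0 * (y 1 * z 2 - y 2 * z 1) - x 1 * (y 0 * z 2 - y 2 * z 0) + x 2 * (y 0 * z 1 - y 1 * z 0)

lemma det_eq_tri (x y z : Fin 3 → ℝ) : Matrix.det (Matrix.of ![x, y, z]) = tri x y z := by
  simp [Matrix.det_fin_three, tri]; ring

lemma tri_cramer (x a b c : Fin 3 → ℝ) :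
    tri a b c • x = tri x b c • a + tri x c a • b + tri x a b • c := by
  ext i
  fin_cases i <;> simp [tri] <;> ring

lemma exists_smul_add_eq_zero {x y z : Fin 3 → ℝ} (h : tri x y z = 0) :
    ∃ α β δ : ℝ, (α ≠ 0 ∨ β ≠ 0 ∨ δ ≠ 0) ∧ α • x + β • y + δ • z = 0 := by
  rw [← det_eq_tri, ← Matrix.exists_vecMul_eq_zero_iff] at h
  obtain ⟨v, hv, h⟩ := h
  refine ⟨v 0, v 1, v 2, ?_, ?_⟩
  · by_contra! hc
    exact hv (by ext i; fin_cases i <;> simp [hc])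
  · rw [← h]
    ext i
    simp [Matrix.vecMul, dotProduct, Fin.sum_univ_three]

/-- `x` lies in the closed convex cone generated by the points of `S`; this is expressed by
duality. -/
def InCone (S : Set (Fin 3 → ℝ)) (x : Fin 3 → ℝ) : Prop :=
  ∀ g : (Fin 3 → ℝ) →ₗ[ℝ] ℝ, (∀ y ∈ S, g y ≤ 0) → g x ≤ 0

section Independent

variable {S : Finset M.Surface} {e : (Fin 3 → ℝ) →ₗ[ℝ] ℝ}

lemma not_smul_eq_of_not_inCone
    (hI : ∀ x ∈ S, ¬InCone ((fun y : M.Surface => (y : Fin 3 → ℝ)) '' (S \ {x})) x)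
    {x y z w : M.Surface} (hx : x ∈ S) (hy : y ∈ S) (hz : z ∈ S) (hw : w ∈ S) (hyx : y ≠ x)
    (hzx : z ≠ x) (hwx : w ≠ x) {k α β δ : ℝ} (hk : 0 < k) (hα : 0 ≤ α) (hβ : 0 ≤ β) (hδ : 0 ≤ δ)
    (h : k • (x : Fin 3 → ℝ) = α • (y : Fin 3 → ℝ) + β • (z : Fin 3 → ℝ) + δ • (w : Fin 3 → ℝ)) :
    False := by
  refine hI x hx fun g hg => ?_
  have h1 := congrArg g h
  simp only [map_add, map_smul, smul_eq_mul] at h1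
  have hy' := hg y (mem_image_of_mem _ ⟨hy, hyx⟩)
  have hz' := hg z (mem_image_of_mem _ ⟨hz, hzx⟩)
  have hw' := hg w (mem_image_of_mem _ ⟨hw, hwx⟩)
  by_contra! hc
  have := mul_pos hk hc
  nlinarith [mul_nonneg hα (neg_nonneg.2 hy'), mul_nonneg hβ (neg_nonneg.2 hz'),
    mul_nonneg hδ (neg_nonneg.2 hw')]

/-- Since `e` is positive on `S`, a linear relation has coefficients of both signs. One of the three
vectors then stands alone on its side and lies in the cone of the other two. -/
lemma tri_ne_zero (he : ∀ x ∈ S, 0 < e x)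
    (hI : ∀ x ∈ S, ¬InCone ((fun y : M.Surface => (y : Fin 3 → ℝ)) '' (S \ {x})) x)
    {x y z : M.Surface} (hx : x ∈ S) (hy : y ∈ S) (hz : z ∈ S) (hxy : x ≠ y) (hxz : x ≠ z)
    (hyz : y ≠ z) : tri x y z ≠ 0 := by
  intro h
  obtain ⟨α, β, δ, hne, h0⟩ := exists_smul_add_eq_zero h
  have h1 := congrArg e h0
  simp only [map_add, map_smul, smul_eq_mul, map_zero] at h1
  have ex := he x hx
  have ey := he y hy
  have ez := he z hz
  have hx0 : α • (x : Fin 3 → ℝ) = (-β) • (y : Fin 3 → ℝ) + (-δ) • (z : Fin 3 → ℝ) := by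
    rw [← sub_eq_zero, ← h0]; module
  have hy0 : β • (y : Fin 3 → ℝ) = (-α) • (x : Fin 3 → ℝ) + (-δ) • (z : Fin 3 → ℝ) := by
    rw [← sub_eq_zero, ← h0]; module
  have hz0 : δ • (z : Fin 3 → ℝ) = (-α) • (x : Fin 3 → ℝ) + (-β) • (y : Fin 3 → ℝ) := by
    rw [← sub_eq_zero, ← h0]; module
  have key : ∀ {x y z : M.Surface} {α β δ : ℝ}, x ∈ S → y ∈ S → z ∈ S → x ≠ y → x ≠ z →
      α • (x : Fin 3 → ℝ) = (-β) • (y : Fin 3 → ℝ) + (-δ) • (z : Fin 3 → ℝ) →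
      (0 < α → β ≤ 0 → δ ≤ 0 → False) ∧ (α < 0 → 0 ≤ β → 0 ≤ δ → False) := by
    intro x y z α β δ hx hy hz hxy hxz h
    constructor
    · intro h1 h2 h3
      exact not_smul_eq_of_not_inCone hI hx hy hz hz hxy.symm hxz.symm hxz.symm h1
        (neg_nonneg.2 h2) (neg_nonneg.2 h3) le_rfl (by rw [h]; module)
    · intro h1 h2 h3
      exact not_smul_eq_of_not_inCone hI hx hy hz hz hxy.symm hxz.symm hxz.symm (neg_pos.2 h1)
        h2 h3 le_rfl (by rw [neg_smul, h]; module)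
  have kx := key hx hy hz hxy hxz hx0
  have ky := key hy hx hz hxy.symm hyz hy0
  have kz := key hz hx hy hxz.symm hyz.symm hz0
  rcases le_or_gt 0 α with a | a <;> rcases le_or_gt 0 β with b | b <;>
    rcases le_or_gt 0 δ with d | d
  · have := mul_nonneg a ex.le
    have := mul_nonneg b ey.le
    have := mul_nonneg d ez.le
    have a0 : α = 0 := by nlinarith
    have b0 : β = 0 := by nlinarith
    have d0 : δ = 0 := by nlinarith
    simp [a0, b0, d0] at hne
  · exact kz.2 d a b
  · exact ky.2 b a d
  · exact kx.1 (by nlinarith [mul_neg_of_neg_of_pos b ey, mul_neg_of_neg_of_pos d ez]) b.le d.le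
  · exact kx.2 a b d
  · exact ky.1 (by nlinarith [mul_neg_of_neg_of_pos a ex, mul_neg_of_neg_of_pos d ez]) a.le d.le
  · exact kz.1 (by nlinarith [mul_neg_of_neg_of_pos a ex, mul_neg_of_neg_of_pos b ey]) a.le b.le
  · nlinarith [mul_neg_of_neg_of_pos a ex, mul_neg_of_neg_of_pos b ey, mul_neg_of_neg_of_pos d ez]

lemma tri_swap (x a b : Fin 3 → ℝ) : tri x b a = -tri x a b := by simp only [tri]; ring

/-- Otherwise `a`, `b`, `c` wind once around `x`, and Cramer's rule puts `x` in the cone of the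
triangle `a b c`. -/
lemma tri_trans (he : ∀ x ∈ S, 0 < e x)
    (hI : ∀ x ∈ S, ¬InCone ((fun y : M.Surface => (y : Fin 3 → ℝ)) '' (S \ {x})) x)
    {x a b c : M.Surface} (hx : x ∈ S) (ha : a ∈ S) (hb : b ∈ S) (hc : c ∈ S) (hax : a ≠ x)
    (hbx : b ≠ x) (hcx : c ≠ x) (hab : 0 < tri x a b) (hbc : 0 < tri x b c) : 0 < tri x a c := by
  have hac : a ≠ c := by
    rintro rfl
    rw [tri_swap] at hbc
    linarith
  by_contra! h
  have hlt : 0 < tri x c a := by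
    rw [tri_swap]
    exact neg_pos.2 (lt_of_le_of_ne h (tri_ne_zero he hI hx ha hc hax.symm hcx.symm hac))
  have hcr := tri_cramer (x : Fin 3 → ℝ) a b c
  have h1 := congrArg e hcr
  simp only [map_add, map_smul, smul_eq_mul] at h1
  have hpos : 0 < tri a b c := by
    by_contra! hn
    nlinarith [mul_pos hbc (he a ha), mul_pos hlt (he b hb), mul_pos hab (he c hc),
      mul_nonneg (neg_nonneg.2 hn) (he x hx).le]
  exact not_smul_eq_of_not_inCone hI hx ha hb hc hax hbx hcx hpos hbc.le hlt.le hab.le hcr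

/-- Otherwise Cramer's rule, solved for `b`, puts `b` in the cone of `x`, `a`, `c`. -/
lemma tri_pos_of_sorted (he : ∀ x ∈ S, 0 < e x)
    (hI : ∀ x ∈ S, ¬InCone ((fun y : M.Surface => (y : Fin 3 → ℝ)) '' (S \ {x})) x)
    {x a b c : M.Surface} (hx : x ∈ S) (ha : a ∈ S) (hb : b ∈ S) (hc : c ∈ S) (hax : a ≠ x)
    (hbx : b ≠ x) (hcx : c ≠ x) (hab : 0 < tri x a b) (hbc : 0 < tri x b c) : 0 < tri a b c := by
  have hac := tri_trans he hI hx ha hb hc hax hbx hcx hab hbc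
  have hne : a ≠ b := by rintro rfl; simp [tri] at hab; linarith
  have hne' : b ≠ c := by rintro rfl; simp [tri] at hbc; linarith
  by_contra! h
  refine not_smul_eq_of_not_inCone hI hb hx ha hc hbx.symm hne hne'.symm hac
    (neg_nonneg.2 h) hbc.le hab.le ?_
  have := tri_cramer (x : Fin 3 → ℝ) a b c
  rw [tri_swap (x : Fin 3 → ℝ) a c] at this
  rw [neg_smul, this]
  module

/-- Fix one point `x`. The orientation of triangles with vertex `x` is a total order on the other
points, so they can be sorted by angle around `x`. -/
lemma exists_isConvexPolygon_of_independent (hS : S.Nonempty) (he : ∀ x ∈ S, 0 < e x)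
    (hI : ∀ x ∈ S, ¬InCone ((fun y : M.Surface => (y : Fin 3 → ℝ)) '' (S \ {x})) x) :
    ∃ (n : ℕ) (p : Fin (n + 1) → M.Surface), (∀ i, p i ∈ S) ∧ M.IsConvexPolygon p ∧
      ∀ x ∈ S, x ∈ range p := by
  classical
  obtain ⟨x, hx⟩ := hS
  let T := {y // y ∈ S ∧ y ≠ x}
  let r : T → T → Prop := fun a b => a = b ∨ 0 < tri x a.1 b.1
  have htot : Std.Total r := ⟨fun a b => by
    by_cases hab : a = b
    · exact Or.inl (Or.inl hab)
    · have hne : a.1 ≠ b.1 := fun h => hab (Subtype.ext h)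
      rcases lt_or_gt_of_ne (tri_ne_zero he hI hx a.2.1 b.2.1 a.2.2.symm b.2.2.symm hne) with h | h
      · exact Or.inr (Or.inr (by rw [tri_swap]; linarith))
      · exact Or.inl (Or.inr h)⟩
  have htrans : IsTrans T r := ⟨by
    rintro a b c (rfl | hab) (rfl | hbc)
    · exact Or.inl rfl
    · exact Or.inr hbc
    · exact Or.inr hab
    · exact Or.inr (tri_trans he hI hx a.2.1 b.2.1 c.2.1 a.2.2 b.2.2 c.2.2 hab hbc)⟩
  have hfin : Finite T :=
    Finite.of_injective (fun t : T => (⟨t.1, t.2.1⟩ : {y // y ∈ S})) fun a b h =>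
      Subtype.ext (congrArg (fun z : {y // y ∈ S} => z.1) h)
  have hfintype : Fintype T := Fintype.ofFinite T
  set l : List T := (Finset.univ : Finset T).toList.insertionSort r with hl
  have hsort : l.Pairwise r := List.pairwise_insertionSort r _
  have hnodup : l.Nodup :=
    (List.perm_insertionSort r _).nodup_iff.2 (Finset.nodup_toList _)
  have hmem : ∀ t : T, t ∈ l := fun t =>
    (List.perm_insertionSort r _).mem_iff.2 (by simp)
  have hget : ∀ i j : Fin l.length, i < j → 0 < tri x (l.get i).1 (l.get j).1 := by
    intro i j hij
    refine (List.pairwise_iff_get.1 hsort i j hij).resolve_left fun h => ?_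
    exact hij.ne (hnodup.injective_get h)
  refine ⟨l.length, Fin.cons x fun i => (l.get i).1, ?_, ?_, ?_⟩
  · intro i
    refine Fin.cases ?_ (fun i => ?_) i
    · simpa using hx
    · simpa using (l.get i).2.1
  · intro i j k hij hjk
    rw [det_eq_tri]
    obtain ⟨j, rfl⟩ := Fin.exists_succ_eq.2 (Fin.ne_zero_of_lt hij)
    obtain ⟨k, rfl⟩ := Fin.exists_succ_eq.2 (Fin.ne_zero_of_lt hjk)
    rw [Fin.succ_lt_succ_iff] at hjk
    refine Fin.cases (fun _ => ?_) (fun i hij => ?_) i hij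
    · simpa only [Fin.cons_zero, Fin.cons_succ] using hget j k hjk
    · simp only [Fin.cons_succ]
      rw [Fin.succ_lt_succ_iff] at hij
      exact tri_pos_of_sorted he hI hx (l.get i).2.1 (l.get j).2.1 (l.get k).2.1 (l.get i).2.2
        (l.get j).2.2 (l.get k).2.2 (hget i j hij) (hget j k hjk)
  · intro y hy
    by_cases hyx : y = x
    · exact ⟨0, by simp [hyx]⟩
    · obtain ⟨i, hi⟩ := List.get_of_mem (hmem ⟨y, hy, hyx⟩)
      exact ⟨i.succ, by rw [Fin.cons_succ, hi]⟩

end Independent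

/-- The convex hull of a finite set in an open half space is a convex polygon. -/
lemma exists_isConvexPolygon {e : (Fin 3 → ℝ) →ₗ[ℝ] ℝ} (S : Finset M.Surface) (hS : S.Nonempty)
    (he : ∀ x ∈ S, 0 < e x) :
    ∃ (n : ℕ) (p : Fin (n + 1) → M.Surface), (∀ i, p i ∈ S) ∧ M.IsConvexPolygon p ∧
      ∀ x ∈ S, InCone (range fun i => (p i : Fin 3 → ℝ)) x := by
  classical
  induction S using Finset.strongInduction with
  | H S ih =>
    by_cases hI : ∀ x ∈ S, ¬InCone ((fun y : M.Surface => (y : Fin 3 → ℝ)) '' (S \ {x})) x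
    · obtain ⟨n, p, h1, h2, h3⟩ := exists_isConvexPolygon_of_independent hS he hI
      refine ⟨n, p, h1, h2, fun x hx g hg => ?_⟩
      obtain ⟨i, rfl⟩ := h3 x hx
      exact hg _ (mem_range_self i)
    · push Not at hI
      obtain ⟨x, hx, hc⟩ := hI
      have hne : (S.erase x).Nonempty := by
        -- The cone of the empty set is `{0}`, and `e x > 0`; so a redundant point is never the only
        -- one.
        by_contra hemp
        rw [Finset.not_nonempty_iff_eq_empty] at hemp
        refine absurd (hc e ?_) (not_le.2 (he x hx))
        rintro _ ⟨y, ⟨hy, hyx⟩, rfl⟩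
        have : y ∈ S.erase x := Finset.mem_erase.2 ⟨hyx, hy⟩
        rw [hemp] at this
        exact absurd this (Finset.notMem_empty y)
      obtain ⟨n, p, h1, h2, h3⟩ := ih (S.erase x) (Finset.erase_ssubset hx) hne
        fun y hy => he y (Finset.mem_of_mem_erase hy)
      refine ⟨n, p, fun i => Finset.mem_of_mem_erase (h1 i), h2, fun y hy g hg => ?_⟩
      by_cases hyx : y = x
      · subst hyx
        refine hc g ?_
        rintro _ ⟨z, ⟨hz, hzx⟩, rfl⟩
        exact h3 z (Finset.mem_erase.2 ⟨hzx, hz⟩) g hg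
      · exact h3 y (Finset.mem_erase.2 ⟨hyx, hy⟩) g hg

end SpaceForm

/-! ### The boundary of a set as a source of inscribed polygons. -/

namespace SpaceForm

variable {M : SpaceForm} {R : (Fin 3 → ℝ) →ₗ[ℝ] (Fin 3 → ℝ)}

/-- A convex polygon has, in every direction, the same support as the points it spans. -/
lemma exists_supp_le_of_inCone (hR : M.IsMotion R) {n : ℕ} (p : Fin (n + 1) → M.Surface)
    (hp : ∀ i, 0 < R (p i) 2) {x : M.Surface} (hx : 0 < R x 2)
    (h : InCone (range fun i => (p i : Fin 3 → ℝ)) x) (θ : ℝ) :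
    ∃ i, M.supp θ (R x) ≤ M.supp θ (R (p i)) := by
  obtain ⟨i, hi⟩ := Finite.exists_max fun i => radial θ (R (p i)) / R (p i) 2
  refine ⟨i, supp_le_supp (hR.mem_map x x.2) hx (hR.mem_map _ (p i).2) (hp i) ?_⟩
  let ρ : (Fin 3 → ℝ) →ₗ[ℝ] ℝ :=
    Real.cos θ • LinearMap.proj 0 + Real.sin θ • LinearMap.proj 1
  -- The half space `{g ≤ 0}` is bounded by the supporting line of the polygon at `p i`; it contains
  -- the vertices, hence their cone.
  let g : (Fin 3 → ℝ) →ₗ[ℝ] ℝ :=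
    (R (p i) 2) • (ρ ∘ₗ R) - (radial θ (R (p i))) • ((LinearMap.proj 2) ∘ₗ R)
  have hg : ∀ v, g v = R (p i) 2 * radial θ (R v) - radial θ (R (p i)) * R v 2 := by
    intro v
    simp [g, ρ, radial]
  have := h g ?_
  · rw [hg] at this
    linarith
  · rintro _ ⟨j, rfl⟩
    rw [hg]
    have h1 := hi j
    rw [div_le_div_iff₀ (hp j) (hp i)] at h1
    linarith

/-- If in every direction `A` is dominated by the boundary of `Q`, then the width of `A` is at
most the perimeter of `Q`. -/
lemma width_le_perimeter (hR : M.IsMotion R) {Q : Set M.Surface} (hF : IsCompact (frontier Q))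
    (hpos : ∀ y ∈ frontier Q, 0 < R y 2) {A : Set (Fin 3 → ℝ)} (hA : M.IsChartCompact A)
    (h : ∀ z ∈ A, ∀ θ, ∃ y ∈ frontier Q, M.supp θ z ≤ M.supp θ (R y)) :
    ENNReal.ofReal (M.width A) ≤ M.perimeter Q := by
  refine ENNReal.le_of_forall_pos_le_add fun ε hε _ => ?_
  -- The admissible error in each direction; integrated over the full turn it becomes `ε`.
  have hδ : (0 : ℝ) < ε / (2 * Real.pi) := div_pos hε Real.two_pi_pos
  have hRc : Continuous R := R.continuous_of_finiteDimensional
  have hcont : ContinuousOn (fun q : ℝ × M.Surface => M.supp q.1 (R q.2))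
      (Icc 0 (2 * Real.pi) ×ˢ frontier Q) := by
    refine (continuousOn_supp (M := M)).comp (f := fun q : ℝ × M.Surface => (q.1, R q.2))
      (by fun_prop) ?_
    intro q hq
    exact ⟨hR.mem_map _ q.2.2, hpos _ hq.2⟩
  have huc := (isCompact_Icc.prod hF).uniformContinuousOn_of_continuous hcont
  rw [Metric.uniformContinuousOn_iff] at huc
  obtain ⟨η, hη, huc⟩ := huc _ hδ
  -- A finite `η`-net of the boundary; passing from a boundary point to a net point costs less than
  -- `ε / (2π)` of support, uniformly in `θ`.
  obtain ⟨t, ht, htf, hcov⟩ := hF.finite_cover_balls hη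
  obtain ⟨z, hz⟩ := hA.nonempty
  obtain ⟨y, hy, -⟩ := h z hz 0
  have htne : htf.toFinset.Nonempty := by
    obtain ⟨x, hx, -⟩ := mem_iUnion₂.1 (hcov hy)
    exact ⟨x, by simpa using hx⟩
  obtain ⟨n, p, hpS, hpoly, hcone⟩ := exists_isConvexPolygon
    (e := (LinearMap.proj 2) ∘ₗ R) htf.toFinset htne
    (fun x hx => by simpa using hpos x (ht (by simpa using hx)))
  have hpF : ∀ i, p i ∈ frontier Q := fun i => ht (by simpa using hpS i)
  have hB : M.IsChartCompact (range fun i => (hR.map (p i) : Fin 3 → ℝ)) := by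
    refine ⟨(finite_range _).isCompact, range_nonempty _, ?_, ?_⟩
    · rintro _ ⟨i, rfl⟩
      exact (hR.map (p i)).2
    · rintro _ ⟨i, rfl⟩
      exact hpos _ (hpF i)
  have hw : M.width A ≤ M.width (range fun i => (hR.map (p i) : Fin 3 → ℝ)) +
      2 * Real.pi * (ε / (2 * Real.pi)) := by
    refine hA.width_le_add hB fun θ hθ => hA.supMax_le fun z hz => ?_
    obtain ⟨y, hy, hzy⟩ := h z hz θ
    obtain ⟨x, hx, hxy⟩ := mem_iUnion₂.1 (hcov hy)
    have h1 := huc (θ, y) ⟨hθ, hy⟩ (θ, x) ⟨hθ, ht hx⟩ (by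
      rw [Prod.dist_eq, dist_self]
      exact max_lt hη hxy)
    rw [Real.dist_eq] at h1
    have h2 := (abs_lt.1 h1).2
    obtain ⟨i, hi⟩ := exists_supp_le_of_inCone hR p (fun i => hpos _ (hpF i)) (hpos x (ht hx))
      (hcone x (by simpa using hx)) θ
    have h3 := hB.le_supMax (θ := θ) (mem_range_self i)
    simp only [IsMotion.map] at h3 ⊢
    simp only at h2
    linarith
  rw [mul_div_cancel₀ _ Real.two_pi_pos.ne'] at hw
  have hsum := width_range_le_sum_gdist (fun i => hR.map (p i)) fun i => hpos _ (hpF i)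
  calc ENNReal.ofReal (M.width A)
      ≤ ENNReal.ofReal (∑ i, M.gdist (p i) (p (i + 1)) + ε) := by
        refine ENNReal.ofReal_le_ofReal (hw.trans ?_)
        simp only [hR.gdist_map] at hsum
        linarith
    _ ≤ ENNReal.ofReal (∑ i, M.gdist (p i) (p (i + 1))) + ENNReal.ofReal ε :=
        ENNReal.ofReal_add_le
    _ ≤ M.perimeter Q + ε := by
        rw [ENNReal.ofReal_coe_nnreal]
        gcongr
        exact le_iSup_of_le n (le_iSup_of_le p (le_iSup_of_le hpF (le_iSup_of_le hpoly le_rfl)))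

/-- A path that starts in `Q` and ends outside `Q` meets the boundary of `Q`. -/
lemma exists_mem_frontier {X : Type*} [TopologicalSpace X] {Q : Set X} {c : ℝ → X}
    (hc : ContinuousOn c (Icc 0 1)) (h0 : c 0 ∈ Q) (h1 : c 1 ∉ Q) :
    ∃ t ∈ Icc (0 : ℝ) 1, c t ∈ frontier Q := by
  have hc' := continuousOn_iff_continuous_domRestrict.1 hc
  have hne : (frontier ((Icc (0 : ℝ) 1).domRestrict c ⁻¹' Q)).Nonempty := by
    have : PreconnectedSpace (Icc (0 : ℝ) 1) :=
      isPreconnected_iff_preconnectedSpace.1 isPreconnected_Icc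
    refine nonempty_frontier_iff.2 ⟨⟨⟨0, by simp⟩, h0⟩, fun h => h1 ?_⟩
    have : (⟨1, by simp⟩ : Icc (0 : ℝ) 1) ∈ (Icc (0 : ℝ) 1).domRestrict c ⁻¹' Q := by
      rw [h]; trivial
    exact this
  obtain ⟨t, ht⟩ := hne
  exact ⟨t, t.2, hc'.frontier_preimage_subset Q ht⟩

end SpaceForm

/-! ### Width and perimeter in the plane and the hyperbolic plane. -/

namespace SpaceForm

variable {M : SpaceForm} {R : (Fin 3 → ℝ) →ₗ[ℝ] (Fin 3 → ℝ)}

/-- If from every point of `A` there is a path to the complement of `Q` that goes outward in a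
given direction, then the width of `A` is at most the perimeter of `Q`. -/
lemma width_le_perimeter_of_path (hR : M.IsMotion R) {Q : Set M.Surface}
    (hF : IsCompact (frontier Q)) (hpos : ∀ y ∈ frontier Q, 0 < R y 2) {A : Set (Fin 3 → ℝ)}
    (hA : M.IsChartCompact A)
    (h : ∀ z ∈ A, ∀ θ, ∃ c : ℝ → M.Surface, ContinuousOn c (Icc 0 1) ∧ c 0 ∈ Q ∧ c 1 ∉ Q ∧
      ∀ t ∈ Icc (0 : ℝ) 1, radial θ z * R (c t) 2 ≤ radial θ (R (c t)) * z 2) :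
    ENNReal.ofReal (M.width A) ≤ M.perimeter Q := by
  refine width_le_perimeter hR hF hpos hA fun z hz θ => ?_
  obtain ⟨c, hc, h0, h1, hrad⟩ := h z hz θ
  obtain ⟨t, ht, hy⟩ := exists_mem_frontier hc h0 h1
  exact ⟨c t, hy, supp_le_supp (hA.mem z hz) (hA.pos z hz) (hR.mem_map _ (c t).2) (hpos _ hy)
    (hrad t ht)⟩

lemma isClosed_mem (M : SpaceForm) : IsClosed {x : Fin 3 → ℝ | M.Mem x} := by
  cases M
  · exact isClosed_eq (by simp only [form]; fun_prop) continuous_const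
  · exact isClosed_eq (by fun_prop) continuous_const
  -- The strict inequality may be weakened, as `x 2 = 0` contradicts the equation of the
  -- hyperboloid.
  · have : {x : Fin 3 → ℝ | lobachevskij.Mem x} =
        {x | form lobachevskij x x = -1} ∩ {x | 0 ≤ x 2} := by
      ext x
      refine ⟨fun h => ⟨h.1, h.2.le⟩, fun h => ⟨h.1, lt_of_le_of_ne h.2 fun h0 => ?_⟩⟩
      have h1 : form lobachevskij x x = -1 := h.1
      simp only [form, ← h0] at h1
      nlinarith [sq_nonneg (x 0), sq_nonneg (x 1)]
    rw [this]
    exact (isClosed_eq (by simp only [form]; fun_prop) continuous_const).inter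
      (isClosed_le continuous_const (by fun_prop))

lemma isClosedEmbedding_coe (M : SpaceForm) :
    Topology.IsClosedEmbedding ((↑) : M.Surface → (Fin 3 → ℝ)) :=
  (isClosed_mem M).isClosedEmbedding_subtypeVal

/-- A set with bounded coordinates has compact closure. -/
lemma isCompact_closure_of_abs_le {Q : Set M.Surface} {r : ℝ}
    (h : ∀ y ∈ Q, ∀ i, |(y : Fin 3 → ℝ) i| ≤ r) : IsCompact (closure Q) := by
  have h1 : IsCompact ((fun y : M.Surface => (y : Fin 3 → ℝ)) ⁻¹'
      (Set.pi univ fun _ => Icc (-r) r)) :=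
    (isClosedEmbedding_coe M).isCompact_preimage (isCompact_univ_pi fun _ => isCompact_Icc)
  refine h1.of_isClosed_subset isClosed_closure (closure_minimal ?_ h1.isClosed)
  intro y hy i _
  exact abs_le.1 (h y hy i)

lemma gdist_le_toReal_diam {Q : Set M.Surface} (hQ : M.diam Q < ⊤) {x y : M.Surface} (hx : x ∈ Q)
    (hy : y ∈ Q) : M.gdist x y ≤ (M.diam Q).toReal := by
  refine (ENNReal.ofReal_le_iff_le_toReal hQ.ne).1 ?_
  exact le_iSup_of_le x (le_iSup_of_le hx (le_iSup_of_le y (le_iSup_of_le hy le_rfl)))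

lemma sqrt_lt_of_mem (x : lobachevskij.Surface) :
    Real.sqrt ((x : Fin 3 → ℝ) 0 ^ 2 + (x : Fin 3 → ℝ) 1 ^ 2) < (x : Fin 3 → ℝ) 2 := by
  have hx := x.2
  simp only [Mem, form] at hx
  rw [Real.sqrt_lt' hx.2]
  nlinarith

/-- The coordinates of a point of the hyperboloid are bounded by the distance to a given point. -/
lemma abs_coord_le_of_neg_form_le (x y : lobachevskij.Surface) {k : ℝ}
    (h : -form lobachevskij x y ≤ k) (i : Fin 3) :
    |(y : Fin 3 → ℝ) i| ≤ k / ((x : Fin 3 → ℝ) 2 -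
      Real.sqrt ((x : Fin 3 → ℝ) 0 ^ 2 + (x : Fin 3 → ℝ) 1 ^ 2)) := by
  have hlt := sqrt_lt_of_mem x
  have hy := y.2
  obtain ⟨σ, hσ⟩ : ∃ σ, σ = Real.sqrt ((x : Fin 3 → ℝ) 0 ^ 2 + (x : Fin 3 → ℝ) 1 ^ 2) := ⟨_, rfl⟩
  have hσ2 : σ ^ 2 = (x : Fin 3 → ℝ) 0 ^ 2 + (x : Fin 3 → ℝ) 1 ^ 2 := by
    rw [hσ, Real.sq_sqrt (by positivity)]
  have hσ0 : 0 ≤ σ := hσ ▸ Real.sqrt_nonneg _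
  rw [← hσ] at hlt ⊢
  simp only [Mem, form] at hy h
  have h2 : (y : Fin 3 → ℝ) 2 ≤ k / ((x : Fin 3 → ℝ) 2 - σ) := by
    -- Cauchy–Schwarz for the horizontal parts gives `(x 2 - σ) * y 2 ≤ k`.
    rw [le_div_iff₀ (sub_pos.2 hlt)]
    have h3 : (x : Fin 3 → ℝ) 0 * (y : Fin 3 → ℝ) 0 + (x : Fin 3 → ℝ) 1 * (y : Fin 3 → ℝ) 1 ≤
        σ * (y : Fin 3 → ℝ) 2 := by
      refine (abs_le_of_sq_le_sq' ?_ (mul_nonneg hσ0 hy.2.le)).2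
      rw [mul_pow, hσ2]
      nlinarith [sq_nonneg ((x : Fin 3 → ℝ) 0 * (y : Fin 3 → ℝ) 1 -
        (x : Fin 3 → ℝ) 1 * (y : Fin 3 → ℝ) 0), sq_nonneg ((x : Fin 3 → ℝ) 0),
        sq_nonneg ((x : Fin 3 → ℝ) 1)]
    linarith
  refine le_trans ?_ h2
  refine abs_le_of_sq_le_sq ?_ hy.2.le
  fin_cases i <;> simp <;> nlinarith [sq_nonneg ((y : Fin 3 → ℝ) 0), sq_nonneg ((y : Fin 3 → ℝ) 1)]

/-- A set of finite diameter has bounded coordinates. -/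
lemma exists_abs_le_of_diam_lt_top {Q : Set M.Surface} (hQ : M.diam Q < ⊤) (hM : M ≠ sphere)
    {x : M.Surface} (hx : x ∈ Q) : ∃ r, 0 ≤ r ∧ ∀ y ∈ Q, ∀ i, |(y : Fin 3 → ℝ) i| ≤ r := by
  suffices ∃ r, ∀ y ∈ Q, ∀ i, |(y : Fin 3 → ℝ) i| ≤ r by
    obtain ⟨r, hr⟩ := this
    exact ⟨r, (abs_nonneg _).trans (hr x hx 0), hr⟩
  cases M
  · exact absurd rfl hM
  · refine ⟨|(x : Fin 3 → ℝ) 0| + |(x : Fin 3 → ℝ) 1| + (diam plane Q).toReal + 1,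
      fun y hy i => ?_⟩
    have h := gdist_le_toReal_diam hQ hx hy
    have hD : 0 ≤ (diam plane Q).toReal := ENNReal.toReal_nonneg
    simp only [gdist, form, Pi.sub_apply] at h
    rw [Real.sqrt_le_left hD] at h
    have h0 : |(x : Fin 3 → ℝ) 0 - (y : Fin 3 → ℝ) 0| ≤ (diam plane Q).toReal :=
      abs_le_of_sq_le_sq (by nlinarith [sq_nonneg ((x : Fin 3 → ℝ) 1 - (y : Fin 3 → ℝ) 1)]) hD
    have h1 : |(x : Fin 3 → ℝ) 1 - (y : Fin 3 → ℝ) 1| ≤ (diam plane Q).toReal :=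
      abs_le_of_sq_le_sq (by nlinarith [sq_nonneg ((x : Fin 3 → ℝ) 0 - (y : Fin 3 → ℝ) 0)]) hD
    have h2 : (y : Fin 3 → ℝ) 2 = 1 := y.2
    rw [abs_le] at h0 h1 ⊢
    have a0 := abs_nonneg ((x : Fin 3 → ℝ) 0)
    have a1 := abs_nonneg ((x : Fin 3 → ℝ) 1)
    have b0 := le_abs_self ((x : Fin 3 → ℝ) 0)
    have b1 := le_abs_self ((x : Fin 3 → ℝ) 1)
    have c0 := neg_abs_le ((x : Fin 3 → ℝ) 0)
    have c1 := neg_abs_le ((x : Fin 3 → ℝ) 1)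
    fin_cases i <;> simp <;> constructor <;> linarith
  · refine ⟨_, fun y hy i => abs_coord_le_of_neg_form_le x y
      (k := Real.cosh (diam lobachevskij Q).toReal) ?_ i⟩
    have h := gdist_le_toReal_diam hQ hx hy
    have h1 := neg_form_ge_one x y
    simp only [gdist] at h
    rw [← Real.cosh_arcosh h1, Real.cosh_le_cosh, abs_of_nonneg (Real.arcosh_nonneg h1),
      abs_of_nonneg ENNReal.toReal_nonneg]
    exact h

/-- Monotonicity of `p / √(k² + p²)`, cross-multiplied. -/
lemma mul_le_add_mul_of_sq_eq {p s k A B : ℝ} (hs : 0 ≤ s) (hA : A ^ 2 = k ^ 2 + p ^ 2)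
    (hB : B ^ 2 = k ^ 2 + (p + s) ^ 2) (hA0 : 0 ≤ A) (hB0 : 0 ≤ B) : p * B ≤ (p + s) * A := by
  rcases le_or_gt 0 p with hp | hp
  · refine abs_le_of_sq_le_sq' ?_ (by positivity) |>.2
    rw [mul_pow, mul_pow, hA, hB]
    nlinarith [mul_nonneg (sq_nonneg k) (mul_nonneg hp hs), mul_nonneg (sq_nonneg k) (sq_nonneg s)]
  · rcases le_or_gt 0 (p + s) with hq | hq
    · nlinarith [mul_nonneg hq hA0, mul_nonneg hB0 (neg_nonneg.2 hp.le)]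
    · have : -(p + s) * A ≤ -p * B := by
        refine abs_le_of_sq_le_sq' ?_ (mul_nonneg (by linarith) hB0) |>.2
        rw [mul_pow, mul_pow, hA, hB]
        have : 0 ≤ s * (-(2 * p + s)) := mul_nonneg hs (by linarith)
        nlinarith [mul_nonneg (sq_nonneg k) this]
      linarith

/-- The point of the surface over a given point of the coordinate plane. -/
noncomputable def lift (M : SpaceForm) (x : Fin 3 → ℝ) : Fin 3 → ℝ :=
  ![x 0, x 1, Real.sqrt (1 + -M.curv * (x 0 ^ 2 + x 1 ^ 2))]

lemma lift_mem (hM : M ≠ sphere) (x : Fin 3 → ℝ) : M.Mem (M.lift x) := by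
  cases M
  · exact absurd rfl hM
  · simp [Mem, lift, curv]
  · have h : 0 < 1 + (x 0 ^ 2 + x 1 ^ 2) := by positivity
    simp only [Mem, lift, curv, form]
    simp
    rw [Real.mul_self_sqrt h.le]
    exact ⟨by ring, h⟩

lemma lift_self (hM : M ≠ sphere) (x : M.Surface) : M.lift x = x := by
  have hx := x.2
  cases M
  · exact absurd rfl hM
  · ext i
    simp only [Mem] at hx
    fin_cases i <;> simp [lift, curv, hx]
  · ext i
    simp only [Mem, form] at hx
    fin_cases i <;> simp [lift, curv]
    rw [Real.sqrt_eq_iff_mul_self_eq_of_pos hx.2]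
    linarith

/-- A horizontal shift by `s` in direction `θ` fixes `transverse θ` and adds `s` to `radial θ`, so
the chart coordinate in direction `θ` does not decrease. -/
lemma radial_mul_lift_le (hM : M ≠ sphere) (x : M.Surface) (θ : ℝ) {s : ℝ} (hs : 0 ≤ s) :
    radial θ x * M.lift ((x : Fin 3 → ℝ) + s • ![Real.cos θ, Real.sin θ, 0]) 2 ≤
      radial θ (M.lift ((x : Fin 3 → ℝ) + s • ![Real.cos θ, Real.sin θ, 0])) *
        (x : Fin 3 → ℝ) 2 := by
  have hx := x.2
  have hsc := Real.sin_sq_add_cos_sq θ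
  cases M
  · exact absurd rfl hM
  · simp only [Mem] at hx
    simp [lift, curv, radial, hx]
    nlinarith
  · simp only [Mem, form] at hx
    have e : radial θ (lobachevskij.lift ((x : Fin 3 → ℝ) + s • ![Real.cos θ, Real.sin θ, 0])) =
        radial θ x + s := by
      simp [lift, radial]
      linear_combination s * hsc
    rw [e]
    have e2 := form_eq lobachevskij θ x x
    simp only [form, curv] at e2
    refine mul_le_add_mul_of_sq_eq (k := Real.sqrt (1 + transverse θ x ^ 2)) hs ?_ ?_ hx.2.le ?_
    · rw [Real.sq_sqrt (by positivity)]
      linarith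
    · rw [Real.sq_sqrt (by positivity)]
      simp [lift, curv]
      rw [Real.sq_sqrt (by positivity)]
      simp only [radial, transverse]
      linear_combination (-(x : Fin 3 → ℝ) 0 ^ 2 - (x : Fin 3 → ℝ) 1 ^ 2 + s ^ 2) * hsc
    · simp [lift]

lemma width_le_perimeter_of_ne_sphere (hM : M ≠ sphere) {Q : Set M.Surface} (hQ : M.diam Q < ⊤)
    {A : Set (Fin 3 → ℝ)} (hA : M.IsChartCompact A) (hAQ : A ⊆ (↑) '' Q) :
    ENNReal.ofReal (M.width A) ≤ M.perimeter Q := by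
  obtain ⟨z, hz⟩ := hA.nonempty
  obtain ⟨x, hx, -⟩ := hAQ hz
  obtain ⟨r, hr0, hr⟩ := exists_abs_le_of_diam_lt_top hQ hM hx
  have hpos : ∀ y : M.Surface, 0 < (y : Fin 3 → ℝ) 2 := by
    intro y
    have := y.2
    cases M
    · exact absurd rfl hM
    · rw [show (y : Fin 3 → ℝ) 2 = 1 from this]
      exact one_pos
    · exact this.2
  refine width_le_perimeter_of_path (isMotion_id M)
    ((isCompact_closure_of_abs_le hr).of_isClosed_subset isClosed_frontier frontier_subset_closure)
    (fun y _ => hpos y) hA fun z hz θ => ?_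
  obtain ⟨x, hx, rfl⟩ := hAQ hz
  -- If the end point were in `Q`, each horizontal coordinate would have moved by at most `2 r`, and
  -- the shift would be at most `4 r`.
  refine ⟨fun t => ⟨M.lift ((x : Fin 3 → ℝ) + (t * (4 * r + 1)) • ![Real.cos θ, Real.sin θ, 0]),
    lift_mem hM _⟩, ?_, ?_, ?_, ?_⟩
  · refine (Continuous.subtype_mk ?_ _).continuousOn
    unfold lift
    fun_prop
  · convert hx
    simp [lift_self hM]
  · intro h1
    have a := hr _ h1 0
    have b := hr _ h1 1
    have a' := hr _ hx 0
    have b' := hr _ hx 1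
    simp [lift] at a b
    rw [abs_le] at a b a' b'
    have hsc := Real.sin_sq_add_cos_sq θ
    have e : (4 * r + 1) = Real.cos θ * ((4 * r + 1) * Real.cos θ) +
        Real.sin θ * ((4 * r + 1) * Real.sin θ) := by linear_combination -(4 * r + 1) * hsc
    have c1 : Real.cos θ * ((4 * r + 1) * Real.cos θ) ≤ 2 * r := by
      have := abs_le_of_sq_le_sq (a := Real.cos θ * ((4 * r + 1) * Real.cos θ)) (b := 2 * r) ?_
        (by positivity)
      · exact (abs_le.1 this).2
      · have h2 : ((4 * r + 1) * Real.cos θ) ^ 2 ≤ (2 * r) ^ 2 :=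
          sq_le_sq' (by linarith) (by linarith)
        rw [mul_pow]
        nlinarith [sq_nonneg (Real.sin θ), sq_nonneg (Real.cos θ),
          sq_nonneg ((4 * r + 1) * Real.cos θ),
          mul_nonneg (sq_nonneg (Real.sin θ)) (sq_nonneg ((4 * r + 1) * Real.cos θ))]
    have c2 : Real.sin θ * ((4 * r + 1) * Real.sin θ) ≤ 2 * r := by
      have := abs_le_of_sq_le_sq (a := Real.sin θ * ((4 * r + 1) * Real.sin θ)) (b := 2 * r) ?_
        (by positivity)
      · exact (abs_le.1 this).2
      · have h2 : ((4 * r + 1) * Real.sin θ) ^ 2 ≤ (2 * r) ^ 2 :=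
          sq_le_sq' (by linarith) (by linarith)
        rw [mul_pow]
        nlinarith [mul_nonneg (sq_nonneg (Real.cos θ)) (sq_nonneg ((4 * r + 1) * Real.sin θ))]
    linarith
  · intro t ht
    exact radial_mul_lift_le hM x θ (mul_nonneg ht.1 (by positivity))

end SpaceForm

/-! ### Convex sets on the sphere and their cones. -/

namespace SpaceForm

lemma form_sphere_pos {v : Fin 3 → ℝ} (hv : v ≠ 0) : 0 < form sphere v v := by
  obtain ⟨i, hi⟩ := Function.ne_iff.1 hv
  have h := mul_self_pos.2 hi
  have h1 := Finset.single_le_sum (f := fun j => v j * v j) (fun j _ => mul_self_nonneg (v j))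
    (Finset.mem_univ i)
  rw [Fin.sum_univ_three] at h1
  exact h.trans_le h1

lemma neg_one_le_form_sphere (x y : sphere.Surface) : -1 ≤ form sphere x y := by
  have hx := x.2
  have hy := y.2
  simp only [Mem, form] at *
  nlinarith [sq_nonneg ((x : Fin 3 → ℝ) 0 + (y : Fin 3 → ℝ) 0),
    sq_nonneg ((x : Fin 3 → ℝ) 1 + (y : Fin 3 → ℝ) 1),
    sq_nonneg ((x : Fin 3 → ℝ) 2 + (y : Fin 3 → ℝ) 2)]

lemma cos_gdist_sphere (x y : sphere.Surface) :
    Real.cos (gdist sphere x y) = form sphere x y :=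
  Real.cos_arccos (neg_one_le_form_sphere x y) (form_sphere_le_one x y)

lemma sin_gdist_sphere_nonneg (x y : sphere.Surface) : 0 ≤ Real.sin (gdist sphere x y) :=
  Real.sin_nonneg_of_nonneg_of_le_pi (Real.arccos_nonneg _) (Real.arccos_le_pi _)

/-- A convex set on the sphere contains no antipodal points. -/
lemma IsConvex.ne_neg {Q : Set sphere.Surface} (hQ : sphere.IsConvex Q) {x y : sphere.Surface}
    (hx : x ∈ Q) (hy : y ∈ Q) : (y : Fin 3 → ℝ) ≠ -x := by
  intro h
  obtain ⟨⟨A, ⟨v, hv, h1, rfl⟩, huniq⟩, -⟩ := hQ x hx y hy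
  have hx1 : form sphere x x = 1 := x.2
  have hxv : form sphere x v = 0 := hv.1
  have hvv : form sphere v v = 1 := hv.2
  have hd : gdist sphere x y = Real.pi := by
    rw [gdist, h, form_neg_right, hx1, Real.arccos_neg_one]
  -- Starting in direction `-v` gives a second half great circle; the point `v` of the first one is
  -- not on it.
  have hseg : sphere.IsSegment x y {z | ∃ t ∈ Icc 0 (gdist sphere x y),
      geodesic sphere x (-v) t = (z : Fin 3 → ℝ)} :=
    ⟨-v, hv.neg, by simp [geodesic, hd, h], rfl⟩
  have heq := huniq _ hseg
  have hmem : (⟨v, hvv⟩ : sphere.Surface) ∈ {z : sphere.Surface | ∃ t ∈ Icc 0 (gdist sphere x y),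
      geodesic sphere x v t = (z : Fin 3 → ℝ)} :=
    ⟨Real.pi / 2, ⟨by positivity, by rw [hd]; linarith [Real.pi_pos]⟩, by simp [geodesic]⟩
  have hmem' : (⟨v, hvv⟩ : sphere.Surface) ∈ {z : sphere.Surface | ∃ t ∈ Icc 0 (gdist sphere x y),
      geodesic sphere x (-v) t = (z : Fin 3 → ℝ)} := by
    rw [heq]
    exact hmem
  obtain ⟨t, ht, hvt⟩ := hmem'
  have h2 := congrArg (form sphere v) hvt
  simp only [geodesic] at h2
  rw [form_add_right, form_smul_right, form_smul_right, form_neg_right, hvv, form_comm, hxv] at h2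
  have := Real.sin_nonneg_of_nonneg_of_le_pi ht.1 (hd ▸ ht.2)
  linarith

/-- The cone over a convex subset of the sphere is convex. -/
lemma IsConvex.mem_of_smul_eq {Q : Set sphere.Surface} (hQ : sphere.IsConvex Q)
    {x y z : sphere.Surface} (hx : x ∈ Q) (hy : y ∈ Q) {α β N : ℝ} (hα : 0 ≤ α) (hβ : 0 ≤ β)
    (hN : 0 < N) (hz : N • (z : Fin 3 → ℝ) = α • (x : Fin 3 → ℝ) + β • (y : Fin 3 → ℝ)) :
    z ∈ Q := by
  obtain ⟨⟨A, hA, -⟩, hsub⟩ := hQ x hx y hy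
  refine hsub A hA ?_
  obtain ⟨v, hv, h1, rfl⟩ := hA
  obtain ⟨d, hd⟩ : ∃ d, d = gdist sphere x y := ⟨_, rfl⟩
  have hc : Real.cos d = form sphere x y := by rw [hd, cos_gdist_sphere]
  have hs : 0 ≤ Real.sin d := hd ▸ sin_gdist_sphere_nonneg x y
  have hd0 : 0 ≤ d := hd ▸ Real.arccos_nonneg _
  have hdpi : d ≤ Real.pi := hd ▸ Real.arccos_le_pi _
  have hx1 : form sphere x x = 1 := x.2
  have hy1 : form sphere y y = 1 := y.2
  have hz1 : form sphere z z = 1 := z.2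
  rw [← hd] at h1 ⊢
  have hN2 : N ^ 2 = α ^ 2 + β ^ 2 + 2 * α * β * Real.cos d := by
    have h2 : form sphere (N • (z : Fin 3 → ℝ)) (N • (z : Fin 3 → ℝ)) =
        form sphere (α • (x : Fin 3 → ℝ) + β • (y : Fin 3 → ℝ))
          (α • (x : Fin 3 → ℝ) + β • (y : Fin 3 → ℝ)) := by rw [hz]
    rw [hc]
    simp only [form, Pi.add_apply, Pi.smul_apply, smul_eq_mul] at h2 hx1 hy1 hz1 ⊢
    linear_combination h2 - N ^ 2 * hz1 + α ^ 2 * hx1 + β ^ 2 * hy1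
  have hsc := Real.sin_sq_add_cos_sq d
  have hc1 := Real.cos_le_one d
  have hc2 := Real.neg_one_le_cos d
  have hNle : N ≤ α + β := by
    refine abs_le_of_sq_le_sq' ?_ (by positivity) |>.2
    nlinarith [mul_nonneg hα hβ]
  have hNge : β + α * Real.cos d ≤ N := by
    refine abs_le_of_sq_le_sq' ?_ hN.le |>.2
    nlinarith [mul_nonneg (sq_nonneg α) (sq_nonneg (Real.sin d))]
  -- So the cosine `q` of the distance from `x` to `z` is at least `cos d`: `z` does not come after
  -- `y`. The upper bound on `N` serves if `cos d ≥ 0`, the lower one if `cos d < 0`.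
  have hle : Real.cos d * N ≤ α + β * Real.cos d := by
    rcases le_or_gt 0 (Real.cos d) with h | h
    · nlinarith [mul_le_mul_of_nonneg_left hNle h]
    · nlinarith [mul_le_mul_of_nonpos_left hNge h.le, mul_nonneg hα (sq_nonneg (Real.sin d))]
  obtain ⟨q, hq⟩ : ∃ q, q = (α + β * Real.cos d) / N := ⟨_, rfl⟩
  have hqN : q * N = α + β * Real.cos d := by rw [hq]; field_simp
  have hcq : Real.cos d ≤ q := by rw [hq, le_div_iff₀ hN]; exact hle
  have hq2 : N ^ 2 * (1 - q ^ 2) = (β * Real.sin d) ^ 2 := by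
    linear_combination hN2 - (q * N + α + β * Real.cos d) * hqN - β ^ 2 * hsc
  have hq1 : q ^ 2 ≤ 1 := by
    by_contra! h
    nlinarith [mul_pos (pow_pos hN 2) (sub_pos.2 h), sq_nonneg (β * Real.sin d)]
  have hq1' := abs_le.1 ((sq_le_one_iff_abs_le_one q).1 hq1)
  have hsin : N * Real.sqrt (1 - q ^ 2) = β * Real.sin d := by
    rw [← Real.sqrt_sq (mul_nonneg hβ hs), ← hq2, Real.sqrt_mul (by positivity),
      Real.sqrt_sq hN.le]
  refine ⟨Real.arccos q, ⟨Real.arccos_nonneg _, ?_⟩, ?_⟩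
  · rw [← Real.arccos_cos hd0 hdpi]
    exact Real.arccos_le_arccos hcq
  · have h3 : N • geodesic sphere x v (Real.arccos q) = N • (z : Fin 3 → ℝ) := by
      rw [hz, ← h1]
      simp only [geodesic]
      rw [Real.cos_arccos hq1'.1 hq1'.2, Real.sin_arccos, smul_add, smul_smul, smul_smul, hsin,
        mul_comm N q, hqN]
      module
    exact smul_right_injective _ hN.ne' h3

/-- Normalization with respect to the Euclidean norm. -/
noncomputable def normalize (v : Fin 3 → ℝ) : Fin 3 → ℝ := (Real.sqrt (form sphere v v))⁻¹ • v

lemma normalize_mem {v : Fin 3 → ℝ} (hv : v ≠ 0) : sphere.Mem (normalize v) := by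
  have h := form_sphere_pos hv
  have h2 := Real.sq_sqrt h.le
  have h3 := Real.sqrt_pos.2 h
  rw [Mem, normalize, form_smul_left, form_smul_right]
  field_simp
  exact h2.symm

lemma sqrt_smul_normalize {v : Fin 3 → ℝ} (hv : v ≠ 0) :
    Real.sqrt (form sphere v v) • normalize v = v := by
  rw [normalize, smul_inv_smul₀ (Real.sqrt_pos.2 (form_sphere_pos hv)).ne']

lemma continuousAt_normalize {v : Fin 3 → ℝ} (hv : v ≠ 0) : ContinuousAt normalize v := by
  have hc : Continuous fun v : Fin 3 → ℝ => Real.sqrt (form sphere v v) := by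
    simp only [form]
    fun_prop
  exact (hc.continuousAt.inv₀ (Real.sqrt_pos.2 (form_sphere_pos hv)).ne').smul continuousAt_id

/-- Approximate `x` and `y` by points of `Q`; normalization is continuous where the combination is
nonzero. -/
lemma IsConvex.normalize_mem_closure {Q : Set sphere.Surface} (hQ : sphere.IsConvex Q)
    {x y : Fin 3 → ℝ} (hx : x ∈ closure ((fun z : sphere.Surface => (z : Fin 3 → ℝ)) '' Q))
    (hy : y ∈ closure ((fun z : sphere.Surface => (z : Fin 3 → ℝ)) '' Q)) {α β : ℝ} (hα : 0 ≤ α)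
    (hβ : 0 ≤ β) (hne : α • x + β • y ≠ 0) :
    normalize (α • x + β • y) ∈ closure ((fun z : sphere.Surface => (z : Fin 3 → ℝ)) '' Q) := by
  let w : (Fin 3 → ℝ) × (Fin 3 → ℝ) → (Fin 3 → ℝ) := fun q => α • q.1 + β • q.2
  have hw : Continuous w := by fun_prop
  have hU : IsOpen {q | w q ≠ 0} := isOpen_ne_fun hw continuous_const
  have hmem : (x, y) ∈ closure ({q | w q ≠ 0} ∩
      ((fun z : sphere.Surface => (z : Fin 3 → ℝ)) '' Q) ×ˢ
        ((fun z : sphere.Surface => (z : Fin 3 → ℝ)) '' Q)) := by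
    refine hU.inter_closure ⟨hne, ?_⟩
    rw [closure_prod_eq]
    exact ⟨hx, hy⟩
  have hcont : ContinuousAt (fun q => normalize (w q)) (x, y) :=
    ContinuousAt.comp (f := w) (g := normalize) (x := (x, y)) (continuousAt_normalize hne)
      hw.continuousAt
  refine hcont.continuousWithinAt.mem_closure hmem ?_
  rintro q ⟨hq0, ⟨p, hp, h1⟩, ⟨r, hr, h2⟩⟩
  refine ⟨⟨normalize (w q), normalize_mem hq0⟩, hQ.mem_of_smul_eq hp hr hα hβ
    (Real.sqrt_pos.2 (form_sphere_pos hq0)) ?_, rfl⟩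
  have h1' : (p : Fin 3 → ℝ) = q.1 := h1
  have h2' : (r : Fin 3 → ℝ) = q.2 := h2
  rw [h1', h2']
  exact sqrt_smul_normalize hq0

end SpaceForm

namespace SpaceForm

/-- The closed cone over a compact subset of the sphere. -/
def coneOver (K : Set (Fin 3 → ℝ)) : Set (Fin 3 → ℝ) :=
  {v | ∃ y ∈ K, v = Real.sqrt (form sphere v v) • y}

/-- The cone is the projection of a closed set along the compact factor `K`. -/
lemma isClosed_coneOver {K : Set (Fin 3 → ℝ)} (hK : IsCompact K) : IsClosed (coneOver K) := by
  have : CompactSpace K := isCompact_iff_compactSpace.1 hK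
  have h : IsClosed {q : (Fin 3 → ℝ) × K |
      q.1 = Real.sqrt (form sphere q.1 q.1) • (q.2 : Fin 3 → ℝ)} :=
    isClosed_eq continuous_fst (by simp only [form]; fun_prop)
  convert isClosedMap_fst_of_compactSpace _ h
  ext v
  constructor
  · rintro ⟨y, hy, hv⟩
    exact ⟨(v, ⟨y, hy⟩), hv, rfl⟩
  · rintro ⟨q, hq, rfl⟩
    exact ⟨q.2, q.2.2, hq⟩

lemma sqrt_form_smul_mem {z : Fin 3 → ℝ} (hz : sphere.Mem z) {t : ℝ} (ht : 0 ≤ t) :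
    Real.sqrt (form sphere (t • z) (t • z)) = t := by
  have hz1 : form sphere z z = 1 := hz
  rw [form_smul_left, form_smul_right, hz1, mul_one, Real.sqrt_mul_self ht]

/-- A compact subset of the sphere without antipodal points and with a convex cone lies in an open
half space. -/
lemma exists_form_pos {K : Set (Fin 3 → ℝ)} (hK : IsCompact K) (hne : K.Nonempty)
    (hmem : ∀ z ∈ K, sphere.Mem z) (hneg : ∀ z ∈ K, -z ∉ K)
    (hconv : ∀ x ∈ K, ∀ y ∈ K, ∀ α β : ℝ, 0 ≤ α → 0 ≤ β → α • x + β • y ≠ 0 →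
      normalize (α • x + β • y) ∈ K) :
    ∃ e : Fin 3 → ℝ, form sphere e e = 1 ∧ ∀ z ∈ K, 0 < form sphere e z := by
  have hclosed := isClosed_coneOver hK
  have hcv : Convex ℝ (coneOver K) := by
    rintro v ⟨x, hx, hv⟩ w ⟨y, hy, hw⟩ α β hα hβ -
    have h1 : α • v + β • w = (α * Real.sqrt (form sphere v v)) • x +
        (β * Real.sqrt (form sphere w w)) • y := by
      rw [mul_smul, mul_smul, ← hv, ← hw]
    by_cases h0 : α • v + β • w = 0
    · exact ⟨x, hx, by rw [h0]; simp [form]⟩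
    · refine ⟨_, ?_, (sqrt_smul_normalize h0).symm⟩
      rw [h1] at h0 ⊢
      exact hconv x hx y hy _ _ (mul_nonneg hα (Real.sqrt_nonneg _))
        (mul_nonneg hβ (Real.sqrt_nonneg _)) h0
  have hsmul : ∀ z ∈ K, ∀ t : ℝ, 0 ≤ t → t • z ∈ coneOver K := fun z hz t ht =>
    ⟨z, hz, by rw [sqrt_form_smul_mem (hmem z hz) ht]⟩
  -- Without antipodal points `-z` is outside the closed convex cone. A functional separating them
  -- is bounded above on the cone, hence nonpositive on it; its negative is as required.
  have hsep : ∀ z ∈ K, ∃ f : (Fin 3 → ℝ) →L[ℝ] ℝ, (∀ y ∈ K, 0 ≤ f y) ∧ 0 < f z := by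
    intro z hz
    have hnot : -z ∉ coneOver K := by
      rintro ⟨y, hy, h⟩
      have h1 : Real.sqrt (form sphere (-z) (-z)) = 1 := by
        have hz1 : form sphere z z = 1 := hmem z hz
        rw [form_neg_right, form_comm, form_neg_right, hz1]
        simp
      rw [h1, one_smul] at h
      exact hneg z hz (h ▸ hy)
    obtain ⟨f, u, hf, hu⟩ := geometric_hahn_banach_closed_point hcv hclosed hnot
    have hu0 : 0 < u := by simpa using hf _ (hsmul z hz 0 le_rfl)
    refine ⟨-f, fun y hy => ?_, ?_⟩
    · by_contra! h
      simp only [neg_apply, neg_lt_zero] at h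
      have := hf _ (hsmul y hy (u / f y) (by positivity))
      rw [map_smul, smul_eq_mul, div_mul_cancel₀ _ h.ne'] at this
      exact lt_irrefl _ this
    · rw [map_neg] at hu
      simp only [neg_apply]
      linarith
  choose! f hf0 hf using hsep
  -- Finitely many of the sets where `f z` is positive cover `K`, so the sum of these functionals is
  -- positive on all of `K`.
  obtain ⟨t, htK, hcov⟩ := hK.elim_nhds_subcover (fun z => {y | 0 < f z y}) fun z hz =>
    (isOpen_lt continuous_const (f z).continuous).mem_nhds (hf z hz)
  obtain ⟨g, hg⟩ : ∃ g : (Fin 3 → ℝ) →L[ℝ] ℝ, g = ∑ z ∈ t, f z := ⟨_, rfl⟩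
  have hgK : ∀ y ∈ K, 0 < g y := by
    intro y hy
    obtain ⟨z, hz, hzy⟩ := mem_iUnion₂.1 (hcov hy)
    rw [hg, sum_apply]
    exact Finset.sum_pos' (fun i hi => hf0 i (htK i hi) y hy) ⟨z, hz, hzy⟩
  obtain ⟨v, hv⟩ : ∃ v : Fin 3 → ℝ, ∀ y, form sphere v y = g y := by
    refine ⟨fun i => g (Pi.single i 1), fun y => ?_⟩
    have hy : y = y 0 • Pi.single 0 1 + y 1 • Pi.single 1 1 + y 2 • Pi.single 2 1 := by
      ext i
      fin_cases i <;> simp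
    conv_rhs => rw [hy]
    simp only [map_add, map_smul, smul_eq_mul, form]
    ring
  have hv0 : v ≠ 0 := by
    rintro rfl
    obtain ⟨y, hy⟩ := hne
    have := hgK y hy
    rw [← hv] at this
    simp [form] at this
  refine ⟨normalize v, normalize_mem hv0, fun z hz => ?_⟩
  rw [normalize, form_smul_left]
  exact mul_pos (inv_pos.2 (Real.sqrt_pos.2 (form_sphere_pos hv0))) ((hv z).symm ▸ hgK z hz)

/-- A reflection of the sphere that maps a given point to the pole. -/
lemma exists_isMotion_sphere {e : Fin 3 → ℝ} (he : form sphere e e = 1) :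
    ∃ R, sphere.IsMotion R ∧ (∀ x, R x 2 = form sphere e x) ∧ ∀ x, R (R x) = x := by
  have key : ∀ R : (Fin 3 → ℝ) →ₗ[ℝ] (Fin 3 → ℝ),
      (∀ x y, form sphere (R x) (R y) = form sphere x y) → sphere.IsMotion R := by
    refine fun R h => ⟨h, fun x hx => ?_, fun x y v hy hv => ?_⟩
    · rw [Mem, h]
      exact hx
    · rw [IsTangent, hy, h]
      exact hv
  simp only [form] at he
  by_cases h2 : e 2 = 1
  · have h0 : e 0 = 0 := by nlinarith
    have h1 : e 1 = 0 := by nlinarith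
    exact ⟨LinearMap.id, key _ fun _ _ => rfl, fun x => by simp [form, h0, h1, h2], fun _ => rfl⟩
  · obtain ⟨k, hk⟩ : ∃ k, k * (1 - e 2) = 1 :=
      ⟨(1 - e 2)⁻¹, inv_mul_cancel₀ (sub_ne_zero.2 fun h => h2 h.symm)⟩
    -- The Householder reflection exchanging `e` and the pole; the squared length of their
    -- difference is `2 * (1 - e 2) = 2 / k`.
    let R : (Fin 3 → ℝ) →ₗ[ℝ] (Fin 3 → ℝ) :=
      { toFun := fun x => x - (k * (form sphere e x - x 2)) • (e - ![0, 0, 1])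
        map_add' := fun x y => by
          rw [form_add_right, Pi.add_apply]
          module
        map_smul' := fun c x => by
          rw [form_smul_right, Pi.smul_apply, smul_eq_mul, RingHom.id_apply]
          module }
    have hR : ∀ x, R x = x - (k * (form sphere e x - x 2)) • (e - ![0, 0, 1]) := fun _ => rfl
    have hR2 : ∀ x, R x 2 = form sphere e x := by
      intro x
      simp only [hR, form, Pi.sub_apply, Pi.smul_apply, smul_eq_mul]
      simp
      linear_combination (e 0 * x 0 + e 1 * x 1 + e 2 * x 2 - x 2) * hk
    have hRe : ∀ x, form sphere e (R x) = x 2 := by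
      intro x
      simp only [hR, form, Pi.sub_apply, Pi.smul_apply, smul_eq_mul]
      simp
      linear_combination (-k * (e 0 * x 0 + e 1 * x 1 + e 2 * x 2 - x 2)) * he -
        (e 0 * x 0 + e 1 * x 1 + e 2 * x 2 - x 2) * hk
    refine ⟨R, key R fun x y => ?_, hR2, fun x => ?_⟩
    · simp only [hR, form, Pi.sub_apply, Pi.smul_apply, smul_eq_mul]
      simp
      linear_combination (k ^ 2 * (e 0 * x 0 + e 1 * x 1 + e 2 * x 2 - x 2) *
        (e 0 * y 0 + e 1 * y 1 + e 2 * y 2 - y 2)) * he +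
        2 * k * (e 0 * x 0 + e 1 * x 1 + e 2 * x 2 - x 2) *
        (e 0 * y 0 + e 1 * y 1 + e 2 * y 2 - y 2) * hk
    · rw [hR (R x), hRe, hR2, hR x]
      module

end SpaceForm

/-! ### Width and perimeter on the sphere. -/

namespace SpaceForm

lemma mem_of_neg (x : sphere.Surface) : sphere.Mem (-(x : Fin 3 → ℝ)) := by
  have hx : form sphere x x = 1 := x.2
  rw [Mem, form_neg_right, form_comm, form_neg_right, hx, neg_neg]

lemma abs_coord_le_one (y : sphere.Surface) (i : Fin 3) : |(y : Fin 3 → ℝ) i| ≤ 1 := by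
  refine (sq_le_one_iff_abs_le_one _).1 ?_
  have h := Finset.single_le_sum (f := fun j => (y : Fin 3 → ℝ) j * (y : Fin 3 → ℝ) j)
    (fun j _ => mul_self_nonneg _) (Finset.mem_univ i)
  rw [Fin.sum_univ_three] at h
  rw [sq]
  exact h.trans_eq y.2

/-- A convex set on the sphere whose closure contains antipodal points has perimeter at
least `2 * π`. -/
lemma IsConvex.two_pi_le_perimeter {Q : Set sphere.Surface} (hQ : sphere.IsConvex Q)
    {x y : sphere.Surface} (hx : x ∈ closure Q) (hy : y ∈ closure Q)
    (hxy : (y : Fin 3 → ℝ) = -x) : ENNReal.ofReal (2 * Real.pi) ≤ sphere.perimeter Q := by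
  -- If `x` were interior, some point of `Q` near `-x` would have its antipode in `Q`.
  have key : ∀ {x y : sphere.Surface}, x ∈ closure Q → y ∈ closure Q → (y : Fin 3 → ℝ) = -x →
      x ∈ frontier Q := by
    intro x y hx hy hxy
    refine ⟨hx, fun hxi => ?_⟩
    let ν : sphere.Surface → sphere.Surface := fun z => ⟨-z, mem_of_neg z⟩
    have hν : Continuous ν := by fun_prop
    have hyν : y ∈ ν ⁻¹' interior Q := by
      have : ν y = x := Subtype.ext (by simp [ν, hxy])
      rwa [mem_preimage, this]
    obtain ⟨z, hz, hzQ⟩ := mem_closure_iff.1 hy _ (isOpen_interior.preimage hν) hyν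
    exact hQ.ne_neg hzQ (interior_subset hz) rfl
  have hx1 : form sphere x x = 1 := x.2
  have hfxy : form sphere x y = -1 := by rw [hxy, form_neg_right, hx1]
  -- The digon with vertices `x` and `-x`, whose two sides have length `π`.
  refine le_iSup_of_le 1 (le_iSup_of_le ![x, y] (le_iSup_of_le ?_ (le_iSup_of_le ?_ ?_)))
  · intro i
    fin_cases i
    · exact key hx hy hxy
    · exact key hy hx (by simp [hxy])
  · intro i j k hij hjk
    omega
  · rw [Fin.sum_univ_two]
    refine ENNReal.ofReal_le_ofReal (le_of_eq ?_)
    simp only [gdist]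
    simp [form_comm sphere y, hfxy]
    ring

lemma radial_add (θ : ℝ) (v w : Fin 3 → ℝ) : radial θ (v + w) = radial θ v + radial θ w := by
  simp only [radial, Pi.add_apply]
  ring

lemma radial_smul (θ k : ℝ) (v : Fin 3 → ℝ) : radial θ (k • v) = k * radial θ v := by
  simp only [radial, Pi.smul_apply, smul_eq_mul]
  ring

/-- The reflection taking `e` to the pole moves the closure of `Q` into the chart. From each point a
great circle leads in direction `θ` to the boundary of the hemisphere, which lies outside `Q`. -/
lemma exists_isMotion_width_le_of_form_pos {Q : Set sphere.Surface} {e : Fin 3 → ℝ}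
    (he : form sphere e e = 1) (hpos : ∀ y ∈ closure Q, 0 < form sphere e y)
    {A : Set (Fin 3 → ℝ)} (hA : IsCompact A) (hne : A.Nonempty)
    (hAQ : A ⊆ (fun z : sphere.Surface => (z : Fin 3 → ℝ)) '' Q) :
    ∃ R, sphere.IsMotion R ∧ sphere.IsChartCompact (R '' A) ∧
      ENNReal.ofReal (sphere.width (R '' A)) ≤ sphere.perimeter Q := by
  obtain ⟨R, hR, hR2, hRR⟩ := exists_isMotion_sphere he
  have hRc : Continuous R := R.continuous_of_finiteDimensional
  have hRA : sphere.IsChartCompact (R '' A) := by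
    refine ⟨hA.image hRc, hne.image _, ?_, ?_⟩
    · rintro _ ⟨v, hv, rfl⟩
      obtain ⟨x, hx, rfl⟩ := hAQ hv
      exact hR.mem_map _ x.2
    · rintro _ ⟨v, hv, rfl⟩
      obtain ⟨x, hx, rfl⟩ := hAQ hv
      rw [hR2]
      exact hpos x (subset_closure hx)
  refine ⟨R, hR, hRA, width_le_perimeter_of_path hR ?_ ?_ hRA ?_⟩
  · refine (isCompact_closure_of_abs_le (r := 1) fun y _ i =>
      abs_coord_le_one y i).of_isClosed_subset isClosed_frontier frontier_subset_closure
  · intro y hy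
    rw [hR2]
    exact hpos y (frontier_subset_closure hy)
  · rintro _ ⟨v, hv, rfl⟩ θ
    have hz2 := hRA.pos _ (mem_image_of_mem _ hv)
    obtain ⟨x, hx, rfl⟩ := hAQ hv
    -- The point at infinity of the chart in direction `θ`, pulled back by the involution `R`.
    obtain ⟨n, hn⟩ : ∃ n, R n = ![Real.cos θ, Real.sin θ, 0] := ⟨_, hRR _⟩
    have hn2 : R n 2 = 0 := by rw [hn]; simp
    have hnr : radial θ (R n) = 1 := by
      rw [hn]
      have := Real.sin_sq_add_cos_sq θ
      simp [radial]
      linarith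
    let w : ℝ → Fin 3 → ℝ := fun t => (1 - t) • (x : Fin 3 → ℝ) + t • n
    have hw : Continuous w := by fun_prop
    have hRw : ∀ t, R (w t) = (1 - t) • R x + t • R n := fun t => by
      simp only [w, map_add, map_smul]
    have hw0 : ∀ t ∈ Icc (0 : ℝ) 1, w t ≠ 0 := by
      intro t ht h0
      have h1 := hRw t
      rw [h0, map_zero] at h1
      have h2 := congrFun h1 2
      simp only [Pi.zero_apply, Pi.add_apply, Pi.smul_apply, smul_eq_mul, hn2, mul_zero,
        add_zero] at h2
      have ht1 : t = 1 := by
        rcases mul_eq_zero.1 h2.symm with h | h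
        · linarith
        · exact absurd h hz2.ne'
      have h3 := congrArg (radial θ) h1
      rw [ht1, radial_add, radial_smul, radial_smul, hnr] at h3
      simp [radial] at h3
    classical
    let c : ℝ → sphere.Surface := fun t =>
      if h : w t = 0 then x else ⟨normalize (w t), normalize_mem h⟩
    have hc : ∀ t ∈ Icc (0 : ℝ) 1, (c t : Fin 3 → ℝ) = normalize (w t) := fun t ht => by
      simp only [c, dif_neg (hw0 t ht)]
    have hx1 : form sphere x x = 1 := x.2
    refine ⟨c, ?_, ?_, ?_, ?_⟩
    · refine (isClosedEmbedding_coe sphere).isInducing.continuousOn_iff.2 ?_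
      refine ContinuousOn.congr (f := fun t => normalize (w t)) ?_ hc
      intro t ht
      exact (ContinuousAt.comp (f := w) (g := normalize) (x := t)
        (continuousAt_normalize (hw0 t ht)) hw.continuousAt).continuousWithinAt
    · convert hx
      refine Subtype.ext ?_
      rw [hc 0 (by simp)]
      simp [w, normalize, hx1]
    · intro h1
      have h2 := hpos _ (subset_closure h1)
      rw [← hR2, hc 1 (by simp)] at h2
      simp [w, normalize, hn2] at h2
    · intro t ht
      rw [hc t ht, normalize, map_smul, radial_smul, Pi.smul_apply, smul_eq_mul, hRw, radial_add,
        radial_smul, radial_smul, hnr]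
      simp only [Pi.add_apply, Pi.smul_apply, smul_eq_mul, hn2]
      have h1 : 0 ≤ (Real.sqrt (form sphere (w t) (w t)))⁻¹ := by positivity
      nlinarith [mul_nonneg h1 (mul_nonneg ht.1 hz2.le)]

/-- A compact subset of a convex set `Q` can be moved to the chart so that its width is at
most the perimeter of `Q`. -/
lemma IsConvex.exists_isMotion_width_le_perimeter {M : SpaceForm} {Q : Set M.Surface}
    (hQ : M.IsConvex Q) (hdiam : M.diam Q < ⊤) {A : Set (Fin 3 → ℝ)} (hA : IsCompact A)
    (hne : A.Nonempty) (hAQ : A ⊆ (fun z : M.Surface => (z : Fin 3 → ℝ)) '' Q)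
    (hpos : M = sphere → ∃ e, form sphere e e = 1 ∧ ∀ z ∈ A, 0 < form sphere e z) :
    ∃ R, M.IsMotion R ∧ M.IsChartCompact (R '' A) ∧
      ENNReal.ofReal (M.width (R '' A)) ≤ M.perimeter Q := by
  by_cases hM : M = sphere
  · subst hM
    -- With antipodal points in the closure no chart contains it; then `2π` lies between width and
    -- perimeter, and the chart only has to contain `A`.
    by_cases hanti : ∃ x ∈ closure Q, ∃ y ∈ closure Q, (y : Fin 3 → ℝ) = -x
    · obtain ⟨x, hx, y, hy, hxy⟩ := hanti
      obtain ⟨e, he, heA⟩ := hpos rfl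
      obtain ⟨R, hR, hR2, -⟩ := exists_isMotion_sphere he
      have hRA : sphere.IsChartCompact (R '' A) := by
        refine ⟨hA.image R.continuous_of_finiteDimensional, hne.image _, ?_, ?_⟩
        · rintro _ ⟨v, hv, rfl⟩
          obtain ⟨x, hx, rfl⟩ := hAQ hv
          exact hR.mem_map _ x.2
        · rintro _ ⟨v, hv, rfl⟩
          rw [hR2]
          exact heA v hv
      exact ⟨R, hR, hRA, (ENNReal.ofReal_le_ofReal hRA.width_sphere_le).trans
        (hQ.two_pi_le_perimeter hx hy hxy)⟩
    · push Not at hanti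
      obtain ⟨K, hK⟩ : ∃ K, K = closure ((fun z : sphere.Surface => (z : Fin 3 → ℝ)) '' Q) :=
        ⟨_, rfl⟩
      have hK' : K = (fun z : sphere.Surface => (z : Fin 3 → ℝ)) '' closure Q := by
        rw [hK]
        exact (isClosedEmbedding_coe sphere).closure_image_eq Q
      suffices h : ∃ e, form sphere e e = 1 ∧ ∀ z ∈ K, 0 < form sphere e z by
        obtain ⟨e, he, heK⟩ := h
        refine exists_isMotion_width_le_of_form_pos he (fun y hy => heK y ?_) hA hne hAQ
        rw [hK']
        exact mem_image_of_mem _ hy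
      refine exists_form_pos ?_ ?_ ?_ ?_ ?_
      · rw [hK']
        exact IsCompact.image (isCompact_closure_of_abs_le (r := 1) fun y _ i =>
          abs_coord_le_one y i) continuous_subtype_val
      · obtain ⟨v, hv⟩ := hne
        exact ⟨v, hK ▸ subset_closure (hAQ hv)⟩
      · rw [hK']
        rintro _ ⟨x, -, rfl⟩
        exact x.2
      · rw [hK']
        rintro _ ⟨x, hx, rfl⟩ ⟨y, hy, hxy⟩
        exact hanti x hx y hy hxy
      · rw [hK]
        intro x hx y hy α β hα hβ h0
        exact hQ.normalize_mem_closure hx hy hα hβ h0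
  · refine ⟨LinearMap.id, isMotion_id M, ?_⟩
    rw [show (LinearMap.id : (Fin 3 → ℝ) →ₗ[ℝ] (Fin 3 → ℝ)) '' A = A from image_id A]
    have hA' : M.IsChartCompact A := by
      refine ⟨hA, hne, fun v hv => ?_, fun v hv => ?_⟩
      · obtain ⟨x, -, rfl⟩ := hAQ hv
        exact x.2
      · obtain ⟨x, -, rfl⟩ := hAQ hv
        have := x.2
        cases M
        · exact absurd rfl hM
        · exact one_pos.trans_eq (show (x : Fin 3 → ℝ) 2 = 1 from this).symm
        · exact this.2
    exact ⟨hA', width_le_perimeter_of_ne_sphere hM hdiam hA' hAQ⟩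

end SpaceForm

/-! ### Segments in linear coordinates and a criterion for convexity. -/

namespace SpaceForm

variable {M : SpaceForm}

/-- The cosine of the geometry. -/
noncomputable def cosT : SpaceForm → ℝ → ℝ
  | sphere => Real.cos
  | plane => fun _ => 1
  | lobachevskij => Real.cosh

/-- The sine of the geometry. -/
noncomputable def sinT : SpaceForm → ℝ → ℝ
  | sphere => Real.sin
  | plane => fun t => t
  | lobachevskij => Real.sinh

lemma geodesic_eq (x : M.Surface) (v : Fin 3 → ℝ) (t : ℝ) :
    M.geodesic x v t = M.cosT t • (x : Fin 3 → ℝ) + M.sinT t • v := by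
  cases M <;> simp [geodesic, cosT, sinT]

lemma cosT_zero (M : SpaceForm) : M.cosT 0 = 1 := by cases M <;> simp [cosT]

lemma sinT_zero (M : SpaceForm) : M.sinT 0 = 0 := by cases M <;> simp [sinT]

lemma sinT_sub (M : SpaceForm) (d t : ℝ) :
    M.sinT (d - t) = M.sinT d * M.cosT t - M.cosT d * M.sinT t := by
  cases M
  · exact Real.sin_sub d t
  · simp [sinT, cosT]
  · exact Real.sinh_sub d t

lemma zero_le_gdist (x y : M.Surface) : 0 ≤ M.gdist x y := by
  cases M
  · exact Real.arccos_nonneg _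
  · exact Real.sqrt_nonneg _
  · exact Real.arcosh_nonneg (neg_form_ge_one x y)

lemma cosT_gdist (x y : M.Surface) : M.cosT (M.gdist x y) = M.cosDist x y := by
  cases M
  · exact cos_gdist_sphere x y
  · rfl
  · exact Real.cosh_arcosh (neg_form_ge_one x y)

lemma form_tangentPart_self (x y : M.Surface) :
    M.form (M.tangentPart x y) (M.tangentPart x y) = M.sinT (M.gdist x y) ^ 2 := by
  have hx := x.2
  have hy := y.2
  have hc := cosT_gdist x y
  cases M
  · simp only [sinT, cosT, cosDist] at hc ⊢
    rw [Real.sin_sq, hc]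
    simp only [tangentPart, cosDist, form, Pi.sub_apply, Pi.smul_apply, smul_eq_mul, Mem] at *
    linear_combination (x.1 0 * y.1 0 + x.1 1 * y.1 1 + x.1 2 * y.1 2) ^ 2 * hx + hy
  · simp only [sinT, gdist]
    have h0 : 0 ≤ form plane ((x : Fin 3 → ℝ) - y) ((x : Fin 3 → ℝ) - y) :=
      add_nonneg (mul_self_nonneg _) (mul_self_nonneg _)
    rw [Real.sq_sqrt h0]
    simp only [tangentPart, cosDist, form, Pi.sub_apply, Pi.smul_apply, smul_eq_mul]
    ring
  · simp only [sinT, cosT, cosDist] at hc ⊢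
    rw [Real.sinh_sq, hc]
    simp only [tangentPart, cosDist, form, Pi.sub_apply, Pi.smul_apply, smul_eq_mul, Mem] at *
    linear_combination (x.1 0 * y.1 0 + x.1 1 * y.1 1 - x.1 2 * y.1 2) ^ 2 * hx.1 + hy.1

lemma sinT_nonneg {x y : M.Surface} {t : ℝ} (ht : t ∈ Icc 0 (M.gdist x y)) : 0 ≤ M.sinT t := by
  cases M
  · exact Real.sin_nonneg_of_nonneg_of_le_pi ht.1 (ht.2.trans (Real.arccos_le_pi _))
  · exact ht.1
  · exact Real.sinh_nonneg_iff.2 ht.1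

/-- The norm of `tangentPart` is `sinT` of the distance up to sign, so `y` is a multiple of `x`; on
the sphere the distance `π` is excluded by `hanti`. -/
lemma eq_of_sinT_gdist_eq_zero {x y : M.Surface}
    (hanti : M = sphere → (y : Fin 3 → ℝ) ≠ -x) (h : M.sinT (M.gdist x y) = 0) :
    M.gdist x y = 0 ∧ y = x := by
  have htp : M.tangentPart x y = 0 := by
    by_contra hne
    have := form_self_pos x (isTangent_tangentPart x y) hne
    rw [form_tangentPart_self, h] at this
    simp at this
  have hy := eq_add_tangentPart M x y
  rw [htp, add_zero, ← cosT_gdist] at hy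
  have hd : M.gdist x y = 0 := by
    cases M
    · by_contra h0
      rcases (Real.arccos_le_pi (form sphere x y)).lt_or_eq with h1 | h1
      · exact (Real.sin_pos_of_pos_of_lt_pi
          (lt_of_le_of_ne (zero_le_gdist x y) (Ne.symm h0)) h1).ne' h
      · refine hanti rfl ?_
        rw [show gdist sphere x y = Real.pi from h1] at hy
        simpa [cosT] using hy
    · exact h
    · exact Real.sinh_eq_zero.1 h
  rw [hd, cosT_zero, one_smul] at hy
  exact ⟨hd, Subtype.ext hy⟩

lemma exists_isUnitTangent (x : M.Surface) : ∃ v, M.IsUnitTangent x v := by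
  suffices ∃ v, M.IsTangent x v ∧ v ≠ 0 by
    obtain ⟨v, hv, h0⟩ := this
    have h := form_self_pos x hv h0
    have h2 := Real.sq_sqrt h.le
    have h3 := Real.sqrt_pos.2 h
    refine ⟨(Real.sqrt (M.form v v))⁻¹ • v, hv.smul _, ?_⟩
    rw [form_smul_left, form_smul_right]
    field_simp
    exact h2.symm
  have hx := x.2
  cases M
  · by_cases h : (x : Fin 3 → ℝ) 0 = 0 ∧ (x : Fin 3 → ℝ) 1 = 0
    · refine ⟨![1, 0, 0], ?_, fun h0 => ?_⟩
      · simp [IsTangent, form, h.1]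
      · simpa using congrFun h0 0
    · refine ⟨![-(x : Fin 3 → ℝ) 1, (x : Fin 3 → ℝ) 0, 0], ?_, fun h0 => h ⟨?_, ?_⟩⟩
      · simp [IsTangent, form]
        ring
      · simpa using congrFun h0 1
      · simpa using congrFun h0 0
  · refine ⟨![1, 0, 0], ?_, fun h0 => ?_⟩
    · simp [IsTangent]
    · simpa using congrFun h0 0
  · refine ⟨![(x : Fin 3 → ℝ) 2, 0, (x : Fin 3 → ℝ) 0], ?_, fun h0 => ?_⟩
    · simp [IsTangent, form]
      ring
    · exact hx.2.ne' (by simpa using congrFun h0 0)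

lemma exists_isSegment {x y : M.Surface} (hanti : M = sphere → (y : Fin 3 → ℝ) ≠ -x) :
    ∃ A, M.IsSegment x y A := by
  by_cases h : M.sinT (M.gdist x y) = 0
  · obtain ⟨hd, rfl⟩ := eq_of_sinT_gdist_eq_zero hanti h
    obtain ⟨v, hv⟩ := exists_isUnitTangent y
    refine ⟨_, v, hv, ?_, rfl⟩
    rw [hd, geodesic_eq, cosT_zero, sinT_zero, one_smul, zero_smul, add_zero]
  · refine ⟨_, (M.sinT (M.gdist x y))⁻¹ • M.tangentPart x y,
      ⟨(isTangent_tangentPart x y).smul _, ?_⟩, ?_, rfl⟩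
    · rw [form_smul_left, form_smul_right, form_tangentPart_self]
      field_simp
    · rw [geodesic_eq, smul_inv_smul₀ h, cosT_gdist]
      exact (eq_add_tangentPart M x y).symm

lemma IsSegment.unique {x y : M.Surface} {A B : Set M.Surface}
    (hanti : M = sphere → (y : Fin 3 → ℝ) ≠ -x) (hA : M.IsSegment x y A)
    (hB : M.IsSegment x y B) : A = B := by
  obtain ⟨v, -, hv, rfl⟩ := hA
  obtain ⟨w, -, hw, rfl⟩ := hB
  simp only [geodesic_eq] at hv hw ⊢
  by_cases h : M.sinT (M.gdist x y) = 0
  · obtain ⟨hd, -⟩ := eq_of_sinT_gdist_eq_zero hanti h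
    ext z
    constructor <;> rintro ⟨t, ht, hz⟩ <;> refine ⟨t, ht, ?_⟩ <;> rw [← hz] <;>
      rw [hd, Icc_self, mem_singleton_iff] at ht <;> simp [ht, sinT_zero]
  · have : v = w := smul_right_injective _ h (add_left_cancel (hv.trans hw.symm))
    rw [this]

/-- With `d` the distance and `t` the parameter of `z`, the coefficients are `sinT (d - t) / sinT d`
and `sinT t / sinT d`. -/
lemma IsSegment.exists_eq_add {x y z : M.Surface} {A : Set M.Surface}
    (hanti : M = sphere → (y : Fin 3 → ℝ) ≠ -x) (hA : M.IsSegment x y A) (hz : z ∈ A) :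
    ∃ α β : ℝ, 0 ≤ α ∧ 0 ≤ β ∧ (z : Fin 3 → ℝ) = α • (x : Fin 3 → ℝ) + β • (y : Fin 3 → ℝ) := by
  obtain ⟨v, -, hv, rfl⟩ := hA
  obtain ⟨t, ht, hz⟩ := hz
  have hd0 := zero_le_gdist x y
  rw [geodesic_eq] at hv hz
  by_cases h : M.sinT (M.gdist x y) = 0
  · obtain ⟨hd, -⟩ := eq_of_sinT_gdist_eq_zero hanti h
    rw [hd, Icc_self, mem_singleton_iff] at ht
    refine ⟨1, 0, zero_le_one, le_rfl, ?_⟩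
    rw [← hz, ht, sinT_zero, cosT_zero]
    simp
  · have hs : 0 < M.sinT (M.gdist x y) :=
      lt_of_le_of_ne (sinT_nonneg (right_mem_Icc.2 hd0)) (Ne.symm h)
    have ht' : M.gdist x y - t ∈ Icc 0 (M.gdist x y) := ⟨by linarith [ht.2], by linarith [ht.1]⟩
    refine ⟨M.sinT (M.gdist x y - t) / M.sinT (M.gdist x y), M.sinT t / M.sinT (M.gdist x y),
      div_nonneg (sinT_nonneg ht') hs.le, div_nonneg (sinT_nonneg ht) hs.le, ?_⟩
    rw [← hz]
    ext i
    have hvi := congrFun hv i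
    simp only [Pi.add_apply, Pi.smul_apply, smul_eq_mul] at hvi ⊢
    rw [sinT_sub, ← hvi]
    field_simp
    ring

/-- A set is convex if it contains all points of the surface in the cones over pairs of its
points. -/
lemma isConvex_of_forall_eq_add {Q : Set M.Surface}
    (hanti : M = sphere → ∀ x ∈ Q, ∀ y ∈ Q, (y : Fin 3 → ℝ) ≠ -x)
    (h : ∀ x ∈ Q, ∀ y ∈ Q, ∀ (z : M.Surface) (α β : ℝ), 0 ≤ α → 0 ≤ β →
      (z : Fin 3 → ℝ) = α • (x : Fin 3 → ℝ) + β • (y : Fin 3 → ℝ) → z ∈ Q) : M.IsConvex Q := by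
  intro x hx y hy
  have hxy : M = sphere → (y : Fin 3 → ℝ) ≠ -x := fun hM => hanti hM x hx y hy
  obtain ⟨A, hA⟩ := exists_isSegment hxy
  refine ⟨⟨A, hA, fun B hB => hB.unique hxy hA⟩, fun B hB z hz => ?_⟩
  obtain ⟨α, β, hα, hβ, hz⟩ := hB.exists_eq_add hxy hz
  exact h x hx y hy z α β hα hβ hz

end SpaceForm

/-! ### Bounded convex supersets and the convex hull. -/

namespace SpaceForm

variable {M : SpaceForm}

/-- On the hyperboloid `-⟨x, y⟩ ≥ 1` makes `(α + β) ^ 2` at most `-⟨z, z⟩ = 1`. Hence coordinate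
boxes are convex. -/
lemma add_le_one_of_eq_add (hM : M ≠ sphere) {x y z : M.Surface} {α β : ℝ} (hα : 0 ≤ α)
    (hβ : 0 ≤ β) (hz : (z : Fin 3 → ℝ) = α • (x : Fin 3 → ℝ) + β • (y : Fin 3 → ℝ)) :
    α + β ≤ 1 := by
  have hx := x.2
  have hy := y.2
  have hz' := z.2
  cases M
  · exact absurd rfl hM
  · simp only [Mem, hz, Pi.add_apply, Pi.smul_apply, smul_eq_mul] at hx hy hz'
    rw [hx, hy] at hz'
    linarith
  · have h := neg_form_ge_one x y
    refine abs_le_of_sq_le_sq' ?_ zero_le_one |>.2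
    simp only [Mem, hz, form, Pi.add_apply, Pi.smul_apply, smul_eq_mul] at hx hy hz' h
    have h1 : α ^ 2 + β ^ 2 + 2 * (α * β * -(x.1 0 * y.1 0 + x.1 1 * y.1 1 - x.1 2 * y.1 2)) =
        1 := by
      linear_combination -hz'.1 + α ^ 2 * hx.1 + β ^ 2 * hy.1
    linarith [mul_le_mul_of_nonneg_left h (mul_nonneg hα hβ)]

lemma isConvex_setOf_abs_le (hM : M ≠ sphere) (r : ℝ) :
    M.IsConvex {x | ∀ i, |(x : Fin 3 → ℝ) i| ≤ r} := by
  refine isConvex_of_forall_eq_add (fun h => absurd h hM) fun x hx y hy z α β hα hβ hz i => ?_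
  have h1 := add_le_one_of_eq_add hM hα hβ hz
  have hr : 0 ≤ r := (abs_nonneg _).trans (hx i)
  rw [hz, Pi.add_apply, Pi.smul_apply, Pi.smul_apply, smul_eq_mul, smul_eq_mul]
  refine (abs_add_le _ _).trans ?_
  rw [abs_mul, abs_mul, abs_of_nonneg hα, abs_of_nonneg hβ]
  nlinarith [mul_le_mul_of_nonneg_left (hx i) hα, mul_le_mul_of_nonneg_left (hy i) hβ]

lemma isConvex_setOf_form_pos (e : Fin 3 → ℝ) :
    sphere.IsConvex {x | 0 < form sphere e x} := by
  refine isConvex_of_forall_eq_add (fun _ x hx y hy h => ?_) fun x hx y hy z α β hα hβ hz => ?_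
  · have hx' : 0 < form sphere e x := hx
    have hy' : 0 < form sphere e y := hy
    rw [h, form_neg_right] at hy'
    linarith
  · have hx' : 0 < form sphere e x := hx
    have hy' : 0 < form sphere e y := hy
    change 0 < form sphere e z
    rw [hz, form_add_right, form_smul_right, form_smul_right]
    rcases hα.lt_or_eq with h | h
    · exact add_pos_of_pos_of_nonneg (mul_pos h hx') (mul_nonneg hβ hy'.le)
    · rcases hβ.lt_or_eq with h' | h'
      · exact add_pos_of_nonneg_of_pos (mul_nonneg hα hx'.le) (mul_pos h' hy')
      · have hz1 : form sphere z z = 1 := z.2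
        rw [← h, ← h', zero_smul, zero_smul, add_zero] at hz
        rw [hz] at hz1
        simp [form] at hz1

lemma diam_lt_top_of_gdist_le {Q : Set M.Surface} {C : ℝ}
    (h : ∀ x ∈ Q, ∀ y ∈ Q, M.gdist x y ≤ C) : M.diam Q < ⊤ := by
  refine lt_of_le_of_lt ?_ (ENNReal.ofReal_lt_top (r := C))
  exact iSup_le fun x => iSup_le fun hx => iSup_le fun y => iSup_le fun hy =>
    ENNReal.ofReal_le_ofReal (h x hx y hy)

lemma diam_setOf_abs_le_lt_top (hM : M ≠ sphere) (r : ℝ) :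
    M.diam {x : M.Surface | ∀ i, |(x : Fin 3 → ℝ) i| ≤ r} < ⊤ := by
  cases M
  · exact absurd rfl hM
  · refine diam_lt_top_of_gdist_le (C := Real.sqrt (8 * r ^ 2)) fun x hx y hy => ?_
    refine Real.sqrt_le_sqrt ?_
    have h0 := abs_le.1 (hx 0)
    have h1 := abs_le.1 (hx 1)
    have k0 := abs_le.1 (hy 0)
    have k1 := abs_le.1 (hy 1)
    have a : ((x : Fin 3 → ℝ) 0 - (y : Fin 3 → ℝ) 0) ^ 2 ≤ (2 * r) ^ 2 :=
      sq_le_sq' (by linarith) (by linarith)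
    have b : ((x : Fin 3 → ℝ) 1 - (y : Fin 3 → ℝ) 1) ^ 2 ≤ (2 * r) ^ 2 :=
      sq_le_sq' (by linarith) (by linarith)
    simp only [form, Pi.sub_apply]
    nlinarith
  · refine diam_lt_top_of_gdist_le (C := Real.arcosh (3 * r ^ 2)) fun x hx y hy => ?_
    have h := neg_form_ge_one x y
    have key : ∀ i, |(x : Fin 3 → ℝ) i * (y : Fin 3 → ℝ) i| ≤ r ^ 2 := fun i => by
      rw [abs_mul, sq]
      exact mul_le_mul (hx i) (hy i) (abs_nonneg _) ((abs_nonneg _).trans (hx i))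
    have h0 := abs_le.1 (key 0)
    have h1 := abs_le.1 (key 1)
    have h2 := abs_le.1 (key 2)
    have hle : -form lobachevskij x y ≤ 3 * r ^ 2 := by
      simp only [form]
      linarith
    exact (Real.arcosh_le_arcosh (by linarith) (by linarith)).2 hle

lemma gdist_sphere_le_pi (x y : sphere.Surface) : gdist sphere x y ≤ Real.pi :=
  Real.arccos_le_pi _

/-- A compact set, on the sphere contained in an open half sphere, lies in a bounded convex set. -/
lemma exists_isConvex_superset {A : Set (Fin 3 → ℝ)} (hA : IsCompact A) {B : Set M.Surface}
    (hB : ∀ x ∈ B, (x : Fin 3 → ℝ) ∈ A)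
    (hpos : M = sphere → ∃ e, form sphere e e = 1 ∧ ∀ z ∈ A, 0 < form sphere e z) :
    ∃ Q, M.IsConvex Q ∧ M.diam Q < ⊤ ∧ B ⊆ Q := by
  by_cases hM : M = sphere
  · subst hM
    obtain ⟨e, -, he⟩ := hpos rfl
    exact ⟨_, isConvex_setOf_form_pos e,
      diam_lt_top_of_gdist_le fun x _ y _ => gdist_sphere_le_pi x y, fun x hx => he x (hB x hx)⟩
  · obtain ⟨r, hr⟩ := hA.isBounded.exists_norm_le
    exact ⟨_, isConvex_setOf_abs_le hM r, diam_setOf_abs_le_lt_top hM r,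
      fun x hx i => (norm_le_pi_norm _ i).trans (hr x (hB x hx))⟩

lemma subset_hull (A : Set M.Surface) : A ⊆ M.hull A := fun _ hx _ hQ => hQ.2 hx

/-- Existence and uniqueness of segments are inherited from `Q`. Without any convex superset the
hull would be the whole surface. -/
lemma isConvex_hull {A Q : Set M.Surface} (hQ : M.IsConvex Q) (hA : A ⊆ Q) :
    M.IsConvex (M.hull A) := fun x hx y hy =>
  ⟨(hQ x (hx Q ⟨hQ, hA⟩) y (hy Q ⟨hQ, hA⟩)).1, fun B hB _ hz Q' hQ' =>
    (hQ'.1 x (hx Q' hQ') y (hy Q' hQ')).2 B hB hz⟩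

lemma diam_hull_le {A Q : Set M.Surface} (hQ : M.IsConvex Q) (hA : A ⊆ Q) :
    M.diam (M.hull A) ≤ M.diam Q :=
  iSup_le fun x => iSup_le fun hx => iSup_le fun y => iSup_le fun hy =>
    le_iSup_of_le x (le_iSup_of_le (hx Q ⟨hQ, hA⟩)
      (le_iSup_of_le y (le_iSup_of_le (hy Q ⟨hQ, hA⟩) le_rfl)))

lemma form_pos_of_diam_lt {B : Set sphere.Surface}
    (h : sphere.diam B < ENNReal.ofReal (Real.pi / 2)) {x y : sphere.Surface} (hx : x ∈ B)
    (hy : y ∈ B) : 0 < form sphere x y := by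
  have h1 : ENNReal.ofReal (gdist sphere x y) ≤ sphere.diam B :=
    le_iSup_of_le x (le_iSup_of_le hx (le_iSup_of_le y (le_iSup_of_le hy le_rfl)))
  exact Real.arccos_lt_pi_div_two.1
    ((ENNReal.ofReal_lt_ofReal_iff (by positivity)).1 (h1.trans_lt h))

end SpaceForm

/-! ### The theorem. -/

theorem theorem3p1 (M : SpaceForm) (a b : ℝ) (hab : a ≤ b) (γ : ℝ → M.Surface)
    (hγ : M.IsGCurve γ a b)
    (hdiam : M = SpaceForm.sphere → M.diam (γ '' Icc a b) < ENNReal.ofReal (Real.pi / 2)) :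
    M.length γ a b ≤ M.perimeter (M.hull (γ '' Icc a b)) ∧
    (M.length γ a b = M.perimeter (M.hull (γ '' Icc a b)) →
      ∀ᵐ s : ℝ, s ∈ Icc a b → ∀ u, u ≠ 0 → M.HasVelocity γ a b s u →
        ∃ v₁ v₂, M.IsProjectingSector γ a s v₁ v₂ ∧ M.angle v₁ v₂ = Real.pi / 2 ∧
          ((∃ r : ℝ, u = r • v₁) ∨ (∃ r : ℝ, u = r • v₂))) ∧
    (∀ Q : Set M.Surface, M.IsConvex Q → M.diam Q < ⊤ → γ '' Icc a b ⊆ Q →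
      M.length γ a b ≤ M.perimeter Q) := by
  have hc : ContinuousOn (fun t => (γ t : Fin 3 → ℝ)) (Icc a b) := by
    have := hγ.absolutelyContinuous.continuousOn
    rwa [uIcc_of_le hab] at this
  have hpos : M = SpaceForm.sphere → ∀ r ∈ Icc a b, ∀ t ∈ Icc a b, 0 < M.form (γ r) (γ t) := by
    rintro rfl r hr t ht
    exact SpaceForm.form_pos_of_diam_lt (hdiam rfl) (mem_image_of_mem _ hr)
      (mem_image_of_mem _ ht)
  have hA : IsCompact (SpaceForm.past γ a b) := isCompact_Icc.image_of_continuousOn hc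
  have hne : (SpaceForm.past γ a b).Nonempty := (nonempty_Icc.2 hab).image _
  have he : M = SpaceForm.sphere → ∃ e, SpaceForm.form .sphere e e = 1 ∧
      ∀ z ∈ SpaceForm.past γ a b, 0 < SpaceForm.form .sphere e z := by
    rintro rfl
    -- All points of the curve are closer than `π / 2` to its starting point.
    refine ⟨γ a, (γ a).2, ?_⟩
    rintro _ ⟨t, ht, rfl⟩
    exact hpos rfl a (left_mem_Icc.2 hab) t ht
  -- The width lies between length and perimeter for every bounded convex `Q`, so the equality case
  -- also holds for every such `Q`; the hull is one of them.
  have key : ∀ Q : Set M.Surface, M.IsConvex Q → M.diam Q < ⊤ → γ '' Icc a b ⊆ Q →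
      M.length γ a b ≤ M.perimeter Q ∧ (M.length γ a b = M.perimeter Q →
        ∀ᵐ s : ℝ, s ∈ Icc a b → ∀ u, u ≠ 0 → M.HasVelocity γ a b s u →
          ∃ v₁ v₂, M.IsProjectingSector γ a s v₁ v₂ ∧ M.angle v₁ v₂ = Real.pi / 2 ∧
            ((∃ r : ℝ, u = r • v₁) ∨ (∃ r : ℝ, u = r • v₂))) := by
    intro Q hQ hQd hQγ
    obtain ⟨R, hR, hRA, hle⟩ := hQ.exists_isMotion_width_le_perimeter hQd hA hne
      (by rintro _ ⟨t, ht, rfl⟩; exact ⟨γ t, hQγ (mem_image_of_mem _ ht), rfl⟩) he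
    have hw : R '' SpaceForm.past γ a b = SpaceForm.past (fun t => hR.map (γ t)) a b :=
      image_image _ _ _
    rw [hw] at hle
    have hmain := hγ.length_le_width hab hpos hR fun t ht =>
      hRA.pos _ (mem_image_of_mem _ (mem_image_of_mem _ ht))
    exact ⟨hmain.1.trans hle, fun heq => hmain.2 (heq ▸ hle)⟩
  obtain ⟨Q, hQ, hQd, hQγ⟩ := SpaceForm.exists_isConvex_superset (B := γ '' Icc a b) hA
    (by rintro _ ⟨t, ht, rfl⟩; exact mem_image_of_mem _ ht) he
  have hhull := key _ (SpaceForm.isConvex_hull hQ hQγ)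
    ((SpaceForm.diam_hull_le hQ hQγ).trans_lt hQd) (SpaceForm.subset_hull _)
  exact ⟨hhull.1, hhull.2, fun Q hQ hQd hQγ => (key Q hQ hQd hQγ).1⟩
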